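/- Fix a dimension $d$, two different probability distributions $F_1\neq F_2$ on $\mathbb R^d$ with $\int\|x\|\,dF_k(x)<\infty$ ($k=1,2$), a number $\theta\in(0,1)$, and real numbers $\delta_n$ with $\delta_n\to0$ and $n\delta_n\to\infty$. Put $\tau_n=\lfloor n\theta\rfloor$. For every $n$ let $\mathbf Z_1,\dots,\mathbf Z_n$ (more precisely $\mathbf Z_{n,1},\dots,\mathbf Z_{n,n}$, all defined on one probability space) be independent, with $\mathbf Z_1,\dots,\mathbf Z_{\tau_n}\sim F_1$ and $\mathbf Z_{\tau_n+1},\dots,\mathbf Z_n\sim F_2$. With the Euclidean norm let $$T_{11}(t)=\binom t2^{-1}\sum_{1\le i<j\le t}\|\mathbf Z_i-\mathbf Z_j\|,\quad T_{22}(t)=\binom{n-t}2^{-1}\sum_{t<i<j\le n}\|\mathbf Z_i-\mathbf Z_j\|,\quad T_{12}(t)=\frac1{t(n-t)}\sum_{i\le t<j}\|\mathbf Z_i-\mathbf Z_j\|,$$ $$S_n(t)=\frac{t(n-t)}{n^2}\Big[\{T_{12}(t)-T_{11}(t)\}^2+\{T_{12}(t)-T_{22}(t)\}^2\Big],\qquad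 \mathcal A_n=\{\lfloor n\delta_n\rfloor,\dots,\lceil n(1-\delta_n)\rceil\}.$$ Let $\widehat T_n$ be any maximiser of $S_n(t)$ over $t\in\mathcal A_n$, let $\widehat S_n=\max_{t\in\mathcal A_n}S_n(t)$, and for a permutation $\pi$ of $\{1,\dots,n\}$ let $\widehat S_n^{(\pi)}$ be $\widehat S_n$ computed from $\mathbf Z_{\pi(1)},\dots,\mathbf Z_{\pi(n)}$. For $0<\alpha<1$ let $c_{1-\alpha}(n)=\inf\{x\ge0:\ \frac1{n!}\sum_\pi\mathbf 1[\widehat S_n^{(\pi)}\le x]\ge1-\alpha\}$; $\widehat T_n$ is detected as the change-point at level $\alpha$ if $\widehat S_n>c_{1-\alpha}(n)$. Then: (a) $\widehat\theta_n=\widehat T_n/n$ converges to $\theta$ almost surely, in each of the following two cases: (i) the samples of different sizes are nested, that is, they are drawn from one sequence of $F_1$-observations and one sequence of $F_2$-observations, each enumerated from the outer end of the sample towards the change: for all $m,n$, $\mathbf Z_{m,i}=\mathbf Z_{n,i}$ whenever $i\le\min(\tau_m,\tau_n)$, and $\mathbf Z_{m,m+1-j}=\mathbf Z_{n,n+1-j}$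 whenever $1\le j\le\min(m-\tau_m,\,n-\tau_n)$; (ii) the joint law of the samples of different sizes is arbitrary, and $\int\|x\|^4\,dF_k(x)<\infty$ for $k=1,2$. (b) If $F_1$ and $F_2$ are sub-exponential, i.e. for some $K>0$ and every unit vector $v$, $\int\exp(|\langle v,x\rangle|/K)\,dF_k(x)\le2$ ($k=1,2$), then for every $\alpha\in(0,1)$ and whatever the joint law of the samples of different sizes, $\widehat T_n$ is detected as the change-point at level $\alpha$ with probability tending to one as $n\to\infty$. -/

import Mathlib

open MeasureTheory ProbabilityTheory Filter Topology
open scoped ENNReal Nat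

namespace ChangePoint

/-- `d`-dimensional observations; the norm is the Euclidean (`ℓ₂`) one. -/
abbrev Vec (d : ℕ) : Type := EuclideanSpace ℝ (Fin d)

variable {d n : ℕ}

/-! The sample `z 0, …, z (n - 1)` is split at `t` into the first `t` observations (those with
index `< t`) and the last `n - t` observations (those with index `≥ t`). -/

/-- Average pairwise distance within the first `t` observations. -/
noncomputable def T11 (z : Fin n → Vec d) (t : ℕ) : ℝ :=
  (t.choose 2 : ℝ)⁻¹ *
    ∑ p : Fin n × Fin n with p.1 < p.2 ∧ (p.2 : ℕ) < t, ‖z p.1 - z p.2‖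

/-- Average pairwise distance within the last `n - t` observations. -/
noncomputable def T22 (z : Fin n → Vec d) (t : ℕ) : ℝ :=
  ((n - t).choose 2 : ℝ)⁻¹ *
    ∑ p : Fin n × Fin n with p.1 < p.2 ∧ t ≤ (p.1 : ℕ), ‖z p.1 - z p.2‖

/-- Average distance between the first `t` and the last `n - t` observations. -/
noncomputable def T12 (z : Fin n → Vec d) (t : ℕ) : ℝ :=
  ((t : ℝ) * ((n : ℝ) - t))⁻¹ *
    ∑ p : Fin n × Fin n with (p.1 : ℕ) < t ∧ t ≤ (p.2 : ℕ), ‖z p.1 - z p.2‖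

/-- The empirical divergence between the two parts of the sample. -/
noncomputable def divergence (z : Fin n → Vec d) (t : ℕ) : ℝ :=
  (T12 z t - T11 z t) ^ 2 + (T12 z t - T22 z t) ^ 2

/-- The weighted criterion `t (n - t) / n² * D_n(t)`. -/
noncomputable def criterion (z : Fin n → Vec d) (t : ℕ) : ℝ :=
  (t : ℝ) * ((n : ℝ) - t) / (n : ℝ) ^ 2 * divergence z t

/-- The search range `{⌊n δ⌋, …, ⌈n (1 - δ)⌉}`. -/
noncomputable def searchRange (n : ℕ) (δ : ℝ) : Finset ℕ :=
  Finset.Icc ⌊(n : ℝ) * δ⌋₊ ⌈(n : ℝ) * (1 - δ)⌉₊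

/-- `t` is a potential change-point: a maximiser of the criterion over the search range. -/
def IsPotentialChangePoint (δ : ℝ) (z : Fin n → Vec d) (t : ℕ) : Prop :=
  t ∈ searchRange n δ ∧ ∀ s ∈ searchRange n δ, criterion z s ≤ criterion z t

/-- The test statistic: the maximum of the criterion over the search range. -/
noncomputable def testStatistic (δ : ℝ) (z : Fin n → Vec d) : ℝ :=
  ⨆ t : {t : ℕ // t ∈ searchRange n δ}, criterion z t

/-- The permutation cut-off: the `1 - α` quantile of the test statistic computed on all the
`n !` rearrangements of the sample. -/
noncomputable def permutationCutoff (δ α : ℝ) (z : Fin n → Vec d) : ℝ :=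
  sInf {x : ℝ | 0 ≤ x ∧
    1 - α ≤ ((Finset.univ.filter fun π : Equiv.Perm (Fin n) =>
      testStatistic δ (fun i => z (π i)) ≤ x).card : ℝ) / (n ! : ℝ)}

/-- `t` is detected as the change-point at level `α`: it is the potential change-point, and the
test statistic exceeds the permutation cut-off. -/
def IsDetectedChangePoint (δ α : ℝ) (z : Fin n → Vec d) (t : ℕ) : Prop :=
  IsPotentialChangePoint δ z t ∧ permutationCutoff δ α z < testStatistic δ z

/-- `F` is sub-exponential: the `ψ₁`-norms of its one-dimensional projections,
`inf {c > 0 | E exp (|⟨v, X⟩| / c) ≤ 2}`, are bounded uniformly over the unit vectors `v`. -/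
def IsSubExponential (F : Measure (Vec d)) : Prop :=
  ∃ K : ℝ, 0 < K ∧ ∀ v : Vec d, ‖v‖ = 1 →
    ∫⁻ x, ENNReal.ofReal (Real.exp (|inner ℝ v x| / K)) ∂F ≤ 2

variable {Ω : Type*} [MeasurableSpace Ω]

/-- For every `n`, the row `Z n 0, …, Z n (n - 1)` consists of independent observations, the
first `τ n` of which have law `F₁` and the others law `F₂`. Nothing is said about the joint law
of different rows. -/
structure IsSingleChangeModel (P : Measure Ω) (Z : (n : ℕ) → Fin n → Ω → Vec d)
    (τ : ℕ → ℕ) (F₁ F₂ : Measure (Vec d)) : Prop where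
  indep : ∀ n, iIndepFun (Z n) P
  law_before : ∀ (n : ℕ) (i : Fin n), (i : ℕ) < τ n → HasLaw (Z n i) F₁ P
  law_after : ∀ (n : ℕ) (i : Fin n), τ n ≤ (i : ℕ) → HasLaw (Z n i) F₂ P

/-- The samples of different sizes are drawn from one sequence of `F₁`-observations and one
sequence of `F₂`-observations, each enumerated from the outer end of the sample towards the
change: a pre-change observation depends only on its position counted from the beginning, a
post-change observation only on its position counted from the end (`Fin.rev`). -/
def IsNested (Z : (n : ℕ) → Fin n → Ω → Vec d) (τ : ℕ → ℕ) : Prop :=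
  (∀ (m n : ℕ) (i : Fin m) (j : Fin n), (i : ℕ) < τ m → (j : ℕ) < τ n →
    (i : ℕ) = (j : ℕ) → Z m i = Z n j) ∧
  (∀ (m n : ℕ) (i : Fin m) (j : Fin n), τ m ≤ (i : ℕ) → τ n ≤ (j : ℕ) →
    (i.rev : ℕ) = (j.rev : ℕ) → Z m i = Z n j)

end ChangePoint

set_option linter.unusedSectionVars false

namespace ChangePoint

/-! Let `a`, `b`, `c` be the mean distances within `F₁`, within `F₂` and between them. The energy
distance `2c - a - b` is positive for `F₁ ≠ F₂` (`energy_pos`): on the line it is twice the squared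
`L²` distance of the distribution functions, and in `Vec d` a multiple of it is the average of the
energy distances of the one-dimensional projections. Hence `S = (c - a)² + (c - b)²` is positive.

If `t/n → γ` with `0 < γ < 1`, the empirical measures of the two parts converge, on functions of
linear growth, to combinations of `F₁` and `F₂`. So the normalised pair sums converge
(`EmpiricalLimit.tendsto_pairSum`), and with them the criterion. Its limit is `θ(1 - θ)S` at `γ =
θ`, at most `γ(1 - θ)S` on the left (`limit_criterion_le`) and, by reversing the sample, at most `(1
- γ)θS` on the right. At `γ = 0` and `γ = 1` the limit is zero, because sums of norms over the short
part are controlled (`FrontControl`). By compactness of `[0, 1]`, along every ultrafilter the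
fraction of the maximiser has a limit, and maximality forces this limit to be `θ`
(`TwoSidedControl.tendsto_maximiser`). No uniform convergence in `t` has to be stated: the split is
an arbitrary selection, and partial sums of nonnegative terms are monotone in it.

All limits are taken along filters on pairs `(n, ω)`, so one argument serves both almost sure
convergence and convergence in probability. The control comes from the strong law for nested
samples. With fourth moments it comes from the bound `O(n²)` for the fourth moment of a centred sum:
divided by `n⁴` this is summable, so the joint law of the rows is irrelevant.

For the test, partial sums of a randomly permuted sample have small variance (`sum_perm_sq_le`).
Both parts of the permuted sample then look like `θF₁ + (1 - θ)F₂`, the three mean distances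
coincide, and the permuted statistic is small for most permutations. The cut-off falls below half of
`θ(1 - θ)S`, which the criterion at the change exceeds with probability tending to one. -/

/-- The mean distance between independent points with laws `μ` and `ν`. -/
noncomputable def meanDist {E : Type*} [NormedAddCommGroup E] [MeasurableSpace E]
    (μ ν : Measure E) : ℝ :=
  ∫ p : E × E, ‖p.1 - p.2‖ ∂(μ.prod ν)

lemma integral_two_mul_sub_sub {α : Type*} [MeasurableSpace α] {ρ : Measure α} {f g h : α → ℝ}
    (hf : Integrable f ρ) (hg : Integrable g ρ) (hh : Integrable h ρ) :
    ∫ x, (2 * f x - g x - h x) ∂ρ = 2 * ∫ x, f x ∂ρ - ∫ x, g x ∂ρ - ∫ x, h x ∂ρ := by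
  have h1 := integral_sub ((hf.const_mul 2).sub hg) hh
  have h2 := integral_sub (hf.const_mul 2) hg
  simp only [Pi.sub_apply] at h1
  rw [h1, h2, integral_const_mul]

/-! ### Energy distance on the line -/

section Line

variable (μ ν : Measure ℝ)

/-- The pairs `(p, s)` for which `s` separates the coordinates of `p`. -/
def separatingSet : Set ((ℝ × ℝ) × ℝ) :=
  {q | (q.1.1 ≤ q.2 ∧ q.2 < q.1.2) ∨ (q.1.2 ≤ q.2 ∧ q.2 < q.1.1)}

lemma measurableSet_separatingSet : MeasurableSet separatingSet := by
  unfold separatingSet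
  measurability

lemma volume_separating (x y : ℝ) :
    volume {s : ℝ | (x ≤ s ∧ s < y) ∨ (y ≤ s ∧ s < x)} = ENNReal.ofReal ‖x - y‖ := by
  rcases le_total x y with h | h
  · have : {s : ℝ | (x ≤ s ∧ s < y) ∨ (y ≤ s ∧ s < x)} = Set.Ico x y := by
      ext s; simp only [Set.mem_ofPred_eq, Set.mem_Ico]; grind
    rw [this, Real.volume_Ico, Real.norm_eq_abs, abs_sub_comm, abs_of_nonneg (by linarith)]
  · have : {s : ℝ | (x ≤ s ∧ s < y) ∨ (y ≤ s ∧ s < x)} = Set.Ico y x := by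
      ext s; simp only [Set.mem_ofPred_eq, Set.mem_Ico]; grind
    rw [this, Real.volume_Ico, Real.norm_eq_abs, abs_of_nonneg (by linarith)]

lemma cdf_cross_nonneg (s : ℝ) : 0 ≤ cdf μ s * (1 - cdf ν s) + cdf ν s * (1 - cdf μ s) := by
  have n1 := cdf_nonneg μ s
  have n2 := cdf_nonneg ν s
  have n3 : 0 ≤ 1 - cdf μ s := by linarith [cdf_le_one μ s]
  have n4 : 0 ≤ 1 - cdf ν s := by linarith [cdf_le_one ν s]
  positivity

lemma measurable_cdf_cross :
    Measurable fun s => cdf μ s * (1 - cdf ν s) + cdf ν s * (1 - cdf μ s) := by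
  have h1 : Measurable (cdf μ) := (monotone_cdf μ).measurable
  have h2 : Measurable (cdf ν) := (monotone_cdf ν).measurable
  fun_prop

variable [IsProbabilityMeasure μ] [IsProbabilityMeasure ν]

lemma prod_separating (s : ℝ) :
    (μ.prod ν) {p : ℝ × ℝ | (p.1 ≤ s ∧ s < p.2) ∨ (p.2 ≤ s ∧ s < p.1)} =
      ENNReal.ofReal (cdf μ s * (1 - cdf ν s) + cdf ν s * (1 - cdf μ s)) := by
  have h1 : {p : ℝ × ℝ | (p.1 ≤ s ∧ s < p.2) ∨ (p.2 ≤ s ∧ s < p.1)} =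
      Set.Iic s ×ˢ Set.Ioi s ∪ Set.Ioi s ×ˢ Set.Iic s := by
    ext p; simp only [Set.mem_ofPred_eq, Set.mem_union, Set.mem_prod, Set.mem_Iic, Set.mem_Ioi]
    grind
  have hd : Disjoint (Set.Iic s ×ˢ Set.Ioi s : Set (ℝ × ℝ)) (Set.Ioi s ×ˢ Set.Iic s) := by
    rw [Set.disjoint_left]
    intro p hp hq
    simp only [Set.mem_prod, Set.mem_Iic, Set.mem_Ioi] at hp hq
    linarith [hp.1, hq.1]
  have hIic : ∀ (ρ : Measure ℝ) [IsProbabilityMeasure ρ],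
      ρ (Set.Iic s) = ENNReal.ofReal (cdf ρ s) := fun ρ _ => (ofReal_cdf ρ s).symm
  have hIoi : ∀ (ρ : Measure ℝ) [IsProbabilityMeasure ρ],
      ρ (Set.Ioi s) = ENNReal.ofReal (1 - cdf ρ s) := by
    intro ρ _
    rw [← Set.compl_Iic, prob_compl_eq_one_sub measurableSet_Iic, hIic,
      ENNReal.ofReal_sub _ (cdf_nonneg ρ s), ENNReal.ofReal_one]
  have n1 := cdf_nonneg μ s
  have n2 := cdf_nonneg ν s
  have n3 : 0 ≤ 1 - cdf μ s := by linarith [cdf_le_one μ s]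
  have n4 : 0 ≤ 1 - cdf ν s := by linarith [cdf_le_one ν s]
  rw [h1, measure_union hd (measurableSet_Ioi.prod measurableSet_Iic), Measure.prod_prod,
    Measure.prod_prod, hIic, hIic, hIoi, hIoi, ← ENNReal.ofReal_mul n1, ← ENNReal.ofReal_mul n3,
    ← ENNReal.ofReal_add (by positivity) (by positivity)]
  ring_nf

/-- The distance `|x - y|` is the length of the set of points `s` separating `x` from `y`. Tonelli
on `separatingSet` trades this length for the probability that a given `s` separates. -/
lemma lintegral_dist_eq_lintegral_cdf :
    ∫⁻ p, ENNReal.ofReal ‖p.1 - p.2‖ ∂(μ.prod ν) =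
      ∫⁻ s, ENNReal.ofReal (cdf μ s * (1 - cdf ν s) + cdf ν s * (1 - cdf μ s)) := by
  have h1 := Measure.prod_apply (μ := μ.prod ν) (ν := (volume : Measure ℝ))
    measurableSet_separatingSet
  have h2 := Measure.prod_apply_symm (μ := μ.prod ν) (ν := (volume : Measure ℝ))
    measurableSet_separatingSet
  rw [h1] at h2
  convert h2 using 1
  · exact lintegral_congr fun p => (volume_separating p.1 p.2).symm
  · exact lintegral_congr fun s => (prod_separating μ ν s).symm

variable {μ ν}

lemma integrable_cdf_cross (h : Integrable (fun p : ℝ × ℝ => ‖p.1 - p.2‖) (μ.prod ν)) :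
    Integrable fun s => cdf μ s * (1 - cdf ν s) + cdf ν s * (1 - cdf μ s) := by
  refine ⟨(measurable_cdf_cross μ ν).aestronglyMeasurable, ?_⟩
  rw [hasFiniteIntegral_iff_ofReal (ae_of_all _ (cdf_cross_nonneg μ ν)),
    ← lintegral_dist_eq_lintegral_cdf]
  exact (hasFiniteIntegral_iff_ofReal (ae_of_all _ fun p => norm_nonneg _)).1 h.2

lemma meanDist_eq_integral_cdf :
    meanDist μ ν = ∫ s, cdf μ s * (1 - cdf ν s) + cdf ν s * (1 - cdf μ s) := by
  unfold meanDist
  rw [integral_eq_lintegral_of_nonneg_ae (ae_of_all _ fun p => norm_nonneg _)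
      (by fun_prop),
    integral_eq_lintegral_of_nonneg_ae (ae_of_all _ (cdf_cross_nonneg μ ν))
      (measurable_cdf_cross μ ν).aestronglyMeasurable, lintegral_dist_eq_lintegral_cdf]

lemma integrable_dist_prod {E : Type*} [NormedAddCommGroup E] [MeasurableSpace E] [BorelSpace E]
    [SecondCountableTopology E] {μ ν : Measure E} [IsFiniteMeasure μ] [IsFiniteMeasure ν]
    (hμ : Integrable (fun x => x) μ) (hν : Integrable (fun x => x) ν) :
    Integrable (fun p : E × E => ‖p.1 - p.2‖) (μ.prod ν) :=
  ((hμ.comp_fst ν).sub (hν.comp_snd μ)).norm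

/-- On the line, the energy distance is twice the squared `L²` distance of the distribution
functions. -/
lemma energy_eq_integral_sq_cdf (hμ : Integrable (fun x => x) μ) (hν : Integrable (fun x => x) ν) :
    Integrable (fun s => 2 * (cdf μ s - cdf ν s) ^ 2) ∧
    2 * meanDist μ ν - meanDist μ μ - meanDist ν ν = ∫ s, 2 * (cdf μ s - cdf ν s) ^ 2 := by
  have i1 := integrable_cdf_cross (integrable_dist_prod hμ hν)
  have i2 := integrable_cdf_cross (integrable_dist_prod hμ hμ)
  have i3 := integrable_cdf_cross (integrable_dist_prod hν hν)
  have key : (fun s => 2 * (cdf μ s - cdf ν s) ^ 2) = fun s =>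
      2 * (cdf μ s * (1 - cdf ν s) + cdf ν s * (1 - cdf μ s)) -
      (cdf μ s * (1 - cdf μ s) + cdf μ s * (1 - cdf μ s)) -
      (cdf ν s * (1 - cdf ν s) + cdf ν s * (1 - cdf ν s)) := by
    funext s; ring
  rw [key]
  refine ⟨((i1.const_mul 2).sub i2).sub i3, ?_⟩
  rw [integral_two_mul_sub_sub i1 i2 i3, meanDist_eq_integral_cdf, meanDist_eq_integral_cdf,
    meanDist_eq_integral_cdf]

lemma energy_nonneg_real (hμ : Integrable (fun x => x) μ) (hν : Integrable (fun x => x) ν) :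
    0 ≤ 2 * meanDist μ ν - meanDist μ μ - meanDist ν ν := by
  rw [(energy_eq_integral_sq_cdf hμ hν).2]
  exact integral_nonneg fun s => by positivity

/-- A vanishing integral of squares makes the distribution functions equal almost everywhere; right
continuity upgrades this to equality everywhere. -/
lemma eq_of_energy_eq_zero_real (hμ : Integrable (fun x => x) μ)
    (hν : Integrable (fun x => x) ν)
    (h : 2 * meanDist μ ν - meanDist μ μ - meanDist ν ν = 0) : μ = ν := by
  obtain ⟨hi, he⟩ := energy_eq_integral_sq_cdf hμ hν
  rw [h, eq_comm, integral_eq_zero_iff_of_nonneg (fun s => by positivity) hi] at he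
  apply Measure.eq_of_cdf
  ext s
  have hae : ∀ᵐ s, cdf μ s = cdf ν s := by
    filter_upwards [he] with s hs
    have : (cdf μ s - cdf ν s) ^ 2 = 0 := by simpa using hs
    nlinarith [pow_eq_zero_iff (two_ne_zero) |>.1 this]
  -- A null set contains no interval `(s, u)`, so points of equality accumulate at `s` from the
  -- right.
  have hfreq : ∃ᶠ y in 𝓝[>] s, cdf μ y = cdf ν y := by
    intro hev
    have h2 : ∀ᶠ y in 𝓝[>] s, ¬ cdf μ y = cdf ν y := hev
    obtain ⟨u, hu, hsub⟩ := mem_nhdsGT_iff_exists_Ioo_subset.1 h2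
    have hz : volume (Set.Ioo s u) = 0 :=
      measure_mono_null (fun y hy => hsub hy) (ae_iff.1 hae)
    rw [Real.volume_Ioo, ENNReal.ofReal_eq_zero] at hz
    simp only [Set.mem_Ioi] at hu
    linarith
  have c : ∀ (ρ : Measure ℝ), Tendsto (cdf ρ) (𝓝[>] s) (𝓝 (cdf ρ s)) := fun ρ =>
    ((cdf ρ).right_continuous s).mono Set.Ioi_subset_Ici_self
  have hd := ((c μ).sub (c ν))
  by_contra hne
  exact hfreq ((hd.eventually_ne (sub_ne_zero.2 hne)).mono fun y hy => sub_ne_zero.1 hy)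

end Line

/-! ### Energy distance in Euclidean space, by projection -/

section Euclidean

variable {d : ℕ}

/-- Averages of `|⟪g, x⟫|` over `g` in the unit ball are a multiple of `‖x‖`. -/
lemma exists_integral_abs_inner :
    ∃ κ : ℝ, 0 ≤ κ ∧ ∀ x : Vec d,
      ∫ g in Metric.ball (0 : Vec d) 1, |inner ℝ g x| = κ * ‖x‖ := by
  by_cases h0 : ∃ e : Vec d, ‖e‖ = 1
  · obtain ⟨e, he⟩ := h0
    refine ⟨∫ g in Metric.ball (0 : Vec d) 1, |inner ℝ g e|,
      integral_nonneg fun g => abs_nonneg _, fun x => ?_⟩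
    have hn : ‖x‖ = ‖‖x‖ • e‖ := by simp [norm_smul, he]
    -- The reflection taking `x` to `‖x‖ • e` preserves both the volume and the unit ball, so only
    -- the norm of `x` matters.
    set R := (Submodule.reflection (ℝ ∙ (x - ‖x‖ • e))ᗮ) with hR
    have hRx : R x = ‖x‖ • e := Submodule.reflection_sub hn
    have hpre : R ⁻¹' Metric.ball 0 1 = Metric.ball (0 : Vec d) 1 := by
      ext g; simp
    have := R.measurePreserving.setIntegral_preimage_emb
      R.toHomeomorph.measurableEmbedding (fun g => |inner ℝ g (‖x‖ • e)|) (Metric.ball 0 1)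
    rw [hpre] at this
    rw [← integral_mul_const]
    calc ∫ g in Metric.ball (0 : Vec d) 1, |inner ℝ g x|
        = ∫ g in Metric.ball (0 : Vec d) 1, |inner ℝ (R g) (‖x‖ • e)| := by
          simp_rw [← hRx, LinearIsometryEquiv.inner_map_map]
      _ = _ := by
          rw [this]
          simp [inner_smul_right, abs_mul, mul_comm]
  -- Without a unit vector the space is trivial.
  · refine ⟨0, le_rfl, fun x => ?_⟩
    have : x = 0 := by
      by_contra hx
      exact h0 ⟨(‖x‖)⁻¹ • x, by rw [norm_smul, norm_inv, norm_norm,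
        inv_mul_cancel₀ (norm_ne_zero_iff.2 hx)]⟩
    simp [this]

variable (F G : Measure (Vec d)) [IsProbabilityMeasure F] [IsProbabilityMeasure G]

lemma meanDist_map_inner (g : Vec d) :
    meanDist (F.map fun x => inner ℝ g x) (G.map fun x => inner ℝ g x) =
      ∫ p : Vec d × Vec d, |inner ℝ g (p.1 - p.2)| ∂(F.prod G) := by
  unfold meanDist
  rw [Measure.map_prod_map F G (f := fun x => inner ℝ g x) (g := fun x => inner ℝ g x)
    (by fun_prop) (by fun_prop), integral_map (by fun_prop) (by fun_prop)]
  simp [inner_sub_right]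

variable {F G}

/-- For `g` in the unit ball, Cauchy–Schwarz dominates the integrand by the distance of the two
points. This justifies Fubini in `integral_ball_meanDist`. -/
lemma integrable_abs_inner_prod (hF : Integrable (fun x => x) F) (hG : Integrable (fun x => x) G) :
    Integrable (fun q : Vec d × (Vec d × Vec d) => |inner ℝ q.1 (q.2.1 - q.2.2)|)
      ((volume.restrict (Metric.ball (0 : Vec d) 1)).prod (F.prod G)) := by
  have : IsFiniteMeasure (volume.restrict (Metric.ball (0 : Vec d) 1)) :=
    ⟨by rw [Measure.restrict_apply_univ]; exact measure_ball_lt_top⟩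
  have h1 := (integrable_dist_prod hF hG).comp_snd (volume.restrict (Metric.ball (0 : Vec d) 1))
  refine h1.mono' (by fun_prop) ?_
  have h2 : ∀ᵐ g ∂(volume.restrict (Metric.ball (0 : Vec d) 1)), ‖g‖ ≤ 1 := by
    filter_upwards [ae_restrict_mem measurableSet_ball] with g hg
    exact (mem_ball_zero_iff.1 hg).le
  have h3 := Measure.quasiMeasurePreserving_fst
    (μ := volume.restrict (Metric.ball (0 : Vec d) 1)) (ν := F.prod G) |>.ae h2
  filter_upwards [h3] with q hq
  rw [Real.norm_eq_abs, abs_abs]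
  calc |inner ℝ q.1 (q.2.1 - q.2.2)| ≤ ‖q.1‖ * ‖q.2.1 - q.2.2‖ := abs_real_inner_le_norm _ _
    _ ≤ 1 * ‖q.2.1 - q.2.2‖ := by gcongr
    _ = _ := one_mul _

/-- Exchanging the average over directions with the expectation turns the averaged mean distance of
the projections into `κ` times the mean distance in space. -/
lemma integral_ball_meanDist {κ : ℝ}
    (hκ : ∀ x : Vec d, ∫ g in Metric.ball (0 : Vec d) 1, |inner ℝ g x| = κ * ‖x‖)
    (hF : Integrable (fun x => x) F) (hG : Integrable (fun x => x) G) :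
    IntegrableOn (fun g : Vec d =>
      meanDist (F.map fun x => inner ℝ g x) (G.map fun x => inner ℝ g x)) (Metric.ball 0 1) ∧
    ∫ g in Metric.ball (0 : Vec d) 1,
      meanDist (F.map fun x => inner ℝ g x) (G.map fun x => inner ℝ g x) =
      κ * meanDist F G := by
  have : IsFiniteMeasure (volume.restrict (Metric.ball (0 : Vec d) 1)) :=
    ⟨by rw [Measure.restrict_apply_univ]; exact measure_ball_lt_top⟩
  simp_rw [meanDist_map_inner]
  have hi := integrable_abs_inner_prod hF hG
  refine ⟨hi.integral_prod_left, ?_⟩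
  rw [integral_integral_swap hi]
  simp_rw [hκ]
  rw [integral_const_mul, meanDist]

/-- The energy distance between different laws with finite mean is positive. -/
theorem energy_pos (hF : Integrable (fun x => x) F) (hG : Integrable (fun x => x) G)
    (hne : F ≠ G) : 0 < 2 * meanDist F G - meanDist F F - meanDist G G := by
  obtain ⟨κ, hκ0, hκ⟩ := exists_integral_abs_inner (d := d)
  set e : Vec d → ℝ := fun g =>
    2 * meanDist (F.map fun x => inner ℝ g x) (G.map fun x => inner ℝ g x) -
    meanDist (F.map fun x => inner ℝ g x) (F.map fun x => inner ℝ g x) -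
    meanDist (G.map fun x => inner ℝ g x) (G.map fun x => inner ℝ g x) with he
  have pm : ∀ (H : Measure (Vec d)) [IsProbabilityMeasure H] (g : Vec d),
      IsProbabilityMeasure (H.map fun x => inner ℝ g x) := fun H _ g =>
    Measure.isProbabilityMeasure_map (by fun_prop)
  have im : ∀ (H : Measure (Vec d)) [IsProbabilityMeasure H] (_ : Integrable (fun x => x) H)
      (g : Vec d), Integrable (fun y => y) (H.map fun x => inner ℝ g x) := by
    intro H _ hH g
    rw [integrable_map_measure (by fun_prop) (by fun_prop)]
    exact hH.const_inner g
  obtain ⟨i1, e1⟩ := integral_ball_meanDist hκ hF hG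
  obtain ⟨i2, e2⟩ := integral_ball_meanDist hκ hF hF
  obtain ⟨i3, e3⟩ := integral_ball_meanDist hκ hG hG
  have hei : IntegrableOn e (Metric.ball 0 1) := ((i1.const_mul 2).sub i2).sub i3
  have hint : ∫ g in Metric.ball (0 : Vec d) 1, e g =
      κ * (2 * meanDist F G - meanDist F F - meanDist G G) := by
    rw [he, integral_two_mul_sub_sub i1 i2 i3, e1, e2, e3]
    ring
  have hnn : ∀ g, 0 ≤ e g := fun g => by
    have := pm F g
    have := pm G g
    exact energy_nonneg_real (im F hF g) (im G hG g)
  -- Only `κ ≥ 0` is needed: if the energy were nonpositive, the nonnegative projected energies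
  -- would have a nonpositive average and so vanish for almost every direction.
  by_contra hle
  push Not at hle
  have hz : ∫ g in Metric.ball (0 : Vec d) 1, e g = 0 := by
    apply le_antisymm
    · rw [hint]; exact mul_nonpos_of_nonneg_of_nonpos hκ0 hle
    · exact integral_nonneg hnn
  rw [integral_eq_zero_iff_of_nonneg hnn hei] at hz
  apply hne
  apply Measure.ext_of_charFun
  funext t
  -- For almost every `g` the projections on `g` have the same law, so the characteristic functions
  -- agree at every multiple of `g`.
  have hae : ∀ r : ℝ, (fun g => charFun F (r • g)) =ᵐ[volume.restrict (Metric.ball (0 : Vec d) 1)]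
      fun g => charFun G (r • g) := by
    intro r
    filter_upwards [hz] with g hg
    have := pm F g
    have := pm G g
    have hmap := eq_of_energy_eq_zero_real (im F hF g) (im G hG g) hg
    have h4 : ∀ (H : Measure (Vec d)) [IsProbabilityMeasure H],
        charFun H (r • g) = charFun (H.map fun x => inner ℝ g x) r := by
      intro H _
      rw [charFun_apply, charFun_apply_real, integral_map (by fun_prop) (by fun_prop)]
      simp [inner_smul_right, real_inner_comm]
    rw [h4 F, h4 G, hmap]
  -- Continuity removes the exceptional null set. The scale `2‖t‖` places `t` at the image of a
  -- point of norm `1/2`, inside the open ball.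
  have hon := Measure.eqOn_open_of_ae_eq (hae (2 * ‖t‖)) Metric.isOpen_ball
    (by fun_prop) (by fun_prop)
  by_cases ht : t = 0
  · simp [ht]
  have ht' : ‖t‖ ≠ 0 := norm_ne_zero_iff.2 ht
  have := hon (x := (2 * ‖t‖)⁻¹ • t) (by
    rw [mem_ball_zero_iff, norm_smul, norm_inv, norm_mul, norm_norm]
    field_simp
    norm_num)
  beta_reduce at this
  rwa [smul_smul, mul_inv_cancel₀ (by positivity), one_smul] at this

end Euclidean

/-! ### Convergence of pair sums from convergence of empirical measures -/

section PairSums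

variable {E : Type*} [NormedAddCommGroup E] [MeasurableSpace E] [BorelSpace E]

/-- Nonnegative measurable functions of at most linear growth. -/
def LinearGrowth (f : E → ℝ) : Prop :=
  Measurable f ∧ (∀ x, 0 ≤ f x) ∧ ∃ C : ℝ, ∀ x, f x ≤ C * (1 + ‖x‖)

lemma LinearGrowth.of_le {f : E → ℝ} (hm : Measurable f) (h0 : ∀ x, 0 ≤ f x) {C : ℝ}
    (hC : ∀ x, f x ≤ C * (1 + ‖x‖)) : LinearGrowth f := ⟨hm, h0, C, hC⟩

lemma linearGrowth_one : LinearGrowth (fun _ : E => (1 : ℝ)) :=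
  .of_le measurable_const (fun _ => zero_le_one) (C := 1) fun x => by
    linarith [norm_nonneg x]

lemma linearGrowth_norm : LinearGrowth (fun x : E => ‖x‖) :=
  .of_le measurable_norm (fun _ => norm_nonneg _) (C := 1) fun x => by linarith

lemma LinearGrowth.memLp {f : E → ℝ} (hf : LinearGrowth f) {μ : Measure E} [IsFiniteMeasure μ]
    {p : ℝ≥0∞} (h : MemLp (fun x => x) p μ) : MemLp f p μ := by
  obtain ⟨hm, h0, C, hC⟩ := hf
  have h1 : MemLp (fun x : E => 1 + ‖x‖) p μ := (memLp_const (1 : ℝ)).add h.norm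
  refine (h1.const_mul C).mono hm.aestronglyMeasurable (ae_of_all _ fun x => ?_)
  rw [Real.norm_of_nonneg (h0 x), Real.norm_eq_abs]
  exact (hC x).trans (le_abs_self _)

lemma LinearGrowth.integrable {f : E → ℝ} (hf : LinearGrowth f) {μ : Measure E}
    [IsFiniteMeasure μ] (h : Integrable (fun x => x) μ) : Integrable f μ :=
  memLp_one_iff_integrable.1 (hf.memLp (memLp_one_iff_integrable.2 h))

/-- The sum of the distances between the points of `z` indexed by `I` and those indexed by `J`. -/
noncomputable def pairSum {n : ℕ} (z : Fin n → E) (I J : Finset (Fin n)) : ℝ :=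
  ∑ i ∈ I, ∑ j ∈ J, ‖z i - z j‖

/-- Along `l`, the empirical measures `(N k)⁻¹ ∑ i ∈ I k, dirac (z k i)` converge to `μ` on functions
of linear growth. -/
def EmpiricalLimit {ι : Type*} (l : Filter ι) (N : ι → ℕ) (z : (k : ι) → Fin (N k) → E)
    (I : (k : ι) → Finset (Fin (N k))) (μ : Measure E) : Prop :=
  ∀ f : E → ℝ, LinearGrowth f →
    Tendsto (fun k => (N k : ℝ)⁻¹ * ∑ i ∈ I k, f (z k i)) l (𝓝 (∫ x, f x ∂μ))

/-- The indicator function of a fibre of a simple function. -/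
noncomputable def fiberIndicator (ψ : SimpleFunc E E) (a x : E) : ℝ :=
  (ψ ⁻¹' {a}).indicator (fun _ => 1) x

/-- After discretisation the distance is a finite sum of products of a function of `x` and a
function of `y`. Double sums therefore factor into products of empirical averages. -/
lemma norm_simpleFunc_sub (ψ : SimpleFunc E E) (x y : E) :
    ‖ψ x - ψ y‖ = ∑ a ∈ ψ.range, ∑ b ∈ ψ.range,
      ‖a - b‖ * (fiberIndicator ψ a x * fiberIndicator ψ b y) := by
  rw [Finset.sum_eq_single (ψ x), Finset.sum_eq_single (ψ y)]
  · simp [fiberIndicator]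
  · intro b _ hb
    simp [fiberIndicator, hb.symm]
  · intro h; exact absurd (ψ.mem_range_self y) h
  · intro a _ ha
    simp [fiberIndicator, ha.symm]
  · intro h; exact absurd (ψ.mem_range_self x) h

lemma linearGrowth_fiberIndicator (ψ : SimpleFunc E E) (a : E) :
    LinearGrowth (fiberIndicator ψ a) := by
  refine .of_le (measurable_const.indicator (ψ.measurableSet_fiber a)) (fun x => ?_)
    (C := 1) fun x => ?_
  · exact Set.indicator_nonneg (fun _ _ => zero_le_one) x
  · have : fiberIndicator ψ a x ≤ 1 := Set.indicator_le_self' (fun _ _ => zero_le_one) x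
    linarith [norm_nonneg x]

variable [SecondCountableTopology E]

/-- The discretisation error is itself an admissible test function, so its empirical averages
converge too. -/
lemma linearGrowth_norm_sub_simpleFunc (ψ : SimpleFunc E E) :
    LinearGrowth fun x => ‖x - ψ x‖ := by
  obtain ⟨C, hC⟩ : ∃ C, ∀ x, ‖ψ x‖ ≤ C := ψ.exists_forall_norm_le
  refine .of_le (measurable_id.sub ψ.measurable).norm (fun x => norm_nonneg _)
    (C := 1 + C) fun x => ?_
  have h1 := norm_sub_le x (ψ x)
  have h2 := hC x
  have h3 := norm_nonneg (ψ x)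
  nlinarith [norm_nonneg x, mul_nonneg (h3.trans h2) (norm_nonneg x)]

lemma abs_norm_sub_sub_le (ψ : SimpleFunc E E) (x y : E) :
    |‖x - y‖ - ‖ψ x - ψ y‖| ≤ ‖x - ψ x‖ + ‖y - ψ y‖ := by
  have h := abs_norm_sub_norm_le (x - y) (ψ x - ψ y)
  have h2 : x - y - (ψ x - ψ y) = (x - ψ x) - (y - ψ y) := by abel
  rw [h2] at h
  exact h.trans (norm_sub_le _ _)

/-- If two families of empirical measures converge, so do the normalised pair sums. -/
theorem EmpiricalLimit.tendsto_pairSum {ι : Type*} {l : Filter ι} {N : ι → ℕ}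
    {z : (k : ι) → Fin (N k) → E} {I J : (k : ι) → Finset (Fin (N k))} {μ ν : Measure E}
    [IsFiniteMeasure μ] [IsFiniteMeasure ν]
    (hμ : Integrable (fun x => x) μ) (hν : Integrable (fun x => x) ν)
    (hI : EmpiricalLimit l N z I μ) (hJ : EmpiricalLimit l N z J ν) :
    Tendsto (fun k => pairSum (z k) (I k) (J k) / (N k : ℝ) ^ 2) l (𝓝 (meanDist μ ν)) := by
  rw [Metric.tendsto_nhds]
  intro η hη
  have hmass : 0 < 3 * (μ.real Set.univ + ν.real Set.univ + 1) := by positivity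
  -- With this `ε` the limiting error `r` is at most `ε` times the total masses, hence below `η /
  -- 3`; the summand `1` keeps the denominator positive.
  set ε := η / (3 * (μ.real Set.univ + ν.real Set.univ + 1)) with hε
  have hε0 : 0 < ε := by positivity
  -- Approximation of the identity in `L¹(μ + ν)` yields one simple function that serves both
  -- measures.
  obtain ⟨ψ, hψ, -⟩ := (memLp_one_iff_integrable.2 (hμ.add_measure hν)).exists_simpleFunc_eLpNorm_sub_lt
    ENNReal.one_ne_top (ε := ENNReal.ofReal ε) (by simpa using hε0)
  have hg := linearGrowth_norm_sub_simpleFunc ψ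
  have hgμ := hg.integrable hμ
  have hgν := hg.integrable hν
  have hsmall : ∫ x, ‖x - ψ x‖ ∂μ + ∫ x, ‖x - ψ x‖ ∂ν < ε := by
    have hn : ∫ x, ‖x - ψ x‖ ∂(μ + ν) = (eLpNorm ((fun x => x) - ⇑ψ) 1 (μ + ν)).toReal := by
      rw [eLpNorm_one_eq_lintegral_enorm]
      exact integral_norm_eq_lintegral_enorm (f := (fun x => x) - ⇑ψ)
        (measurable_id.sub ψ.measurable).aestronglyMeasurable
    rw [← integral_add_measure hgμ hgν, hn]
    exact ENNReal.toReal_lt_of_lt_ofReal hψ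
  have n1 : 0 ≤ ∫ x, ‖x - ψ x‖ ∂μ := integral_nonneg fun x => norm_nonneg _
  have n2 : 0 ≤ ∫ x, ‖x - ψ x‖ ∂ν := integral_nonneg fun x => norm_nonneg _
  set r := (∫ x, ‖x - ψ x‖ ∂μ) * ν.real Set.univ + μ.real Set.univ * ∫ x, ‖x - ψ x‖ ∂ν with hr
  have hrη : r < η / 3 := by
    have h1 : r ≤ ε * (μ.real Set.univ + ν.real Set.univ) := by
      have := measureReal_nonneg (μ := μ) (s := Set.univ)
      have := measureReal_nonneg (μ := ν) (s := Set.univ)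
      nlinarith
    have h2 : ε * (3 * (μ.real Set.univ + ν.real Set.univ + 1)) = η := div_mul_cancel₀ _ hmass.ne'
    nlinarith
  -- the discretised pair sums converge
  have hdisc : Tendsto (fun k => (∑ i ∈ I k, ∑ j ∈ J k, ‖ψ (z k i) - ψ (z k j)‖) / (N k : ℝ) ^ 2) l
      (𝓝 (∫ p : E × E, ‖ψ p.1 - ψ p.2‖ ∂(μ.prod ν))) := by
    have e1 : ∀ k, (∑ i ∈ I k, ∑ j ∈ J k, ‖ψ (z k i) - ψ (z k j)‖) / (N k : ℝ) ^ 2 =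
        ∑ a ∈ ψ.range, ∑ b ∈ ψ.range, ‖a - b‖ *
          (((N k : ℝ)⁻¹ * ∑ i ∈ I k, fiberIndicator ψ a (z k i)) *
            ((N k : ℝ)⁻¹ * ∑ j ∈ J k, fiberIndicator ψ b (z k j))) := by
      intro k
      simp_rw [norm_simpleFunc_sub ψ]
      calc _ = (∑ a ∈ ψ.range, ∑ b ∈ ψ.range, ‖a - b‖ *
          ((∑ i ∈ I k, fiberIndicator ψ a (z k i)) *
            ∑ j ∈ J k, fiberIndicator ψ b (z k j))) / (N k : ℝ) ^ 2 := by
            congr 1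
            simp_rw [Finset.sum_mul_sum, Finset.mul_sum]
            rw [Finset.sum_congr rfl fun i _ => Finset.sum_comm, Finset.sum_comm]
            refine Finset.sum_congr rfl fun a _ => ?_
            rw [Finset.sum_congr rfl fun i _ => Finset.sum_comm, Finset.sum_comm]
        _ = _ := by
            rw [Finset.sum_div]
            refine Finset.sum_congr rfl fun a _ => ?_
            rw [Finset.sum_div]
            refine Finset.sum_congr rfl fun b _ => ?_
            field_simp
    have e2 : ∫ p : E × E, ‖ψ p.1 - ψ p.2‖ ∂(μ.prod ν) =
        ∑ a ∈ ψ.range, ∑ b ∈ ψ.range, ‖a - b‖ *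
          ((∫ x, fiberIndicator ψ a x ∂μ) * ∫ y, fiberIndicator ψ b y ∂ν) := by
      have hint : ∀ a b, Integrable (fun p : E × E =>
          ‖a - b‖ * (fiberIndicator ψ a p.1 * fiberIndicator ψ b p.2)) (μ.prod ν) := fun a b =>
        (((linearGrowth_fiberIndicator ψ a).integrable hμ).mul_prod
          ((linearGrowth_fiberIndicator ψ b).integrable hν)).const_mul _
      simp_rw [norm_simpleFunc_sub ψ]
      rw [integral_finsetSum _ fun a _ => integrable_finsetSum _ fun b _ => hint a b]
      refine Finset.sum_congr rfl fun a _ => ?_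
      rw [integral_finsetSum _ fun b _ => hint a b]
      refine Finset.sum_congr rfl fun b _ => ?_
      rw [integral_const_mul, integral_prod_mul]
    rw [e2]
    simp_rw [e1]
    refine tendsto_finsetSum _ fun a _ => tendsto_finsetSum _ fun b _ => ?_
    exact ((hI _ (linearGrowth_fiberIndicator ψ a)).mul
      (hJ _ (linearGrowth_fiberIndicator ψ b))).const_mul _
  -- the error of discretisation
  have herr : Tendsto (fun k => ((N k : ℝ)⁻¹ * ∑ i ∈ I k, ‖z k i - ψ (z k i)‖) *
      ((N k : ℝ)⁻¹ * ∑ j ∈ J k, (1 : ℝ)) + ((N k : ℝ)⁻¹ * ∑ i ∈ I k, (1 : ℝ)) *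
      ((N k : ℝ)⁻¹ * ∑ j ∈ J k, ‖z k j - ψ (z k j)‖)) l (𝓝 r) := by
    have := ((hI _ hg).mul (hJ _ linearGrowth_one)).add ((hI _ linearGrowth_one).mul (hJ _ hg))
    simpa [hr] using this
  have hbound : ∀ k, |pairSum (z k) (I k) (J k) / (N k : ℝ) ^ 2 -
      (∑ i ∈ I k, ∑ j ∈ J k, ‖ψ (z k i) - ψ (z k j)‖) / (N k : ℝ) ^ 2| ≤
      ((N k : ℝ)⁻¹ * ∑ i ∈ I k, ‖z k i - ψ (z k i)‖) *
      ((N k : ℝ)⁻¹ * ∑ j ∈ J k, (1 : ℝ)) + ((N k : ℝ)⁻¹ * ∑ i ∈ I k, (1 : ℝ)) *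
      ((N k : ℝ)⁻¹ * ∑ j ∈ J k, ‖z k j - ψ (z k j)‖) := by
    intro k
    have h1 : |pairSum (z k) (I k) (J k) - ∑ i ∈ I k, ∑ j ∈ J k, ‖ψ (z k i) - ψ (z k j)‖| ≤
        (∑ i ∈ I k, ‖z k i - ψ (z k i)‖) * (∑ j ∈ J k, (1 : ℝ)) +
        (∑ i ∈ I k, (1 : ℝ)) * ∑ j ∈ J k, ‖z k j - ψ (z k j)‖ := by
      unfold pairSum
      rw [Finset.sum_mul_sum, Finset.sum_mul_sum, ← Finset.sum_sub_distrib,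
        ← Finset.sum_add_distrib]
      refine (Finset.abs_sum_le_sum_abs _ _).trans (Finset.sum_le_sum fun i _ => ?_)
      rw [← Finset.sum_sub_distrib, ← Finset.sum_add_distrib]
      refine (Finset.abs_sum_le_sum_abs _ _).trans (Finset.sum_le_sum fun j _ => ?_)
      simpa using abs_norm_sub_sub_le ψ (z k i) (z k j)
    rw [← sub_div, abs_div, abs_of_nonneg (by positivity : (0 : ℝ) ≤ (N k : ℝ) ^ 2)]
    refine (div_le_div_of_nonneg_right h1 (by positivity)).trans (le_of_eq ?_)
    field_simp
  -- The same error `r` bounds the effect of discretising the limit.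
  have hLψ : |(∫ p : E × E, ‖ψ p.1 - ψ p.2‖ ∂(μ.prod ν)) - meanDist μ ν| ≤ r := by
    have i1 : Integrable (fun p : E × E => ‖p.1 - ψ p.1‖) (μ.prod ν) := hgμ.comp_fst ν
    have i2 : Integrable (fun p : E × E => ‖p.2 - ψ p.2‖) (μ.prod ν) := hgν.comp_snd μ
    have i3 : Integrable (fun p : E × E => ‖ψ p.1 - ψ p.2‖) (μ.prod ν) := by
      obtain ⟨C, hC⟩ : ∃ C, ∀ x, ‖ψ x‖ ≤ C := ψ.exists_forall_norm_le
      refine Integrable.of_bound (C := C + C) ?_ (ae_of_all _ fun p => ?_)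
      · exact ((ψ.measurable.comp measurable_fst).sub
          (ψ.measurable.comp measurable_snd)).norm.aestronglyMeasurable
      · rw [norm_norm]
        exact (norm_sub_le _ _).trans (add_le_add (hC _) (hC _))
    rw [meanDist, ← integral_sub i3 (integrable_dist_prod hμ hν)]
    refine (abs_integral_le_integral_abs).trans ?_
    calc _ ≤ ∫ p : E × E, (‖p.1 - ψ p.1‖ + ‖p.2 - ψ p.2‖) ∂(μ.prod ν) := by
          refine integral_mono (i3.sub (integrable_dist_prod hμ hν)).abs (i1.add i2) fun p => ?_
          rw [abs_sub_comm]
          exact abs_norm_sub_sub_le ψ p.1 p.2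
      _ = r := by
          rw [integral_add i1 i2, integral_fun_fst (fun x => ‖x - ψ x‖),
            integral_fun_snd (fun x => ‖x - ψ x‖), hr]
          simp [mul_comm]
  filter_upwards [herr.eventually (gt_mem_nhds hrη), Metric.tendsto_nhds.1 hdisc (η / 3)
    (by positivity)] with k hk1 hk2
  rw [Real.dist_eq] at hk2 ⊢
  have h1 := hbound k
  rw [abs_le] at h1 hLψ
  rw [abs_lt] at hk2 ⊢
  constructor <;> linarith [h1.1, h1.2, hLψ.1, hLψ.2, hk2.1, hk2.2]

/-- Linear combination of two measures with nonnegative real weights. -/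
noncomputable def mix (F G : Measure E) (p q : ℝ) : Measure E :=
  ENNReal.ofReal p • F + ENNReal.ofReal q • G

variable {F G : Measure E} [IsFiniteMeasure F] [IsFiniteMeasure G]

instance (p q : ℝ) : IsFiniteMeasure (mix F G p q) := by
  have h1 : IsFiniteMeasure (ENNReal.ofReal p • F) := Measure.smul_finite _ ENNReal.ofReal_ne_top
  have h2 : IsFiniteMeasure (ENNReal.ofReal q • G) := Measure.smul_finite _ ENNReal.ofReal_ne_top
  unfold mix
  infer_instance

lemma integral_mix {f : E → ℝ} (hF : Integrable f F) (hG : Integrable f G) {p q : ℝ}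
    (hp : 0 ≤ p) (hq : 0 ≤ q) :
    ∫ x, f x ∂(mix F G p q) = p * ∫ x, f x ∂F + q * ∫ x, f x ∂G := by
  rw [mix, integral_add_measure (hF.smul_measure ENNReal.ofReal_ne_top)
    (hG.smul_measure ENNReal.ofReal_ne_top), integral_smul_measure, integral_smul_measure,
    ENNReal.toReal_ofReal hp, ENNReal.toReal_ofReal hq, smul_eq_mul, smul_eq_mul]

lemma integrable_mix {X : Type*} [NormedAddCommGroup X] {f : E → X} (hF : Integrable f F)
    (hG : Integrable f G) (p q : ℝ) : Integrable f (mix F G p q) :=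
  (hF.smul_measure ENNReal.ofReal_ne_top).add_measure (hG.smul_measure ENNReal.ofReal_ne_top)

lemma meanDist_comm : meanDist F G = meanDist G F := by
  unfold meanDist
  rw [← integral_prod_swap]
  simp [norm_sub_rev]

/-- The mean distance is bilinear in the two measures, and its symmetry merges the cross terms. -/
lemma meanDist_mix {p q p' q' : ℝ} (hF : Integrable (fun x => x) F)
    (hG : Integrable (fun x => x) G)
    (hp : 0 ≤ p) (hq : 0 ≤ q) (hp' : 0 ≤ p') (hq' : 0 ≤ q') :
    meanDist (mix F G p q) (mix F G p' q') =
      p * p' * meanDist F F + (p * q' + q * p') * meanDist F G + q * q' * meanDist G G := by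
  have key : ∀ (μ ν : Measure E) [IsFiniteMeasure μ] [IsFiniteMeasure ν]
      (_ : Integrable (fun x => x) μ) (_ : Integrable (fun x => x) ν),
      meanDist μ ν = ∫ x, ∫ y, ‖x - y‖ ∂ν ∂μ := fun μ ν _ _ hμ hν => by
    rw [meanDist, integral_prod _ (integrable_dist_prod hμ hν)]
  have hinner : ∀ x, ∫ y, ‖x - y‖ ∂(mix F G p' q') =
      p' * ∫ y, ‖x - y‖ ∂F + q' * ∫ y, ‖x - y‖ ∂G := fun x =>
    integral_mix ((integrable_const x).sub hF).norm ((integrable_const x).sub hG).norm hp' hq'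
  have iFF : Integrable (fun x => ∫ y, ‖x - y‖ ∂F) F :=
    (integrable_dist_prod hF hF).integral_prod_left
  have iFG : Integrable (fun x => ∫ y, ‖x - y‖ ∂G) F :=
    (integrable_dist_prod hF hG).integral_prod_left
  have iGF : Integrable (fun x => ∫ y, ‖x - y‖ ∂F) G :=
    (integrable_dist_prod hG hF).integral_prod_left
  have iGG : Integrable (fun x => ∫ y, ‖x - y‖ ∂G) G :=
    (integrable_dist_prod hG hG).integral_prod_left
  rw [key _ _ (integrable_mix hF hG p q) (integrable_mix hF hG p' q')]
  simp_rw [hinner]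
  have h1 := integral_mix (f := fun x => p' * ∫ y, ‖x - y‖ ∂F + q' * ∫ y, ‖x - y‖ ∂G)
    ((iFF.const_mul p').add (iFG.const_mul q')) ((iGF.const_mul p').add (iGG.const_mul q')) hp hq
  rw [h1, integral_add (iFF.const_mul _) (iFG.const_mul _),
    integral_add (iGF.const_mul _) (iGG.const_mul _)]
  simp_rw [integral_const_mul]
  rw [← key F F hF hF, ← key F G hF hG, ← key G F hG hF, ← key G G hG hG,
    meanDist_comm (F := G) (G := F)]
  ring

end PairSums

/-! ### The criterion in terms of pair sums, and its limits -/

section Criterion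

variable {d n : ℕ}

/-- The indices of the first `t` observations. -/
def firstSet (n t : ℕ) : Finset (Fin n) := Finset.univ.filter fun i => (i : ℕ) < t

/-- The indices of the observations after the first `t`. -/
def lastSet (n t : ℕ) : Finset (Fin n) := Finset.univ.filter fun i => t ≤ (i : ℕ)

lemma mem_firstSet {t : ℕ} {i : Fin n} : i ∈ firstSet n t ↔ (i : ℕ) < t := by simp [firstSet]

lemma mem_lastSet {t : ℕ} {i : Fin n} : i ∈ lastSet n t ↔ t ≤ (i : ℕ) := by simp [lastSet]

lemma sum_firstSet_add_sum_lastSet (t : ℕ) (g : Fin n → ℝ) :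
    ∑ i ∈ firstSet n t, g i + ∑ i ∈ lastSet n t, g i = ∑ i, g i := by
  rw [← Finset.sum_filter_add_sum_filter_not Finset.univ (fun i : Fin n => (i : ℕ) < t)]
  simp only [firstSet, lastSet, not_lt]

lemma card_firstSet {t : ℕ} (ht : t ≤ n) : (firstSet n t).card = t := by
  unfold firstSet
  rw [Fin.card_filter_val_lt, min_eq_right ht]

lemma card_lastSet {t : ℕ} (ht : t ≤ n) : ((lastSet n t).card : ℝ) = n - t := by
  have h := sum_firstSet_add_sum_lastSet (n := n) t (fun _ => (1 : ℝ))
  simp only [Finset.sum_const, nsmul_eq_mul, mul_one, Finset.card_univ, Fintype.card_fin,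
    card_firstSet ht] at h
  linarith

/-- Swapping the coordinates matches the pairs above the diagonal with those below, and the diagonal
contributes zero. -/
lemma sum_ordered_pairs (z : Fin n → Vec d) (S : Finset (Fin n)) :
    ∑ p : Fin n × Fin n with p.1 < p.2 ∧ p.1 ∈ S ∧ p.2 ∈ S, ‖z p.1 - z p.2‖ =
      pairSum z S S / 2 := by
  have hT : (Finset.univ.filter fun p : Fin n × Fin n => p.1 < p.2 ∧ p.1 ∈ S ∧ p.2 ∈ S) =
      (S ×ˢ S).filter fun p => p.1 < p.2 := by
    ext p; simp; tauto
  have hgt : ∑ p ∈ (S ×ˢ S).filter (fun p => p.2 < p.1), ‖z p.1 - z p.2‖ =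
      ∑ p ∈ (S ×ˢ S).filter (fun p => p.1 < p.2), ‖z p.1 - z p.2‖ := by
    refine Finset.sum_nbij' Prod.swap Prod.swap ?_ ?_ ?_ ?_ ?_
    · intro p hp; simp at hp ⊢; tauto
    · intro p hp; simp at hp ⊢; tauto
    · intro p _; simp
    · intro p _; simp
    · intro p _; simp [norm_sub_rev]
  have hle : ∑ p ∈ (S ×ˢ S).filter (fun p => ¬ p.1 < p.2), ‖z p.1 - z p.2‖ =
      ∑ p ∈ (S ×ˢ S).filter (fun p => p.2 < p.1), ‖z p.1 - z p.2‖ := by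
    symm
    refine Finset.sum_subset (fun p hp => ?_) fun p hp hq => ?_
    · simp at hp ⊢; exact ⟨hp.1, hp.2.le⟩
    · simp at hp hq
      have : p.1 = p.2 := le_antisymm (hq hp.1.1 hp.1.2) hp.2
      simp [this]
  have hsum := Finset.sum_filter_add_sum_filter_not (S ×ˢ S) (fun p => p.1 < p.2)
    (fun p => ‖z p.1 - z p.2‖)
  rw [hle, hgt, Finset.sum_product] at hsum
  rw [hT, pairSum, ← hsum]
  ring

lemma T11_eq (z : Fin n → Vec d) (t : ℕ) :
    T11 z t = pairSum z (firstSet n t) (firstSet n t) / (t * (t - 1)) := by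
  have h : (Finset.univ.filter fun p : Fin n × Fin n => p.1 < p.2 ∧ (p.2 : ℕ) < t) =
      Finset.univ.filter fun p : Fin n × Fin n =>
        p.1 < p.2 ∧ p.1 ∈ firstSet n t ∧ p.2 ∈ firstSet n t := by
    ext p
    simp only [Finset.mem_filter_univ, mem_firstSet, Fin.lt_def]
    omega
  rw [T11, h, sum_ordered_pairs, Nat.cast_choose_two, inv_div, div_mul_div_comm,
    mul_comm (2 : ℝ), mul_div_mul_right _ _ two_ne_zero]

lemma T22_eq (z : Fin n → Vec d) {t : ℕ} (ht : t ≤ n) :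
    T22 z t = pairSum z (lastSet n t) (lastSet n t) / (((n : ℝ) - t) * (n - t - 1)) := by
  have h : (Finset.univ.filter fun p : Fin n × Fin n => p.1 < p.2 ∧ t ≤ (p.1 : ℕ)) =
      Finset.univ.filter fun p : Fin n × Fin n =>
        p.1 < p.2 ∧ p.1 ∈ lastSet n t ∧ p.2 ∈ lastSet n t := by
    ext p
    simp only [Finset.mem_filter_univ, mem_lastSet, Fin.lt_def]
    omega
  rw [T22, h, sum_ordered_pairs, Nat.cast_choose_two, Nat.cast_sub ht, inv_div, div_mul_div_comm,
    mul_comm (2 : ℝ), mul_div_mul_right _ _ two_ne_zero]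

lemma T12_eq (z : Fin n → Vec d) (t : ℕ) :
    T12 z t = pairSum z (firstSet n t) (lastSet n t) / (t * ((n : ℝ) - t)) := by
  have h : (Finset.univ.filter fun p : Fin n × Fin n => (p.1 : ℕ) < t ∧ t ≤ (p.2 : ℕ)) =
      firstSet n t ×ˢ lastSet n t := by
    ext p
    simp [mem_firstSet, mem_lastSet]
  rw [T12, h, Finset.sum_product, pairSum, div_eq_inv_mul]

/-- Everything is expressed by `t/n`, by pair sums over `n²` and by `n⁻¹`, which comes from the
factors `t - 1` and `n - t - 1`; each of these ingredients has a limit. -/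
lemma criterion_eq (z : Fin n → Vec d) {t : ℕ} (ht : t ≤ n) (hn : n ≠ 0) :
    criterion z t = (t : ℝ) / n * (1 - (t : ℝ) / n) *
      ((pairSum z (firstSet n t) (lastSet n t) / (n : ℝ) ^ 2 /
          ((t : ℝ) / n * (1 - (t : ℝ) / n)) -
        pairSum z (firstSet n t) (firstSet n t) / (n : ℝ) ^ 2 /
          ((t : ℝ) / n * ((t : ℝ) / n - (n : ℝ)⁻¹))) ^ 2 +
      (pairSum z (firstSet n t) (lastSet n t) / (n : ℝ) ^ 2 /
          ((t : ℝ) / n * (1 - (t : ℝ) / n)) -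
        pairSum z (lastSet n t) (lastSet n t) / (n : ℝ) ^ 2 /
          ((1 - (t : ℝ) / n) * (1 - (t : ℝ) / n - (n : ℝ)⁻¹))) ^ 2) := by
  have hn' : (n : ℝ) ≠ 0 := Nat.cast_ne_zero.2 hn
  have h2 : (n : ℝ) ^ 2 ≠ 0 := pow_ne_zero 2 hn'
  have e1 : (t : ℝ) / n * (1 - (t : ℝ) / n) = t * (n - t) / (n : ℝ) ^ 2 := by field_simp
  have e2 : (t : ℝ) / n * ((t : ℝ) / n - (n : ℝ)⁻¹) = t * (t - 1) / (n : ℝ) ^ 2 := by field_simp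
  have e3 : (1 - (t : ℝ) / n) * (1 - (t : ℝ) / n - (n : ℝ)⁻¹) =
      (n - t) * (n - t - 1) / (n : ℝ) ^ 2 := by field_simp
  rw [e1, e2, e3, div_div_div_cancel_right₀ h2, div_div_div_cancel_right₀ h2,
    div_div_div_cancel_right₀ h2, criterion, divergence, T11_eq, T12_eq, T22_eq z ht]

lemma criterion_nonneg (z : Fin n → Vec d) {t : ℕ} (ht : t ≤ n) : 0 ≤ criterion z t := by
  have : (0 : ℝ) ≤ n - t := sub_nonneg.2 (Nat.cast_le.2 ht)
  unfold criterion divergence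
  positivity

lemma pairSum_nonneg (z : Fin n → Vec d) (I J : Finset (Fin n)) : 0 ≤ pairSum z I J :=
  Finset.sum_nonneg fun _ _ => Finset.sum_nonneg fun _ _ => norm_nonneg _

lemma pairSum_le (z : Fin n → Vec d) (I J : Finset (Fin n)) :
    pairSum z I J ≤ J.card * ∑ i ∈ I, ‖z i‖ + I.card * ∑ j ∈ J, ‖z j‖ := by
  calc pairSum z I J ≤ ∑ i ∈ I, ∑ j ∈ J, (‖z i‖ + ‖z j‖) :=
        Finset.sum_le_sum fun i _ => Finset.sum_le_sum fun j _ => norm_sub_le _ _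
    _ = _ := by simp [Finset.sum_add_distrib, Finset.mul_sum]

/-- A bound for the criterion that is useful when the split is close to an end of the sample. -/
lemma criterion_le (z : Fin n → Vec d) {t : ℕ} (ht : 2 ≤ t) (htn : t + 2 ≤ n) :
    criterion z t ≤ 64 * (((n : ℝ) - t) / n * ((∑ i ∈ firstSet n t, ‖z i‖) ^ 2 / (t * n)) +
      (t : ℝ) / n * ((∑ i ∈ lastSet n t, ‖z i‖) ^ 2 / (((n : ℝ) - t) * n))) := by
  have htn' : t ≤ n := by omega
  have hA := pairSum_le z (firstSet n t) (firstSet n t)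
  have hB := pairSum_le z (firstSet n t) (lastSet n t)
  have hC := pairSum_le z (lastSet n t) (lastSet n t)
  have nA := pairSum_nonneg z (firstSet n t) (firstSet n t)
  have nB := pairSum_nonneg z (firstSet n t) (lastSet n t)
  have nC := pairSum_nonneg z (lastSet n t) (lastSet n t)
  rw [card_firstSet htn'] at hA hB
  rw [card_lastSet htn'] at hB hC
  have nQ : 0 ≤ ∑ i ∈ firstSet n t, ‖z i‖ := Finset.sum_nonneg fun _ _ => norm_nonneg _
  have nR : 0 ≤ ∑ i ∈ lastSet n t, ‖z i‖ := Finset.sum_nonneg fun _ _ => norm_nonneg _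
  rw [criterion, divergence, T11_eq, T12_eq, T22_eq z htn']
  set Q := ∑ i ∈ firstSet n t, ‖z i‖
  set R := ∑ i ∈ lastSet n t, ‖z i‖
  have hx : (2 : ℝ) ≤ t := by exact_mod_cast ht
  have hy : (2 : ℝ) ≤ n - t := by
    have : ((t + 2 : ℕ) : ℝ) ≤ n := by exact_mod_cast htn
    push_cast at this
    linarith
  have hn : (0 : ℝ) < n := by linarith
  generalize (n : ℝ) - t = y at hB hC hy ⊢
  generalize (t : ℝ) = x at hA hB hx ⊢
  have x0 : 0 < x := by linarith
  have y0 : 0 < y := by linarith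
  have x1 : 0 < x - 1 := by linarith
  have y1 : 0 < y - 1 := by linarith
  -- The factor `4` is `2 · 2`: the pair sum is at most `2xQ`, and `x ≤ 2(x - 1)` because `x ≥ 2`.
  have bA : pairSum z (firstSet n t) (firstSet n t) / (x * (x - 1)) ≤ 4 * (Q / x) := by
    rw [div_le_iff₀ (by positivity)]
    have : 4 * (Q / x) * (x * (x - 1)) = 4 * Q * (x - 1) := by field_simp
    nlinarith
  have bC : pairSum z (lastSet n t) (lastSet n t) / (y * (y - 1)) ≤ 4 * (R / y) := by
    rw [div_le_iff₀ (by positivity)]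
    have : 4 * (R / y) * (y * (y - 1)) = 4 * R * (y - 1) := by field_simp
    nlinarith
  have bB : pairSum z (firstSet n t) (lastSet n t) / (x * y) ≤ Q / x + R / y := by
    rw [div_le_iff₀ (by positivity)]
    have : (Q / x + R / y) * (x * y) = y * Q + x * R := by field_simp
    linarith
  have cA : 0 ≤ pairSum z (firstSet n t) (firstSet n t) / (x * (x - 1)) := by positivity
  have cB : 0 ≤ pairSum z (firstSet n t) (lastSet n t) / (x * y) := by positivity
  have cC : 0 ≤ pairSum z (lastSet n t) (lastSet n t) / (y * (y - 1)) := by positivity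
  have a0 : 0 ≤ Q / x := by positivity
  have b0 : 0 ≤ R / y := by positivity
  have hD : (pairSum z (firstSet n t) (lastSet n t) / (x * y) -
      pairSum z (firstSet n t) (firstSet n t) / (x * (x - 1))) ^ 2 +
      (pairSum z (firstSet n t) (lastSet n t) / (x * y) -
      pairSum z (lastSet n t) (lastSet n t) / (y * (y - 1))) ^ 2 ≤
      64 * ((Q / x) ^ 2 + (R / y) ^ 2) := by
    have s1 : ∀ u v w : ℝ, 0 ≤ u → 0 ≤ v → 0 ≤ w → u ≤ w → v ≤ w → (u - v) ^ 2 ≤ w ^ 2 := by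
      intro u v w hu hv hw huw hvw
      exact sq_le_sq' (by linarith) (by linarith)
    have h1 := s1 _ _ (4 * (Q / x + R / y)) cB cA (by positivity) (by linarith) (by linarith)
    have h2 := s1 _ _ (4 * (Q / x + R / y)) cB cC (by positivity) (by linarith) (by linarith)
    nlinarith [sq_nonneg (Q / x - R / y)]
  calc _ ≤ x * y / (n : ℝ) ^ 2 * (64 * ((Q / x) ^ 2 + (R / y) ^ 2)) := by gcongr
    _ = _ := by field_simp

variable {ι : Type*} {l : Filter ι} {N t : ι → ℕ} {z : (k : ι) → Fin (N k) → Vec d}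

/-- The limit of the criterion when both parts of the sample have a limiting distribution and
neither is negligible. -/
lemma tendsto_criterion {μ ν : Measure (Vec d)} [IsFiniteMeasure μ] [IsFiniteMeasure ν]
    (hμ : Integrable (fun x => x) μ) (hν : Integrable (fun x => x) ν)
    (hN : Tendsto N l atTop) (ht : ∀ᶠ k in l, t k ≤ N k) {γ : ℝ} (hγ0 : 0 < γ) (hγ1 : γ < 1)
    (hγ : Tendsto (fun k => (t k : ℝ) / N k) l (𝓝 γ))
    (hI : EmpiricalLimit l N z (fun k => firstSet (N k) (t k)) μ)
    (hJ : EmpiricalLimit l N z (fun k => lastSet (N k) (t k)) ν) :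
    Tendsto (fun k => criterion (z k) (t k)) l (𝓝 (γ * (1 - γ) *
      ((meanDist μ ν / (γ * (1 - γ)) - meanDist μ μ / (γ * (γ - 0))) ^ 2 +
       (meanDist μ ν / (γ * (1 - γ)) - meanDist ν ν / ((1 - γ) * (1 - γ - 0))) ^ 2))) := by
  have hinv : Tendsto (fun k => ((N k : ℝ))⁻¹) l (𝓝 0) :=
    tendsto_inv_atTop_zero.comp (tendsto_natCast_atTop_atTop.comp hN)
  have h1 : Tendsto (fun k => 1 - (t k : ℝ) / N k) l (𝓝 (1 - γ)) := hγ.const_sub 1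
  have g1 : 1 - γ ≠ 0 := by linarith
  have A := (hI.tendsto_pairSum hμ hμ hI).div (hγ.mul (hγ.sub hinv)) (by simp [hγ0.ne'])
  have B := (hI.tendsto_pairSum hμ hν hJ).div (hγ.mul h1) (mul_ne_zero hγ0.ne' g1)
  have C := (hJ.tendsto_pairSum hν hν hJ).div (h1.mul (h1.sub hinv)) (by simp [g1])
  refine Tendsto.congr' ?_ ((hγ.mul h1).mul (((B.sub A).pow 2).add ((B.sub C).pow 2)))
  filter_upwards [ht, hN.eventually (eventually_ne_atTop 0)] with k hk hk0
  rw [criterion_eq (z k) hk hk0]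
  rfl

/-- The weights in `hlim` decide what is required at an end: as `t/n → 0`, the bound `r` has to
vanish while `s` need only stay bounded, and symmetrically as `t/n → 1`. -/
lemma tendsto_criterion_zero {r s : ι → ℝ} (h2 : ∀ᶠ k in l, 2 ≤ t k ∧ t k + 2 ≤ N k)
    (hr : ∀ᶠ k in l, (∑ i ∈ firstSet (N k) (t k), ‖z k i‖) ^ 2 / (t k * N k) ≤ r k)
    (hs : ∀ᶠ k in l, (∑ i ∈ lastSet (N k) (t k), ‖z k i‖) ^ 2 / (((N k : ℝ) - t k) * N k) ≤ s k)
    (hlim : Tendsto (fun k => (1 - (t k : ℝ) / N k) * r k + (t k : ℝ) / N k * s k) l (𝓝 0)) :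
    Tendsto (fun k => criterion (z k) (t k)) l (𝓝 0) := by
  refine tendsto_of_tendsto_of_tendsto_of_le_of_le' tendsto_const_nhds
    (by simpa using hlim.const_mul 64) ?_ ?_
  · filter_upwards [h2] with k hk
    exact criterion_nonneg _ (by omega)
  · filter_upwards [h2, hr, hs] with k hk hrk hsk
    refine (criterion_le (z k) hk.1 hk.2).trans ?_
    have hn : (0 : ℝ) < N k := by
      have : 0 < N k := by omega
      exact_mod_cast this
    have h1 : (0 : ℝ) ≤ (N k : ℝ) - t k := by
      have : t k ≤ N k := by omega
      exact sub_nonneg.2 (by exact_mod_cast this)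
    have e : ((N k : ℝ) - t k) / N k = 1 - (t k : ℝ) / N k := by field_simp
    rw [← e]
    gcongr

end Criterion

/-! ### Comparison of the limits, and passage from fixed fractions to arbitrary splits -/

/-- The weighted limiting criterion to the left of the change is at most proportional to the
position of the split. -/
lemma limit_criterion_le {a b c γ θ : ℝ} (h0 : 0 < γ) (h1 : γ ≤ θ) (h2 : θ < 1) :
    γ * (1 - γ) *
      (((γ * (θ - γ) * a + γ * (1 - θ) * c) / (γ * (1 - γ)) - γ * γ * a / (γ * (γ - 0))) ^ 2 +
       ((γ * (θ - γ) * a + γ * (1 - θ) * c) / (γ * (1 - γ)) -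
        ((θ - γ) * (θ - γ) * a + 2 * ((θ - γ) * (1 - θ)) * c + (1 - θ) * (1 - θ) * b) /
          ((1 - γ) * (1 - γ - 0))) ^ 2) ≤
    γ * (1 - θ) * ((c - a) ^ 2 + (c - b) ^ 2) := by
  have hg : 0 < 1 - γ := by linarith
  -- In the limit, `q` is the proportion of post-change observations in the second part.
  obtain ⟨q, hq⟩ : ∃ q, q = (1 - θ) / (1 - γ) := ⟨_, rfl⟩
  have hq0 : 0 < q := hq ▸ div_pos (by linarith) hg
  have hq1 : q ≤ 1 := by rw [hq, div_le_one hg]; linarith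
  have hθ : 1 - θ = q * (1 - γ) := by rw [hq]; field_simp
  have hθγ : θ - γ = (1 - q) * (1 - γ) := by linarith
  have e1 : (γ * (θ - γ) * a + γ * (1 - θ) * c) / (γ * (1 - γ)) - γ * γ * a / (γ * (γ - 0)) =
      q * (c - a) := by
    rw [hθ, hθγ, sub_zero]; field_simp; ring
  have e2 : (γ * (θ - γ) * a + γ * (1 - θ) * c) / (γ * (1 - γ)) -
        ((θ - γ) * (θ - γ) * a + 2 * ((θ - γ) * (1 - θ)) * c + (1 - θ) * (1 - θ) * b) /
          ((1 - γ) * (1 - γ - 0)) = q * (q * (c - b) - (1 - q) * (c - a)) := by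
    rw [hθ, hθγ, sub_zero]; field_simp; ring
  rw [e1, e2, hθ]
  have key : q * ((c - a) ^ 2 + (q * (c - b) - (1 - q) * (c - a)) ^ 2) ≤
      (c - a) ^ 2 + (c - b) ^ 2 := by
    generalize c - a = u
    generalize c - b = v
    -- Convexity of the square, with weights `q` and `1 - q` at the points `v` and `-u`.
    have i1 : (q * v - (1 - q) * u) ^ 2 ≤ q * v ^ 2 + (1 - q) * u ^ 2 := by
      have : 0 ≤ q * (1 - q) * (u + v) ^ 2 :=
        mul_nonneg (mul_nonneg hq0.le (by linarith)) (sq_nonneg _)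
      nlinarith
    have i2 : q * (u ^ 2 + (q * v - (1 - q) * u) ^ 2) ≤
        q * (u ^ 2 + (q * v ^ 2 + (1 - q) * u ^ 2)) := by gcongr
    have i3 : 0 ≤ (1 - q) ^ 2 * u ^ 2 := by positivity
    have i4 : 0 ≤ (1 - q ^ 2) * v ^ 2 := mul_nonneg (by nlinarith) (sq_nonneg _)
    nlinarith
  have : 0 ≤ γ * (q * (1 - γ)) := by positivity
  calc _ = γ * (q * (1 - γ)) *
        (q * ((c - a) ^ 2 + (q * (c - b) - (1 - q) * (c - a)) ^ 2)) := by ring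
    _ ≤ _ := mul_le_mul_of_nonneg_left key this

/-- By monotonicity, the value at `t k` lies between the values at fixed fractions slightly below
and slightly above `γ`; continuity of `G` closes the gap. -/
lemma tendsto_of_monotone {ι : Type*} {l : Filter ι} {N t : ι → ℕ} (hN : Tendsto N l atTop)
    {g : ι → ℕ → ℝ} (hg : ∀ k, Monotone (g k)) {G : ℝ → ℝ}
    (hG : ∀ γ : ℝ, Tendsto (fun k => g k ⌊γ * N k⌋₊) l (𝓝 (G γ))) {γ : ℝ}
    (ht : Tendsto (fun k => (t k : ℝ) / N k) l (𝓝 γ)) (hc : ContinuousAt G γ) :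
    Tendsto (fun k => g k (t k)) l (𝓝 (G γ)) := by
  have hpos : ∀ᶠ k in l, (0 : ℝ) < N k := by
    filter_upwards [hN.eventually (eventually_gt_atTop 0)] with k hk
    exact_mod_cast hk
  refine tendsto_order.2 ⟨fun a ha => ?_, fun a ha => ?_⟩
  · have h1 : ∀ᶠ x in 𝓝[<] γ, a < G x :=
      (hc.eventually (lt_mem_nhds ha)).filter_mono nhdsWithin_le_nhds
    obtain ⟨x, hx, hxγ⟩ := (h1.and self_mem_nhdsWithin).exists
    filter_upwards [(hG x).eventually (lt_mem_nhds hx), ht.eventually (lt_mem_nhds hxγ), hpos]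
      with k hk1 hk2 hk3
    refine hk1.trans_le (hg k (Nat.floor_le_of_le ?_))
    rw [lt_div_iff₀ hk3] at hk2
    exact hk2.le
  · have h1 : ∀ᶠ x in 𝓝[>] γ, G x < a :=
      (hc.eventually (gt_mem_nhds ha)).filter_mono nhdsWithin_le_nhds
    obtain ⟨x, hx, hxγ⟩ := (h1.and self_mem_nhdsWithin).exists
    filter_upwards [(hG x).eventually (gt_mem_nhds hx), ht.eventually (gt_mem_nhds hxγ), hpos]
      with k hk1 hk2 hk3
    refine (hg k (Nat.le_floor ?_)).trans_lt hk1
    rw [div_lt_iff₀ hk3] at hk2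
    exact hk2.le

/-! ### Partial sums before and after the change -/

section Front

variable {E : Type*} [NormedAddCommGroup E] [MeasurableSpace E] [BorelSpace E]

/-- The sum of `f` over those of the first `t` observations that precede the change at `τ`. -/
noncomputable def frontSum {n : ℕ} (f : E → ℝ) (z : Fin n → E) (τ t : ℕ) : ℝ :=
  ∑ i ∈ Finset.univ.filter (fun i : Fin n => (i : ℕ) < t ∧ (i : ℕ) < τ), f (z i)

lemma frontSum_mono {n : ℕ} {f : E → ℝ} (hf : ∀ x, 0 ≤ f x) (z : Fin n → E) (τ : ℕ) :
    Monotone (frontSum f z τ) := fun s t hst =>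
  Finset.sum_le_sum_of_subset_of_nonneg
    (fun i hi => by simp only [Finset.mem_filter_univ] at hi ⊢; omega) fun i _ _ => hf _

lemma frontSum_rev {n τ t : ℕ} (hτ : τ ≤ n) (ht : t ≤ n) (f : E → ℝ) (z : Fin n → E) :
    frontSum f (fun i => z i.rev) (n - τ) (n - t) =
      ∑ i ∈ Finset.univ.filter (fun i : Fin n => t ≤ (i : ℕ) ∧ τ ≤ (i : ℕ)), f (z i) := by
  unfold frontSum
  rw [Finset.sum_filter, Finset.sum_filter, ← Equiv.sum_comp Fin.revPerm]
  refine Finset.sum_congr rfl fun i _ => ?_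
  simp only [Fin.revPerm_apply, Fin.rev_rev, Fin.val_rev]
  have := i.2
  congr 1
  apply propext
  omega

/-- Post-change observations are read from the far end, where they become the pre-change
observations of the reversed sample. A single theory of front sums thus covers both sides. -/
lemma sum_firstSet_eq {n τ t : ℕ} (hτ : τ ≤ n) (ht : t ≤ n) (f : E → ℝ) (z : Fin n → E) :
    ∑ i ∈ firstSet n t, f (z i) = frontSum f z τ t +
      (frontSum f (fun i => z i.rev) (n - τ) n -
        frontSum f (fun i => z i.rev) (n - τ) (n - t)) := by
  have h0 := frontSum_rev hτ (Nat.zero_le n) f z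
  rw [Nat.sub_zero] at h0
  rw [h0, frontSum_rev hτ ht, frontSum]
  simp only [firstSet, Finset.sum_filter, ← Finset.sum_sub_distrib, ← Finset.sum_add_distrib]
  refine Finset.sum_congr rfl fun i _ => ?_
  by_cases h1 : (i : ℕ) < t <;> by_cases h2 : (i : ℕ) < τ
  · have h3 : ¬ τ ≤ (i : ℕ) := by omega
    simp [h1, h2, h3]
  · have h3 : τ ≤ (i : ℕ) := by omega
    have h4 : ¬ t ≤ (i : ℕ) := by omega
    simp [h1, h2, h3, h4]
  · have h3 : ¬ τ ≤ (i : ℕ) := by omega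
    simp [h1, h3]
  · have h3 : τ ≤ (i : ℕ) := by omega
    have h4 : t ≤ (i : ℕ) := by omega
    simp [h1, h3, h4]

lemma sum_lastSet_eq {n τ t : ℕ} (hτ : τ ≤ n) (ht : t ≤ n) (f : E → ℝ) (z : Fin n → E) :
    ∑ i ∈ lastSet n t, f (z i) = frontSum f (fun i => z i.rev) (n - τ) (n - t) +
      (frontSum f z τ n - frontSum f z τ t) := by
  rw [frontSum_rev hτ ht, frontSum, frontSum]
  simp only [lastSet, Finset.sum_filter, ← Finset.sum_sub_distrib, ← Finset.sum_add_distrib]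
  refine Finset.sum_congr rfl fun i _ => ?_
  have h0 := i.2
  by_cases h1 : (i : ℕ) < t <;> by_cases h2 : (i : ℕ) < τ
  · have h3 : ¬ τ ≤ (i : ℕ) := by omega
    have h4 : ¬ t ≤ (i : ℕ) := by omega
    simp [h1, h2, h3, h4]
  · have h3 : τ ≤ (i : ℕ) := by omega
    have h4 : ¬ t ≤ (i : ℕ) := by omega
    simp [h2, h4]
  · have h3 : ¬ τ ≤ (i : ℕ) := by omega
    have h4 : t ≤ (i : ℕ) := by omega
    simp [h1, h2, h3, h4]
  · have h3 : τ ≤ (i : ℕ) := by omega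
    have h4 : t ≤ (i : ℕ) := by omega
    simp [h1, h3, h4]

variable {ι : Type*}

/-- The law of large numbers for the sums of `f` over the observations before the change. -/
def FrontLimit (l : Filter ι) (N τ : ι → ℕ) (z : (k : ι) → Fin (N k) → E) (f : E → ℝ) (θ m : ℝ) :
    Prop :=
  ∀ γ : ℝ, Tendsto (fun k => (N k : ℝ)⁻¹ * frontSum f (z k) (τ k) ⌊γ * N k⌋₊) l
    (𝓝 (min (max γ 0) θ * m))

/-- What is needed about the observations before the change: laws of large numbers, and a bound for
the sums of the norms of the first few observations. -/
structure FrontControl (l : Filter ι) (N τ m : ι → ℕ) (z : (k : ι) → Fin (N k) → E)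
    (F : Measure E) (θ : ℝ) : Prop where
  lln : ∀ f : E → ℝ, LinearGrowth f → FrontLimit l N τ z f θ (∫ x, f x ∂F)
  small : ∃ (M : ℝ) (e : ι → ℝ), Tendsto e l (𝓝 0) ∧ ∀ᶠ k in l, ∀ t, m k ≤ t → t ≤ τ k →
    frontSum (fun x => ‖x‖) (z k) (τ k) t ^ 2 ≤ (M * t + e k * N k) * t

lemma FrontLimit.mono {l l' : Filter ι} {N τ : ι → ℕ} {z : (k : ι) → Fin (N k) → E} {f : E → ℝ}
    {θ m : ℝ} (h : FrontLimit l N τ z f θ m) (hl : l' ≤ l) : FrontLimit l' N τ z f θ m :=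
  fun γ => (h γ).mono_left hl

lemma FrontControl.mono {l l' : Filter ι} {N τ m : ι → ℕ} {z : (k : ι) → Fin (N k) → E}
    {F : Measure E} {θ : ℝ} (h : FrontControl l N τ m z F θ) (hl : l' ≤ l) :
    FrontControl l' N τ m z F θ := by
  obtain ⟨M, e, he, hM⟩ := h.small
  exact ⟨fun f hf => (h.lln f hf).mono hl, M, e, he.mono_left hl, hM.filter_mono hl⟩

/-- Nonnegativity of `f` makes front sums monotone in the split, so `tendsto_of_monotone` extends
the law of large numbers to arbitrary splits, including those depending on the sample. -/
lemma FrontLimit.tendsto {l : Filter ι} {N τ t : ι → ℕ} {z : (k : ι) → Fin (N k) → E} {f : E → ℝ}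
    {θ m γ : ℝ} (h : FrontLimit l N τ z f θ m) (hf : ∀ x, 0 ≤ f x) (hN : Tendsto N l atTop)
    (ht : Tendsto (fun k => (t k : ℝ) / N k) l (𝓝 γ)) :
    Tendsto (fun k => (N k : ℝ)⁻¹ * frontSum f (z k) (τ k) (t k)) l
      (𝓝 (min (max γ 0) θ * m)) := by
  refine tendsto_of_monotone hN (g := fun k t => (N k : ℝ)⁻¹ * frontSum f (z k) (τ k) t)
    (G := fun γ => min (max γ 0) θ * m) (fun k s t hst => ?_) h ht ?_
  · exact mul_le_mul_of_nonneg_left (frontSum_mono hf _ _ hst) (by positivity)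
  · exact Continuous.continuousAt (by fun_prop)

lemma tendsto_sub_div {l : Filter ι} {N t : ι → ℕ} {γ : ℝ} (hN : Tendsto N l atTop)
    (htN : ∀ᶠ k in l, t k ≤ N k) (ht : Tendsto (fun k => (t k : ℝ) / N k) l (𝓝 γ)) :
    Tendsto (fun k => ((N k - t k : ℕ) : ℝ) / N k) l (𝓝 (1 - γ)) := by
  refine (ht.const_sub 1).congr' ?_
  filter_upwards [htN, hN.eventually (eventually_ne_atTop 0)] with k hk hk0
  have : (N k : ℝ) ≠ 0 := Nat.cast_ne_zero.2 hk0
  rw [Nat.cast_sub hk, sub_div, div_self this]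

section TwoSided

variable {l : Filter ι} {N τ t : ι → ℕ} {z : (k : ι) → Fin (N k) → E} {θ γ : ℝ}

lemma tendsto_sum_firstSet {f : E → ℝ} {a b : ℝ} (hf : ∀ x, 0 ≤ f x)
    (hN : Tendsto N l atTop) (hτN : ∀ k, τ k ≤ N k) (hθ0 : 0 < θ)
    (h1 : FrontLimit l N τ z f θ a)
    (h2 : FrontLimit l N (fun k => N k - τ k) (fun k i => z k i.rev) f (1 - θ) b)
    (htN : ∀ᶠ k in l, t k ≤ N k)
    (ht : Tendsto (fun k => (t k : ℝ) / N k) l (𝓝 γ)) (hγ0 : 0 ≤ γ) (hγ1 : γ ≤ 1) :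
    Tendsto (fun k => (N k : ℝ)⁻¹ * ∑ i ∈ firstSet (N k) (t k), f (z k i)) l
      (𝓝 (min γ θ * a + (max γ θ - θ) * b)) := by
  have hNN : Tendsto (fun k => (N k : ℝ) / N k) l (𝓝 1) := by
    refine tendsto_const_nhds.congr' ?_
    filter_upwards [hN.eventually (eventually_ne_atTop 0)] with k hk
    rw [div_self (Nat.cast_ne_zero.2 hk)]
  have A := h1.tendsto hf hN ht
  have B := h2.tendsto hf hN hNN
  have C := h2.tendsto hf hN (tendsto_sub_div hN htN ht)
  have e1 : max γ 0 = γ := max_eq_left hγ0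
  have e2 : min (max (1 : ℝ) 0) (1 - θ) = 1 - θ := by
    rw [max_eq_left zero_le_one, min_eq_right (by linarith)]
  have e3 : min (max (1 - γ) 0) (1 - θ) = 1 - max γ θ := by
    rw [max_eq_left (by linarith), min_sub_sub_left]
  rw [e1] at A
  rw [e2] at B
  rw [e3] at C
  refine ((A.add (B.sub C)).congr' ?_).trans (le_of_eq (by ring_nf))
  filter_upwards [htN] with k hk
  rw [sum_firstSet_eq (hτN k) hk]
  ring

lemma tendsto_sum_lastSet {f : E → ℝ} {a b : ℝ} (hf : ∀ x, 0 ≤ f x)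
    (hN : Tendsto N l atTop) (hτN : ∀ k, τ k ≤ N k) (hθ1 : θ < 1)
    (h1 : FrontLimit l N τ z f θ a)
    (h2 : FrontLimit l N (fun k => N k - τ k) (fun k i => z k i.rev) f (1 - θ) b)
    (htN : ∀ᶠ k in l, t k ≤ N k)
    (ht : Tendsto (fun k => (t k : ℝ) / N k) l (𝓝 γ)) (hγ0 : 0 ≤ γ) (hγ1 : γ ≤ 1) :
    Tendsto (fun k => (N k : ℝ)⁻¹ * ∑ i ∈ lastSet (N k) (t k), f (z k i)) l
      (𝓝 ((θ - min γ θ) * a + (1 - max γ θ) * b)) := by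
  have hNN : Tendsto (fun k => (N k : ℝ) / N k) l (𝓝 1) := by
    refine tendsto_const_nhds.congr' ?_
    filter_upwards [hN.eventually (eventually_ne_atTop 0)] with k hk
    rw [div_self (Nat.cast_ne_zero.2 hk)]
  have A := h1.tendsto hf hN ht
  have B := h1.tendsto hf hN hNN
  have C := h2.tendsto hf hN (tendsto_sub_div hN htN ht)
  have e1 : max γ 0 = γ := max_eq_left hγ0
  have e2 : min (max (1 : ℝ) 0) θ = θ := by
    rw [max_eq_left zero_le_one, min_eq_right hθ1.le]
  have e3 : min (max (1 - γ) 0) (1 - θ) = 1 - max γ θ := by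
    rw [max_eq_left (by linarith), min_sub_sub_left]
  rw [e1] at A
  rw [e2] at B
  rw [e3] at C
  refine ((C.add (B.sub A)).congr' ?_).trans (le_of_eq (by ring_nf))
  filter_upwards [htN] with k hk
  rw [sum_lastSet_eq (hτN k) hk]
  ring

end TwoSided

end Front

/-! ### Deterministic localisation of the maximiser -/

section Localisation

variable {d : ℕ} {ι : Type*} {l : Filter ι} {N τ m : ι → ℕ} {z : (k : ι) → Fin (N k) → Vec d}
  {F G : Measure (Vec d)} [IsProbabilityMeasure F] [IsProbabilityMeasure G] {θ : ℝ}

/-- The deterministic hypotheses on a sample with a single change under which the maximiser of the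
criterion locates the change. -/
structure TwoSidedControl (l : Filter ι) (N τ m : ι → ℕ) (z : (k : ι) → Fin (N k) → Vec d)
    (F G : Measure (Vec d)) (θ : ℝ) : Prop where
  size : Tendsto N l atTop
  margin : Tendsto m l atTop
  change_le : ∀ k, τ k ≤ N k
  change : Tendsto (fun k => (τ k : ℝ) / N k) l (𝓝 θ)
  pos : 0 < θ
  lt_one : θ < 1
  integrable_left : Integrable (fun x => x) F
  integrable_right : Integrable (fun x => x) G
  front : FrontControl l N τ m z F θ
  back : FrontControl l N (fun k => N k - τ k) m (fun k i => z k i.rev) G (1 - θ)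

namespace TwoSidedControl

lemma mono {l' : Filter ι} (h : TwoSidedControl l N τ m z F G θ) (hl : l' ≤ l) :
    TwoSidedControl l' N τ m z F G θ where
  size := h.size.mono_left hl
  margin := h.margin.mono_left hl
  change_le := h.change_le
  change := h.change.mono_left hl
  pos := h.pos
  lt_one := h.lt_one
  integrable_left := h.integrable_left
  integrable_right := h.integrable_right
  front := h.front.mono hl
  back := h.back.mono hl

variable {t : ι → ℕ} {γ : ℝ}

lemma empiricalLimit_first (h : TwoSidedControl l N τ m z F G θ) (htN : ∀ᶠ k in l, t k ≤ N k)
    (ht : Tendsto (fun k => (t k : ℝ) / N k) l (𝓝 γ)) (hγ0 : 0 ≤ γ) (hγ1 : γ ≤ 1) :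
    EmpiricalLimit l N z (fun k => firstSet (N k) (t k)) (mix F G (min γ θ) (max γ θ - θ)) := by
  intro f hf
  rw [integral_mix (hf.integrable h.integrable_left) (hf.integrable h.integrable_right)
    (le_min hγ0 h.pos.le) (sub_nonneg.2 (le_max_right _ _))]
  exact tendsto_sum_firstSet hf.2.1 h.size h.change_le h.pos (h.front.lln f hf) (h.back.lln f hf)
    htN ht hγ0 hγ1

lemma empiricalLimit_last (h : TwoSidedControl l N τ m z F G θ) (htN : ∀ᶠ k in l, t k ≤ N k)
    (ht : Tendsto (fun k => (t k : ℝ) / N k) l (𝓝 γ)) (hγ0 : 0 ≤ γ) (hγ1 : γ ≤ 1) :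
    EmpiricalLimit l N z (fun k => lastSet (N k) (t k))
      (mix F G (θ - min γ θ) (1 - max γ θ)) := by
  intro f hf
  rw [integral_mix (hf.integrable h.integrable_left) (hf.integrable h.integrable_right)
    (sub_nonneg.2 (min_le_right _ _)) (sub_nonneg.2 (max_le hγ1 h.lt_one.le))]
  exact tendsto_sum_lastSet hf.2.1 h.size h.change_le h.lt_one (h.front.lln f hf)
    (h.back.lln f hf) htN ht hγ0 hγ1

/-- The limit of the criterion to the left of the change. -/
lemma tendsto_criterion_left (h : TwoSidedControl l N τ m z F G θ) (htN : ∀ᶠ k in l, t k ≤ N k)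
    (ht : Tendsto (fun k => (t k : ℝ) / N k) l (𝓝 γ)) (hγ0 : 0 < γ) (hγθ : γ ≤ θ) :
    ∃ L, Tendsto (fun k => criterion (z k) (t k)) l (𝓝 L) ∧
      L ≤ γ * (1 - θ) * ((meanDist F G - meanDist F F) ^ 2 + (meanDist F G - meanDist G G) ^ 2) := by
  have hθ1 := h.lt_one
  have hI := h.empiricalLimit_first htN ht hγ0.le (by linarith)
  have hJ := h.empiricalLimit_last htN ht hγ0.le (by linarith)
  have iF := h.integrable_left
  have iG := h.integrable_right
  refine ⟨_, tendsto_criterion (integrable_mix iF iG _ _) (integrable_mix iF iG _ _) h.size htN hγ0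
    (by linarith) ht hI hJ, ?_⟩
  rw [min_eq_left hγθ, max_eq_right hγθ, sub_self]
  have n1 : 0 ≤ θ - γ := by linarith
  have n2 : 0 ≤ 1 - θ := by linarith
  rw [meanDist_mix iF iG hγ0.le le_rfl n1 n2, meanDist_mix iF iG hγ0.le le_rfl hγ0.le le_rfl,
    meanDist_mix iF iG n1 n2 n1 n2]
  refine le_of_eq_of_le ?_ (limit_criterion_le (a := meanDist F F) (b := meanDist G G)
    (c := meanDist F G) hγ0 hγθ hθ1)
  ring

/-- The limit of the criterion to the right of the change. -/
lemma tendsto_criterion_right (h : TwoSidedControl l N τ m z F G θ) (htN : ∀ᶠ k in l, t k ≤ N k)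
    (ht : Tendsto (fun k => (t k : ℝ) / N k) l (𝓝 γ)) (hθγ : θ ≤ γ) (hγ1 : γ < 1) :
    ∃ L, Tendsto (fun k => criterion (z k) (t k)) l (𝓝 L) ∧
      L ≤ (1 - γ) * θ * ((meanDist F G - meanDist F F) ^ 2 + (meanDist F G - meanDist G G) ^ 2) := by
  have hθ0 := h.pos
  have hγ0 : 0 < γ := by linarith
  have hI := h.empiricalLimit_first htN ht hγ0.le hγ1.le
  have hJ := h.empiricalLimit_last htN ht hγ0.le hγ1.le
  have iF := h.integrable_left
  have iG := h.integrable_right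
  refine ⟨_, tendsto_criterion (integrable_mix iF iG _ _) (integrable_mix iF iG _ _) h.size htN hγ0
    (by linarith) ht hI hJ, ?_⟩
  rw [min_eq_right hθγ, max_eq_left hθγ, sub_self]
  have n1 : 0 ≤ γ - θ := by linarith
  have n2 : 0 ≤ 1 - γ := by linarith
  rw [meanDist_mix iF iG hθ0.le n1 le_rfl n2, meanDist_mix iF iG hθ0.le n1 hθ0.le n1,
    meanDist_mix iF iG le_rfl n2 le_rfl n2]
  -- Reversing the sample exchanges the two laws and replaces `γ`, `θ` by `1 - γ`, `1 - θ`.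
  have key := limit_criterion_le (a := meanDist G G) (b := meanDist F F)
    (c := meanDist F G) (γ := 1 - γ) (θ := 1 - θ) (by linarith) (by linarith) (by linarith)
  have e1 : 1 - θ - (1 - γ) = γ - θ := by ring
  have e2 : 1 - (1 - θ) = θ := by ring
  have e3 : 1 - (1 - γ) = γ := by ring
  rw [e1, e2, e3] at key
  refine le_of_eq_of_le ?_ (key.trans (le_of_eq (by ring)))
  ring_nf

/-- The limit of the criterion at the change. -/
lemma tendsto_criterion_change (h : TwoSidedControl l N τ m z F G θ) :
    Tendsto (fun k => criterion (z k) (τ k)) l (𝓝 (θ * (1 - θ) *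
      ((meanDist F G - meanDist F F) ^ 2 + (meanDist F G - meanDist G G) ^ 2))) := by
  have h0 := h.pos
  have h1 := h.lt_one
  have htN : ∀ᶠ k in l, τ k ≤ N k := .of_forall h.change_le
  have hI := h.empiricalLimit_first htN h.change h0.le h1.le
  have hJ := h.empiricalLimit_last htN h.change h0.le h1.le
  have iF := h.integrable_left
  have iG := h.integrable_right
  refine (tendsto_criterion (integrable_mix iF iG _ _) (integrable_mix iF iG _ _) h.size htN h0
    h1 h.change hI hJ).trans (le_of_eq ?_)
  have n2 : 0 ≤ 1 - θ := by linarith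
  have n3 : 1 - θ ≠ 0 := by linarith
  rw [min_self, max_self, sub_self, meanDist_mix iF iG h0.le le_rfl le_rfl n2,
    meanDist_mix iF iG h0.le le_rfl h0.le le_rfl, meanDist_mix iF iG le_rfl n2 le_rfl n2]
  have e1 : (θ * 0 * meanDist F F + (θ * (1 - θ) + 0 * 0) * meanDist F G +
      0 * (1 - θ) * meanDist G G) / (θ * (1 - θ)) = meanDist F G := by field_simp; ring
  have e2 : (θ * θ * meanDist F F + (θ * 0 + 0 * θ) * meanDist F G + 0 * 0 * meanDist G G) /
      (θ * (θ - 0)) = meanDist F F := by rw [sub_zero]; field_simp; ring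
  have e3 : (0 * 0 * meanDist F F + (0 * (1 - θ) + (1 - θ) * 0) * meanDist F G +
      (1 - θ) * (1 - θ) * meanDist G G) / ((1 - θ) * (1 - θ - 0)) = meanDist G G := by
    rw [sub_zero]; field_simp; ring
  rw [e1, e2, e3]

/-- Eventually the first part lies before the change and is longer than the margin, so
`FrontControl.small` makes its squared norm sum over `t n` at most `M t/n + e`, which vanishes. The
contribution of the second part is bounded and carries the weight `t/n`. -/
lemma tendsto_criterion_at_zero (h : TwoSidedControl l N τ m z F G θ)
    (hm : ∀ᶠ k in l, m k ≤ t k ∧ t k + m k ≤ N k)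
    (ht : Tendsto (fun k => (t k : ℝ) / N k) l (𝓝 0)) :
    Tendsto (fun k => criterion (z k) (t k)) l (𝓝 0) := by
  have htN : ∀ᶠ k in l, t k ≤ N k := hm.mono fun k hk => by omega
  obtain ⟨M, e, he, hM⟩ := h.front.small
  have hJ := h.empiricalLimit_last htN ht le_rfl zero_le_one _ linearGrowth_norm
  have hpos : ∀ᶠ k in l, (0 : ℝ) < N k := by
    filter_upwards [h.size.eventually (eventually_gt_atTop 0)] with k hk
    exact_mod_cast hk
  have hm2 := h.margin.eventually (eventually_ge_atTop 2)
  have hτ : ∀ᶠ k in l, t k ≤ τ k := by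
    filter_upwards [ht.eventually_lt h.change h.pos, hpos] with k hk hk0
    rw [div_lt_div_iff_of_pos_right hk0] at hk
    exact_mod_cast hk.le
  refine tendsto_criterion_zero (r := fun k => M * ((t k : ℝ) / N k) + e k)
    (s := fun k => ((N k : ℝ)⁻¹ * ∑ i ∈ lastSet (N k) (t k), ‖z k i‖) ^ 2 /
      (1 - (t k : ℝ) / N k)) ?_ ?_ ?_ ?_
  · filter_upwards [hm, hm2] with k h1 h2
    omega
  · filter_upwards [hm, hm2, hτ, hM, hpos] with k h1 h2 h3 h4 h5
    have e1 : ∑ i ∈ firstSet (N k) (t k), ‖z k i‖ =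
        frontSum (fun x => ‖x‖) (z k) (τ k) (t k) := by
      unfold frontSum
      refine Finset.sum_congr ?_ fun _ _ => rfl
      ext i
      simp only [mem_firstSet, Finset.mem_filter_univ]
      omega
    have ht0 : (0 : ℝ) < t k := by
      have : 0 < t k := by omega
      exact_mod_cast this
    rw [e1, div_le_iff₀ (by positivity)]
    refine (h4 _ h1.1 h3).trans (le_of_eq ?_)
    field_simp
  · filter_upwards [hm, hm2, hpos] with k h1 h2 h3
    have ht0 : (0 : ℝ) < (N k : ℝ) - t k := by
      have : t k < N k := by omega
      exact sub_pos.2 (by exact_mod_cast this)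
    refine le_of_eq ?_
    field_simp
  · have := ((ht.const_sub 1).mul ((ht.const_mul M).add he)).add
      (ht.mul ((hJ.pow 2).div (ht.const_sub 1) (by norm_num)))
    simpa using this

/-- Mirror image of `tendsto_criterion_at_zero`: the short part is the last one, controlled by the
front of the reversed sample. -/
lemma tendsto_criterion_at_one (h : TwoSidedControl l N τ m z F G θ)
    (hm : ∀ᶠ k in l, m k ≤ t k ∧ t k + m k ≤ N k)
    (ht : Tendsto (fun k => (t k : ℝ) / N k) l (𝓝 1)) :
    Tendsto (fun k => criterion (z k) (t k)) l (𝓝 0) := by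
  have htN : ∀ᶠ k in l, t k ≤ N k := hm.mono fun k hk => by omega
  obtain ⟨M, e, he, hM⟩ := h.back.small
  have hI := h.empiricalLimit_first htN ht zero_le_one le_rfl _ linearGrowth_norm
  have hpos : ∀ᶠ k in l, (0 : ℝ) < N k := by
    filter_upwards [h.size.eventually (eventually_gt_atTop 0)] with k hk
    exact_mod_cast hk
  have hm2 := h.margin.eventually (eventually_ge_atTop 2)
  have hτ : ∀ᶠ k in l, τ k ≤ t k := by
    filter_upwards [h.change.eventually_lt ht h.lt_one, hpos] with k hk hk0
    rw [div_lt_div_iff_of_pos_right hk0] at hk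
    exact_mod_cast hk.le
  refine tendsto_criterion_zero
    (r := fun k => ((N k : ℝ)⁻¹ * ∑ i ∈ firstSet (N k) (t k), ‖z k i‖) ^ 2 / ((t k : ℝ) / N k))
    (s := fun k => M * (1 - (t k : ℝ) / N k) + e k) ?_ ?_ ?_ ?_
  · filter_upwards [hm, hm2] with k h1 h2
    omega
  · filter_upwards [hm, hm2, hpos] with k h1 h2 h3
    have ht0 : (0 : ℝ) < t k := by
      have : 0 < t k := by omega
      exact_mod_cast this
    refine le_of_eq ?_
    field_simp
  · filter_upwards [hm, hm2, hτ, hM, hpos, htN] with k h1 h2 h3 h4 h5 h6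
    have e1 : ∑ i ∈ lastSet (N k) (t k), ‖z k i‖ =
        frontSum (fun x => ‖x‖) (fun i => z k i.rev) (N k - τ k) (N k - t k) := by
      rw [frontSum_rev (h.change_le k) h6 (fun x : Vec d => ‖x‖)]
      refine Finset.sum_congr ?_ fun _ _ => rfl
      ext i
      simp only [mem_lastSet, Finset.mem_filter_univ]
      omega
    have ht0 : (0 : ℝ) < (N k : ℝ) - t k := by
      have : t k < N k := by omega
      exact sub_pos.2 (by exact_mod_cast this)
    have h7 := h4 (N k - t k) (by omega) (by omega)
    rw [Nat.cast_sub h6] at h7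
    rw [e1, div_le_iff₀ (by positivity)]
    refine h7.trans (le_of_eq ?_)
    field_simp
  · have := ((ht.const_sub 1).mul ((hI.pow 2).div ht (by norm_num))).add
      (ht.mul (((ht.const_sub 1).const_mul M).add he))
    simpa using this

/-- Splits at which the criterion is at least as large as at the change converge to the change. -/
theorem tendsto_maximiser (h : TwoSidedControl l N τ m z F G θ) (hne : F ≠ G)
    (hm : ∀ᶠ k in l, m k ≤ t k ∧ t k + m k ≤ N k)
    (hmax : ∀ᶠ k in l, criterion (z k) (τ k) ≤ criterion (z k) (t k)) :
    Tendsto (fun k => (t k : ℝ) / N k) l (𝓝 θ) := by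
  have henergy := energy_pos h.integrable_left h.integrable_right hne
  -- The two differences add up to the energy distance, so they cannot both vanish.
  have hS : 0 < (meanDist F G - meanDist F F) ^ 2 + (meanDist F G - meanDist G G) ^ 2 := by
    by_contra hcon
    have h1 := sq_nonneg (meanDist F G - meanDist F F)
    have h2 := sq_nonneg (meanDist F G - meanDist G G)
    have h3 : meanDist F G - meanDist F F = 0 := pow_eq_zero_iff two_ne_zero |>.1 (by linarith)
    have h4 : meanDist F G - meanDist G G = 0 := pow_eq_zero_iff two_ne_zero |>.1 (by linarith)
    linarith
  have hθ0 := h.pos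
  have hθ1 := h.lt_one
  have hpos : 0 < θ * (1 - θ) := mul_pos hθ0 (by linarith)
  rw [tendsto_iff_ultrafilter]
  -- Along an ultrafilter the fractions converge by compactness of `[0, 1]`. It remains to identify
  -- the limit.
  intro U hU
  replace h := h.mono hU
  replace hm := hm.filter_mono hU
  replace hmax := hmax.filter_mono hU
  have htN : ∀ᶠ k in (U : Filter ι), t k ≤ N k := hm.mono fun k hk => by omega
  have hmem : ∀ᶠ k in (U : Filter ι), (t k : ℝ) / N k ∈ Set.Icc (0 : ℝ) 1 := by
    filter_upwards [htN] with k hk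
    exact ⟨by positivity, div_le_one_of_le₀ (by exact_mod_cast hk) (by positivity)⟩
  obtain ⟨γ, hγ, hlim⟩ := isCompact_Icc.ultrafilter_le_nhds (U.map fun k => (t k : ℝ) / N k)
    (le_principal_iff.2 hmem)
  have hlim : Tendsto (fun k => (t k : ℝ) / N k) U (𝓝 γ) := hlim
  have hτ := h.tendsto_criterion_change
  suffices γ = θ by rwa [this] at hlim
  rcases hγ.1.eq_or_lt with h0 | h0
  · subst h0
    have := le_of_tendsto_of_tendsto hτ (h.tendsto_criterion_at_zero hm hlim) hmax
    exact absurd this (not_le.2 (mul_pos hpos hS))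
  rcases hγ.2.eq_or_lt with h1 | h1
  · subst h1
    have := le_of_tendsto_of_tendsto hτ (h.tendsto_criterion_at_one hm hlim) hmax
    exact absurd this (not_le.2 (mul_pos hpos hS))
  -- The limit at the change is at most the bound at `γ`; cancelling `S` and the common factor
  -- leaves `θ ≤ γ` on the left and `γ ≤ θ` on the right.
  rcases le_total γ θ with h2 | h2
  · obtain ⟨L, hL, hLle⟩ := h.tendsto_criterion_left htN hlim h0 h2
    have := (le_of_tendsto_of_tendsto hτ hL hmax).trans hLle
    have h3 := le_of_mul_le_mul_right this hS
    have h4 := le_of_mul_le_mul_right h3 (by linarith)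
    exact le_antisymm h2 h4
  · obtain ⟨L, hL, hLle⟩ := h.tendsto_criterion_right htN hlim h2 h1
    have := (le_of_tendsto_of_tendsto hτ hL hmax).trans hLle
    have h3 := le_of_mul_le_mul_right this hS
    rw [mul_comm] at h3
    have h4 := le_of_mul_le_mul_right h3 hθ0
    linarith

end TwoSidedControl

end Localisation

/-! ### Fourth moments of sums of independent variables -/

section Moments

variable {Ω : Type*} [MeasurableSpace Ω] {P : Measure Ω} [IsProbabilityMeasure P]

lemma integrable_pow_of_integrable_pow_four {X : Ω → ℝ} (hX : AEMeasurable X P)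
    (h4 : Integrable (fun ω => X ω ^ 4) P) {k : ℕ} (hk : k ≤ 4) :
    Integrable (fun ω => X ω ^ k) P := by
  refine ((integrable_const (1 : ℝ)).add h4).mono' (hX.pow_const k).aestronglyMeasurable
    (ae_of_all _ fun ω => ?_)
  simp only [Pi.add_apply, Real.norm_eq_abs, abs_pow]
  have h1 : X ω ^ 4 = |X ω| ^ 4 := (Even.pow_abs (by decide) _).symm
  rw [h1]
  rcases le_total |X ω| 1 with h | h
  · linarith [pow_le_one₀ (n := k) (abs_nonneg (X ω)) h, pow_nonneg (abs_nonneg (X ω)) 4]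
  · linarith [pow_le_pow_right₀ h hk]

/-- In the binomial expansions every cross term with a first power of `M` or `X` vanishes, by
independence and centring. -/
lemma IndepFun.moments_add {M X : Ω → ℝ} (hMX : IndepFun M X P) (hM : AEMeasurable M P)
    (hX : AEMeasurable X P) (hM4 : Integrable (fun ω => M ω ^ 4) P)
    (hX4 : Integrable (fun ω => X ω ^ 4) P) (hM0 : ∫ ω, M ω ∂P = 0) (hX0 : ∫ ω, X ω ∂P = 0) :
    Integrable (fun ω => (M ω + X ω) ^ 4) P ∧ ∫ ω, (M ω + X ω) ∂P = 0 ∧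
    ∫ ω, (M ω + X ω) ^ 2 ∂P = ∫ ω, M ω ^ 2 ∂P + ∫ ω, X ω ^ 2 ∂P ∧
    ∫ ω, (M ω + X ω) ^ 4 ∂P = ∫ ω, M ω ^ 4 ∂P +
      6 * ((∫ ω, M ω ^ 2 ∂P) * ∫ ω, X ω ^ 2 ∂P) + ∫ ω, X ω ^ 4 ∂P := by
  have iM : ∀ k ≤ 4, Integrable (fun ω => M ω ^ k) P := fun k hk =>
    integrable_pow_of_integrable_pow_four hM hM4 hk
  have iX : ∀ k ≤ 4, Integrable (fun ω => X ω ^ k) P := fun k hk =>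
    integrable_pow_of_integrable_pow_four hX hX4 hk
  have iM1 : Integrable M P := by simpa using iM 1 (by norm_num)
  have iX1 : Integrable X P := by simpa using iX 1 (by norm_num)
  have ind : ∀ j k : ℕ, IndepFun (fun ω => M ω ^ j) (fun ω => X ω ^ k) P := fun j k =>
    hMX.comp (measurable_id.pow_const j) (measurable_id.pow_const k)
  have ip : ∀ j ≤ 4, ∀ k ≤ 4, Integrable (fun ω => M ω ^ j * X ω ^ k) P := fun j hj k hk =>
    (ind j k).integrable_mul (iM j hj) (iX k hk)
  have ep : ∀ j ≤ 4, ∀ k ≤ 4, ∫ ω, M ω ^ j * X ω ^ k ∂P =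
      (∫ ω, M ω ^ j ∂P) * ∫ ω, X ω ^ k ∂P := fun j hj k hk =>
    (ind j k).integral_fun_mul_eq_mul_integral (iM j hj).aestronglyMeasurable
      (iX k hk).aestronglyMeasurable
  have p11 := ip 1 (by norm_num) 1 (by norm_num)
  have p31 := ip 3 (by norm_num) 1 (by norm_num)
  have p22 := ip 2 (by norm_num) 2 (by norm_num)
  have p13 := ip 1 (by norm_num) 3 (by norm_num)
  have e11 := ep 1 (by norm_num) 1 (by norm_num)
  have e31 := ep 3 (by norm_num) 1 (by norm_num)
  have e22 := ep 2 (by norm_num) 2 (by norm_num)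
  have e13 := ep 1 (by norm_num) 3 (by norm_num)
  simp only [pow_one] at p11 p31 p13 e11 e31 e13
  rw [hX0, mul_zero] at e11 e31
  rw [hM0, zero_mul] at e13
  have x2 : (fun ω => (M ω + X ω) ^ 2) = fun ω => M ω ^ 2 + 2 * (M ω * X ω) + X ω ^ 2 := by
    funext ω; ring
  have x4 : (fun ω => (M ω + X ω) ^ 4) = fun ω => M ω ^ 4 + 4 * (M ω ^ 3 * X ω) +
      6 * (M ω ^ 2 * X ω ^ 2) + 4 * (M ω * X ω ^ 3) + X ω ^ 4 := by
    funext ω; ring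
  have i2 := iM 2 (by norm_num)
  have j2 := iX 2 (by norm_num)
  have q1 : Integrable (fun ω => M ω ^ 4 + 4 * (M ω ^ 3 * X ω)) P := hM4.add (p31.const_mul 4)
  have q2 : Integrable (fun ω => M ω ^ 4 + 4 * (M ω ^ 3 * X ω) + 6 * (M ω ^ 2 * X ω ^ 2)) P :=
    q1.add (p22.const_mul 6)
  have q3 : Integrable (fun ω => M ω ^ 4 + 4 * (M ω ^ 3 * X ω) + 6 * (M ω ^ 2 * X ω ^ 2) +
      4 * (M ω * X ω ^ 3)) P := q2.add (p13.const_mul 4)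
  have r1 : Integrable (fun ω => M ω ^ 2 + 2 * (M ω * X ω)) P := i2.add (p11.const_mul 2)
  refine ⟨?_, ?_, ?_, ?_⟩
  · rw [x4]; exact q3.add hX4
  · rw [integral_add iM1 iX1, hM0, hX0, add_zero]
  · rw [x2, integral_add r1 j2, integral_add i2 (p11.const_mul 2), integral_const_mul, e11]
    ring
  · rw [x4, integral_add q3 hX4, integral_add q2 (p13.const_mul 4),
      integral_add q1 (p22.const_mul 6), integral_add hM4 (p31.const_mul 4), integral_const_mul,
      integral_const_mul, integral_const_mul, e31, e22, e13]
    ring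

/-- The fourth moment of a sum of `s` independent centred variables is of order `s²`. -/
lemma fourth_moment_sum_le {κ : Type*} {X : κ → Ω → ℝ} (hind : iIndepFun X P)
    (hm : ∀ i, AEMeasurable (X i) P) {σ K : ℝ} (s : Finset κ)
    (h4 : ∀ i ∈ s, Integrable (fun ω => X i ω ^ 4) P) (h0 : ∀ i ∈ s, ∫ ω, X i ω ∂P = 0)
    (h2 : ∀ i ∈ s, ∫ ω, X i ω ^ 2 ∂P = σ) (hK : ∀ i ∈ s, ∫ ω, X i ω ^ 4 ∂P = K) :
    Integrable (fun ω => (∑ i ∈ s, X i ω) ^ 4) P ∧ ∫ ω, ∑ i ∈ s, X i ω ∂P = 0 ∧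
    ∫ ω, (∑ i ∈ s, X i ω) ^ 2 ∂P = s.card * σ ∧
    ∫ ω, (∑ i ∈ s, X i ω) ^ 4 ∂P ≤ 3 * σ ^ 2 * s.card ^ 2 + K * s.card := by
  classical
  induction s using Finset.induction_on with
  | empty => simp
  | insert a s ha ih =>
    obtain ⟨i1, i2, i3, i4⟩ := ih (fun i hi => h4 i (Finset.mem_insert_of_mem hi))
      (fun i hi => h0 i (Finset.mem_insert_of_mem hi))
      (fun i hi => h2 i (Finset.mem_insert_of_mem hi))
      (fun i hi => hK i (Finset.mem_insert_of_mem hi))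
    have hsa := Finset.mem_insert_self a s
    have hI : IndepFun (fun ω => ∑ i ∈ s, X i ω) (X a) P := by
      have := hind.indepFun_finsetSum_of_notMem₀ hm ha
      convert this using 1
      funext ω
      simp
    obtain ⟨j1, j2, j3, j4⟩ := IndepFun.moments_add hI
      (Finset.aemeasurable_fun_sum s fun i _ => hm i) (hm a) i1 (h4 a hsa) i2 (h0 a hsa)
    have e : ∀ ω, ∑ i ∈ insert a s, X i ω = ∑ i ∈ s, X i ω + X a ω := fun ω => by
      rw [Finset.sum_insert ha, add_comm]
    simp only [e, Finset.card_insert_of_notMem ha]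
    refine ⟨j1, j2, ?_, ?_⟩
    · rw [j3, i3, h2 a hsa]; push_cast; ring
    -- With `s` the old cardinality, the cross term `6sσ²` is absorbed by `3σ²((s + 1)² - s²)`.
    · rw [j4, i3, h2 a hsa, hK a hsa]
      push_cast
      nlinarith [sq_nonneg σ]

end Moments

/-! ### Almost sure convergence and convergence in probability as filters -/

section Filters

variable {Ω : Type*} [MeasurableSpace Ω]

/-- Sets that almost surely contain `(n, ω)` for all large `n`. Convergence along this filter is
almost sure convergence. -/
def aeFilter (P : Measure Ω) : Filter (ℕ × Ω) where
  sets := {B | ∀ᵐ ω ∂P, ∀ᶠ n in atTop, (n, ω) ∈ B}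
  univ_sets := by simp
  sets_of_superset {B C} h hBC := by
    have h : ∀ᵐ ω ∂P, ∀ᶠ n in atTop, (n, ω) ∈ B := h
    exact h.mono fun ω hω => hω.mono fun n hn => hBC hn
  inter_sets {B C} h h' := by
    have h : ∀ᵐ ω ∂P, ∀ᶠ n in atTop, (n, ω) ∈ B := h
    have h' : ∀ᵐ ω ∂P, ∀ᶠ n in atTop, (n, ω) ∈ C := h'
    exact (h.and h').mono fun ω hω => (hω.1.and hω.2).mono fun n hn => hn

lemma eventually_aeFilter {P : Measure Ω} {p : ℕ × Ω → Prop} :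
    (∀ᶠ k in aeFilter P, p k) ↔ ∀ᵐ ω ∂P, ∀ᶠ n in atTop, p (n, ω) := Iff.rfl

/-- Sets that contain `(n, ω)` with probability tending to one. Convergence along this filter is
convergence in probability. -/
def probFilter (P : Measure Ω) : Filter (ℕ × Ω) where
  sets := {B | Tendsto (fun n => P {ω | (n, ω) ∉ B}) atTop (𝓝 0)}
  univ_sets := by simp
  sets_of_superset {B C} h hBC := by
    refine tendsto_of_tendsto_of_tendsto_of_le_of_le tendsto_const_nhds h
      (fun _ => zero_le) fun n => measure_mono fun ω hω hB => hω (hBC hB)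
  inter_sets {B C} h h' := by
    have h2 : Tendsto (fun n => P {ω | (n, ω) ∉ B} + P {ω | (n, ω) ∉ C}) atTop (𝓝 0) := by
      simpa using h.add h'
    refine tendsto_of_tendsto_of_tendsto_of_le_of_le tendsto_const_nhds h2
      (fun _ => zero_le) fun n => (measure_mono fun ω hω => ?_).trans (measure_union_le _ _)
    by_contra hcon
    simp only [Set.mem_union, Set.mem_ofPred_eq, not_or, not_not] at hcon
    exact hω hcon

lemma eventually_probFilter {P : Measure Ω} {p : ℕ × Ω → Prop} :
    (∀ᶠ k in probFilter P, p k) ↔ Tendsto (fun n => P {ω | ¬ p (n, ω)}) atTop (𝓝 0) := Iff.rfl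

/-- Along `l`, nonnegative variables with summable expectations tend to zero, and the sample size
tends to infinity. -/
structure SummableVanish (P : Measure Ω) (l : Filter (ℕ × Ω)) : Prop where
  fst : Tendsto Prod.fst l atTop
  tendsto_zero : ∀ W : ℕ → Ω → ℝ, (∀ n, Integrable (W n) P) → (∀ n ω, 0 ≤ W n ω) →
    Summable (fun n => ∫ ω, W n ω ∂P) → Tendsto (fun k : ℕ × Ω => W k.1 k.2) l (𝓝 0)

/-- The exceptional null set may depend on the accuracy. Countably many accuracies `1/(j + 1)`
suffice, so the null sets can be united. -/
lemma tendsto_aeFilter {P : Measure Ω} {f : ℕ × Ω → ℝ} {a : ℝ} :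
    Tendsto f (aeFilter P) (𝓝 a) ↔ ∀ᵐ ω ∂P, Tendsto (fun n => f (n, ω)) atTop (𝓝 a) := by
  constructor
  · intro h
    have h1 : ∀ j : ℕ, ∀ᵐ ω ∂P, ∀ᶠ n in atTop, dist (f (n, ω)) a < 1 / ((j : ℝ) + 1) := fun j =>
      Metric.tendsto_nhds.1 h _ Nat.one_div_pos_of_nat
    filter_upwards [ae_all_iff.2 h1] with ω hω
    rw [Metric.tendsto_nhds]
    intro ε hε
    obtain ⟨j, hj⟩ := exists_nat_one_div_lt hε
    filter_upwards [hω j] with n hn using hn.trans hj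
  · intro h
    rw [Metric.tendsto_nhds]
    intro ε hε
    rw [eventually_aeFilter]
    filter_upwards [h] with ω hω using Metric.tendsto_nhds.1 hω ε hε

lemma tendsto_fst_aeFilter (P : Measure Ω) : Tendsto Prod.fst (aeFilter P) atTop := by
  intro s hs
  exact ae_of_all _ fun ω => hs

lemma tendsto_fst_probFilter (P : Measure Ω) : Tendsto Prod.fst (probFilter P) atTop := by
  intro s hs
  refine tendsto_const_nhds.congr' ?_
  filter_upwards [hs] with n hn
  symm
  have : {ω : Ω | (n, ω) ∉ Prod.fst ⁻¹' s} = ∅ := by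
    ext ω; simpa using hn
  rw [this, measure_empty]

/-- The sum of the variables has finite expectation, so it is almost surely finite and its terms
tend to zero. -/
lemma summableVanish_aeFilter (P : Measure Ω) : SummableVanish P (aeFilter P) := by
  refine ⟨tendsto_fst_aeFilter P, fun W hW h0 hs => tendsto_aeFilter.2 ?_⟩
  have h1 : ∫⁻ ω, ∑' n, ENNReal.ofReal (W n ω) ∂P ≠ ∞ := by
    rw [lintegral_tsum fun n => (hW n).aemeasurable.ennreal_ofReal]
    have : ∀ n, ∫⁻ ω, ENNReal.ofReal (W n ω) ∂P = ENNReal.ofReal (∫ ω, W n ω ∂P) := fun n =>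
      (ofReal_integral_eq_lintegral_ofReal (hW n) (ae_of_all _ (h0 n))).symm
    simp_rw [this]
    rw [← ENNReal.ofReal_tsum_of_nonneg (fun n => integral_nonneg (h0 n)) hs]
    exact ENNReal.ofReal_ne_top
  have h2 := ae_lt_top' (AEMeasurable.tsum fun n => (hW n).aemeasurable.ennreal_ofReal) h1
  filter_upwards [h2] with ω hω
  have h3 := ENNReal.tendsto_atTop_zero_of_tsum_ne_top hω.ne
  have h4 := (ENNReal.tendsto_toReal ENNReal.zero_ne_top).comp h3
  simpa [Function.comp_def, ENNReal.toReal_ofReal (h0 _ ω)] using h4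

/-- Markov's inequality. -/
lemma tendsto_probFilter_zero {P : Measure Ω} {W : ℕ → Ω → ℝ}
    (hW : ∀ᶠ n in atTop, Integrable (W n) P) (h0 : ∀ n ω, 0 ≤ W n ω)
    (hs : Tendsto (fun n => ∫ ω, W n ω ∂P) atTop (𝓝 0)) :
    Tendsto (fun k : ℕ × Ω => W k.1 k.2) (probFilter P) (𝓝 0) := by
  rw [Metric.tendsto_nhds]
  intro ε hε
  rw [eventually_probFilter]
  have h1 : Tendsto (fun n => ENNReal.ofReal (∫ ω, W n ω ∂P) / ENNReal.ofReal ε) atTop (𝓝 0) := by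
    have := (ENNReal.tendsto_ofReal hs)
    rw [ENNReal.ofReal_zero] at this
    have h2 := ENNReal.Tendsto.div_const this (b := ENNReal.ofReal ε) (by simp [hε])
    simpa using h2
  refine tendsto_of_tendsto_of_tendsto_of_le_of_le' tendsto_const_nhds h1
    (.of_forall fun _ => zero_le) ?_
  filter_upwards [hW] with n hWn
  rw [ofReal_integral_eq_lintegral_ofReal hWn (ae_of_all _ (h0 n))]
  refine (measure_mono fun ω hω => ?_).trans (meas_ge_le_lintegral_div
    hWn.aemeasurable.ennreal_ofReal (by simp [hε]) ENNReal.ofReal_ne_top)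
  simp only [Set.mem_ofPred_eq, Real.dist_eq, sub_zero, not_lt, abs_of_nonneg (h0 n ω)] at hω
  exact ENNReal.ofReal_le_ofReal hω

lemma summableVanish_probFilter (P : Measure Ω) : SummableVanish P (probFilter P) :=
  ⟨tendsto_fst_probFilter P, fun _ hW h0 hs =>
    tendsto_probFilter_zero (.of_forall hW) h0 hs.tendsto_atTop_zero⟩

end Filters

/-! ### Elementary limits -/

lemma tendsto_of_tendsto_pow_four {ι : Type*} {l : Filter ι} {f : ι → ℝ}
    (h : Tendsto (fun k => f k ^ 4) l (𝓝 0)) : Tendsto f l (𝓝 0) := by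
  have h1 := h.sqrt.sqrt
  rw [Real.sqrt_zero, Real.sqrt_zero] at h1
  rw [tendsto_zero_iff_abs_tendsto_zero]
  refine h1.congr fun k => ?_
  have : f k ^ 4 = (f k ^ 2) ^ 2 := by ring
  rw [this, Real.sqrt_sq (sq_nonneg _), Real.sqrt_sq_eq_abs]
  rfl

lemma tendsto_floor_mul_div (γ : ℝ) :
    Tendsto (fun n : ℕ => (⌊γ * n⌋₊ : ℝ) / n) atTop (𝓝 (max γ 0)) := by
  rcases le_total 0 γ with h | h
  · rw [max_eq_left h]
    exact (tendsto_nat_floor_mul_div_atTop h).comp tendsto_natCast_atTop_atTop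
  · rw [max_eq_right h]
    have : ∀ n : ℕ, ⌊γ * n⌋₊ = 0 := fun n =>
      Nat.floor_of_nonpos (mul_nonpos_of_nonpos_of_nonneg h n.cast_nonneg)
    simp [this]

lemma tendsto_min_floor_div {τ : ℕ → ℕ} {θ : ℝ}
    (hτ : Tendsto (fun n => (τ n : ℝ) / n) atTop (𝓝 θ)) (γ : ℝ) :
    Tendsto (fun n : ℕ => ((min ⌊γ * n⌋₊ (τ n) : ℕ) : ℝ) / n) atTop (𝓝 (min (max γ 0) θ)) := by
  refine ((tendsto_floor_mul_div γ).min hτ).congr fun n => ?_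
  rw [Nat.cast_min, min_div_div_right n.cast_nonneg]

lemma frontSum_eq_sum_firstSet {E : Type*} [NormedAddCommGroup E] {n : ℕ} (f : E → ℝ)
    (z : Fin n → E) (τ t : ℕ) :
    frontSum f z τ t = ∑ i ∈ firstSet n (min t τ), f (z i) := by
  unfold frontSum firstSet
  refine Finset.sum_congr ?_ fun _ _ => rfl
  ext i
  simp

/-! ### Control of the pre-change observations -/

section Model

variable {Ω : Type*} [MeasurableSpace Ω] {d : ℕ}

/-- Rows of independent observations, the first `τ n` of which have law `F`. -/
structure FrontModel (P : Measure Ω) (Z : (n : ℕ) → Fin n → Ω → Vec d) (τ : ℕ → ℕ)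
    (F : Measure (Vec d)) : Prop where
  indep : ∀ n, iIndepFun (Z n) P
  aemeasurable : ∀ n i, AEMeasurable (Z n i) P
  law : ∀ (n : ℕ) (i : Fin n), (i : ℕ) < τ n → HasLaw (Z n i) F P

namespace FrontModel

variable {P : Measure Ω} [IsProbabilityMeasure P] {Z : (n : ℕ) → Fin n → Ω → Vec d} {τ : ℕ → ℕ}
  {F : Measure (Vec d)} [IsProbabilityMeasure F]

/-- The centred sum of `f` over the first `u` observations. -/
noncomputable def deviation (F : Measure (Vec d)) (f : Vec d → ℝ) {n : ℕ} (z : Fin n → Vec d)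
    (u : ℕ) : ℝ :=
  ∑ i ∈ firstSet n u, (f (z i) - ∫ x, f x ∂F)

lemma frontSum_eq_deviation {n : ℕ} (f : Vec d → ℝ) (z : Fin n → Vec d) {τ : ℕ} (hτ : τ ≤ n)
    (t : ℕ) :
    frontSum f z τ t = deviation F f z (min t τ) + (min t τ : ℕ) * ∫ x, f x ∂F := by
  rw [frontSum_eq_sum_firstSet, deviation, Finset.sum_sub_distrib, Finset.sum_const,
    card_firstSet ((min_le_right _ _).trans hτ), nsmul_eq_mul]
  ring

/-- Fourth moments of the centred sums grow at most quadratically. -/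
lemma exists_fourth_moment_le (h : FrontModel P Z τ F) (hτ : ∀ n, τ n ≤ n) {f : Vec d → ℝ}
    (hf : Measurable f) (h4 : MemLp f 4 F) :
    ∃ C : ℝ, 0 ≤ C ∧ ∀ n u, u ≤ τ n →
      Integrable (fun ω => deviation F f (fun i => Z n i ω) u ^ 4) P ∧
      ∫ ω, deviation F f (fun i => Z n i ω) u ^ 4 ∂P ≤ C * (u : ℝ) ^ 2 := by
  set g : Vec d → ℝ := fun x => f x - ∫ x, f x ∂F with hg
  have hgm : Measurable g := hf.sub_const _
  have hf1 : Integrable f F := h4.integrable (by norm_num)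
  have hg0 : ∫ x, g x ∂F = 0 := by
    rw [hg, integral_sub hf1 (integrable_const _)]; simp
  have hg4 : Integrable (fun x => g x ^ 4) F := by
    have h5 : MemLp g ((4 : ℕ) : ℝ≥0∞) F := by
      have := h4.sub (memLp_const (∫ x, f x ∂F))
      exact_mod_cast this
    refine (h5.integrable_norm_pow (by norm_num)).congr (ae_of_all _ fun x => ?_)
    simp only [Real.norm_eq_abs]
    exact Even.pow_abs (by decide) _
  set σ := ∫ x, g x ^ 2 ∂F
  set K := ∫ x, g x ^ 4 ∂F
  have hK : 0 ≤ K := integral_nonneg fun x => by positivity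
  refine ⟨3 * σ ^ 2 + K, by positivity, fun n u hu => ?_⟩
  have hind : iIndepFun (fun i => g ∘ Z n i) P := (h.indep n).comp _ fun _ => hgm
  have hlaw : ∀ i ∈ firstSet n u, HasLaw (Z n i) F P := fun i hi =>
    h.law n i ((mem_firstSet.1 hi).trans_le hu)
  have hint : ∀ k : ℕ, ∀ i ∈ firstSet n u, ∫ ω, (g ∘ Z n i) ω ^ k ∂P = ∫ x, g x ^ k ∂F := by
    intro k i hi
    have := (hlaw i hi).integral_comp (f := fun x => g x ^ k)
      (hgm.pow_const k).aestronglyMeasurable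
    simpa [Function.comp_def] using this
  obtain ⟨r1, -, -, r4⟩ := fourth_moment_sum_le hind
    (fun i => hgm.comp_aemeasurable (h.aemeasurable n i)) (σ := σ) (K := K) (firstSet n u)
    (fun i hi => by
      have h6 := hg4
      rw [← (hlaw i hi).map_eq] at h6
      exact h6.comp_aemeasurable (hlaw i hi).aemeasurable)
    (fun i hi => by simpa [hg0] using hint 1 i hi) (fun i hi => hint 2 i hi)
    (fun i hi => hint 4 i hi)
  refine ⟨r1, r4.trans ?_⟩
  rw [card_firstSet (hu.trans (hτ n))]
  -- Since `u` is a natural number, `u ≤ u²`, and the linear term of the moment bound merges with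
  -- the quadratic one.
  have : (u : ℝ) ≤ (u : ℝ) ^ 2 := by exact_mod_cast Nat.le_self_pow two_ne_zero u
  nlinarith

/-- The fourth power of the normalised deviation has expectation at most `C n² / n⁴`, which is
summable; this is all that `SummableVanish` asks for. -/
lemma frontLimit (h : FrontModel P Z τ F) (hτ : ∀ n, τ n ≤ n) {θ : ℝ}
    (hτθ : Tendsto (fun n => (τ n : ℝ) / n) atTop (𝓝 θ)) {l : Filter (ℕ × Ω)}
    (hl : SummableVanish P l) {f : Vec d → ℝ} (hf : Measurable f) (h4 : MemLp f 4 F) :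
    FrontLimit l Prod.fst (fun k => τ k.1) (fun k i => Z k.1 i k.2) f θ (∫ x, f x ∂F) := by
  intro γ
  obtain ⟨C, hC0, hC⟩ := h.exists_fourth_moment_le hτ hf h4
  set u : ℕ → ℕ := fun n => min ⌊γ * n⌋₊ (τ n) with hu
  have huτ : ∀ n, u n ≤ τ n := fun n => min_le_right _ _
  have hW := hl.tendsto_zero
    (fun n ω => ((n : ℝ)⁻¹ * deviation F f (fun i => Z n i ω) (u n)) ^ 4)
    (fun n => by simpa only [mul_pow] using (hC n _ (huτ n)).1.const_mul ((n : ℝ)⁻¹ ^ 4))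
    (fun n ω => by positivity) (by
      refine Summable.of_nonneg_of_le (fun n => integral_nonneg fun ω => by positivity)
        (fun n => ?_) ((Real.summable_one_div_nat_pow.2 one_lt_two).mul_left C)
      simp_rw [mul_pow]
      rw [integral_const_mul]
      have h1 : (u n : ℝ) ≤ n := by exact_mod_cast (huτ n).trans (hτ n)
      have h2 := (hC n _ (huτ n)).2
      rcases Nat.eq_zero_or_pos n with rfl | hn
      · simp
      have hn' : (0 : ℝ) < n := by exact_mod_cast hn
      calc (n : ℝ)⁻¹ ^ 4 * ∫ ω, deviation F f (fun i => Z n i ω) (u n) ^ 4 ∂P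
          ≤ (n : ℝ)⁻¹ ^ 4 * (C * (n : ℝ) ^ 2) := by gcongr; exact h2.trans (by gcongr)
        _ = C * (1 / (n : ℝ) ^ 2) := by field_simp)
  have hA := tendsto_of_tendsto_pow_four hW
  have hB := ((tendsto_min_floor_div hτθ γ).comp hl.fst).mul_const (∫ x, f x ∂F)
  have := hA.add hB
  rw [zero_add] at this
  refine this.congr fun k => ?_
  rw [frontSum_eq_deviation (F := F) f _ (hτ k.1)]
  simp only [Function.comp_apply, hu]
  ring

lemma sqrt_succ_div_sq_summable :
    Summable fun n : ℕ => ((Nat.sqrt n : ℝ) + 1) / (n : ℝ) ^ 2 := by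
  refine Summable.of_nonneg_of_le (fun n => by positivity) (fun n => ?_)
    ((Real.summable_nat_rpow.2 (by norm_num : (-3 / 2 : ℝ) < -1)).mul_left 2)
  rcases Nat.eq_zero_or_pos n with rfl | hn
  · simp
  have hn' : (0 : ℝ) < n := by exact_mod_cast hn
  have h1 : (Nat.sqrt n : ℝ) ≤ (n : ℝ) ^ (1 / 2 : ℝ) := by
    rw [← Real.sqrt_eq_rpow]; exact Real.nat_sqrt_le_real_sqrt
  have h2 : (1 : ℝ) ≤ (n : ℝ) ^ (1 / 2 : ℝ) :=
    Real.one_le_rpow (by exact_mod_cast hn) (by norm_num)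
  have h3 : (n : ℝ) ^ (-3 / 2 : ℝ) = (n : ℝ) ^ (1 / 2 : ℝ) / (n : ℝ) ^ 2 := by
    rw [← Real.rpow_natCast, ← Real.rpow_sub hn']; norm_num
  rw [h3, ← mul_div_assoc]
  gcongr
  linarith

/-- Control of the observations before the change when they have fourth moments. -/
lemma frontControl_of_memLp (h : FrontModel P Z τ F) (hτ : ∀ n, τ n ≤ n) {θ : ℝ}
    (hτθ : Tendsto (fun n => (τ n : ℝ) / n) atTop (𝓝 θ)) {l : Filter (ℕ × Ω)}
    (hl : SummableVanish P l) (h4 : MemLp (fun x => x) 4 F) {m : ℕ → ℕ}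
    (hm : Tendsto m atTop atTop) :
    FrontControl l Prod.fst (fun k => τ k.1) (fun k => m k.1) (fun k i => Z k.1 i k.2) F θ := by
  refine ⟨fun f hf => h.frontLimit hτ hτθ hl hf.1 (hf.memLp h4), ?_⟩
  obtain ⟨C, hC0, hC⟩ := h.exists_fourth_moment_le hτ measurable_norm h4.norm
  set μ := ∫ x : Vec d, ‖x‖ ∂F with hμ
  have hμ0 : 0 ≤ μ := integral_nonneg fun x => norm_nonneg x
  -- The deviations are controlled only at the squares `(j + 1)²`, cut at the change. Monotonicity
  -- of norm sums interpolates between consecutive squares.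
  set s : ℕ → ℕ → ℕ := fun n j => min ((j + 1) ^ 2) (τ n) with hs
  have hsτ : ∀ n j, s n j ≤ τ n := fun n j => min_le_right _ _
  set D : ℕ → ℕ → Ω → ℝ := fun n j ω => deviation F (fun x => ‖x‖) (fun i => Z n i ω) (s n j)
    with hD
  -- The weight `(j + 1)⁴` matches the square of the length of the `j`-th block, so each term has
  -- expectation at most `C`. About `√n` terms divided by `n²` are summable.
  set R : ℕ → Ω → ℝ := fun n ω =>
    ∑ j ∈ Finset.range (Nat.sqrt n + 1), D n j ω ^ 4 / ((j : ℝ) + 1) ^ 4 with hR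
  have hR0 : ∀ n ω, 0 ≤ R n ω := fun n ω => Finset.sum_nonneg fun j _ => by positivity
  have hDi : ∀ n j, Integrable (fun ω => D n j ω ^ 4 / ((j : ℝ) + 1) ^ 4) P := fun n j =>
    (hC n _ (hsτ n j)).1.div_const _
  have hRi : ∀ n, Integrable (R n) P := fun n => integrable_finsetSum _ fun j _ => hDi n j
  have hRint : ∀ n, ∫ ω, R n ω ∂P ≤ C * ((Nat.sqrt n : ℝ) + 1) := by
    intro n
    rw [hR, integral_finsetSum _ fun j _ => hDi n j]
    have hj : ∀ j ∈ Finset.range (Nat.sqrt n + 1),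
        ∫ ω, D n j ω ^ 4 / ((j : ℝ) + 1) ^ 4 ∂P ≤ C := by
      intro j _
      rw [integral_div, div_le_iff₀ (by positivity)]
      refine (hC n _ (hsτ n j)).2.trans ?_
      have h1 : (s n j : ℝ) ≤ ((j : ℝ) + 1) ^ 2 := by
        exact_mod_cast (min_le_left ((j + 1) ^ 2) (τ n))
      calc C * (s n j : ℝ) ^ 2 ≤ C * (((j : ℝ) + 1) ^ 2) ^ 2 := by gcongr
        _ = _ := by ring
    refine (Finset.sum_le_sum hj).trans (le_of_eq ?_)
    simp [mul_comm]
  have hW := hl.tendsto_zero (fun n ω => R n ω / (n : ℝ) ^ 2) (fun n => (hRi n).div_const _)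
    (fun n ω => div_nonneg (hR0 n ω) (by positivity)) (by
      refine Summable.of_nonneg_of_le
        (fun n => integral_nonneg fun ω => div_nonneg (hR0 n ω) (by positivity))
        (fun n => ?_) (sqrt_succ_div_sq_summable.mul_left C)
      rw [integral_div, ← mul_div_assoc]
      gcongr
      exact hRint n)
  -- With `(j + 1)² ≤ 4t`, the bound `2D² + 2((j + 1)²μ)²` becomes `8t√R + 32μ²t²`, where `D` is the
  -- deviation at the square above `t`.
  refine ⟨32 * μ ^ 2, fun k => 8 * √(R k.1 k.2 / (k.1 : ℝ) ^ 2), ?_, ?_⟩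
  · simpa using hW.sqrt.const_mul 8
  · filter_upwards [(hm.comp hl.fst).eventually (eventually_ge_atTop 1)] with k hk t htm htτ
    obtain ⟨n, ω⟩ := k
    simp only [Function.comp_apply] at hk htm htτ ⊢
    set j := Nat.sqrt t with hj
    have ht1 : 1 ≤ t := hk.trans htm
    have hj1 : 1 ≤ j := Nat.le_sqrt.2 (by omega)
    have hjt : j * j ≤ t := Nat.sqrt_le t
    have htj : t < (j + 1) * (j + 1) := Nat.lt_succ_sqrt t
    have hjn : j ∈ Finset.range (Nat.sqrt n + 1) :=
      Finset.mem_range.2 (Nat.lt_succ_of_le (Nat.sqrt_le_sqrt (htτ.trans (hτ n))))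
    have hts : t ≤ (j + 1) ^ 2 := by rw [sq]; exact htj.le
    have hn' : (0 : ℝ) < n := by
      have : 0 < n := by have := hτ n; omega
      exact_mod_cast this
    -- the sum up to `t` is at most the sum up to `s n j`
    have h1 : frontSum (fun x => ‖x‖) (fun i => Z n i ω) (τ n) t ≤ D n j ω + ((j : ℝ) + 1) ^ 2 * μ := by
      refine (frontSum_mono (fun x => norm_nonneg x) _ _ hts).trans ?_
      rw [frontSum_eq_deviation (F := F) _ _ (hτ n)]
      have : ((min ((j + 1) ^ 2) (τ n) : ℕ) : ℝ) ≤ ((j : ℝ) + 1) ^ 2 := by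
        exact_mod_cast (min_le_left ((j + 1) ^ 2) (τ n))
      have h2 := mul_le_mul_of_nonneg_right this hμ0
      simpa [hD, hs] using h2
    have h0 : 0 ≤ frontSum (fun x => ‖x‖) (fun i => Z n i ω) (τ n) t :=
      Finset.sum_nonneg fun i _ => norm_nonneg _
    have h2 : D n j ω ^ 4 ≤ ((j : ℝ) + 1) ^ 4 * R n ω := by
      have := Finset.single_le_sum (f := fun j : ℕ => D n j ω ^ 4 / ((j : ℝ) + 1) ^ 4)
        (fun j _ => by positivity) hjn
      rw [mul_comm]
      exact (div_le_iff₀ (by positivity)).1 this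
    have h3 : D n j ω ^ 2 ≤ ((j : ℝ) + 1) ^ 2 * √(R n ω) := by
      refine le_of_sq_le_sq ?_ (by positivity)
      rw [mul_pow, Real.sq_sqrt (hR0 n ω)]
      calc _ = D n j ω ^ 4 := by ring
        _ ≤ _ := h2
        _ = _ := by ring
    -- As `j ≥ 1`, one has `j + 1 ≤ 2j`, and `j² ≤ t`.
    have h4 : ((j : ℝ) + 1) ^ 2 ≤ 4 * t := by
      have h5 : (j + 1) ^ 2 ≤ 4 * t := by nlinarith
      exact_mod_cast h5
    have h5 : √(R n ω / (n : ℝ) ^ 2) * n = √(R n ω) := by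
      rw [Real.sqrt_div (hR0 n ω), Real.sqrt_sq hn'.le, div_mul_cancel₀ _ hn'.ne']
    rw [mul_assoc 8, h5]
    have hr := Real.sqrt_nonneg (R n ω)
    have ht0 : (0 : ℝ) ≤ t := t.cast_nonneg
    have hJ0 : (0 : ℝ) ≤ ((j : ℝ) + 1) ^ 2 := by positivity
    calc frontSum (fun x => ‖x‖) (fun i => Z n i ω) (τ n) t ^ 2
        ≤ (D n j ω + ((j : ℝ) + 1) ^ 2 * μ) ^ 2 := by gcongr
      _ ≤ 2 * D n j ω ^ 2 + 2 * (((j : ℝ) + 1) ^ 2 * μ) ^ 2 := by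
          nlinarith [sq_nonneg (D n j ω - ((j : ℝ) + 1) ^ 2 * μ)]
      _ ≤ 2 * ((4 * t) * √(R n ω)) + 2 * ((4 * t) * μ) ^ 2 := by
          gcongr
          exact h3.trans (by gcongr)
      _ = _ := by ring

/-- Control of the observations before the change when they form a single sequence. -/
lemma frontControl_of_nested (h : FrontModel P Z τ F) (hτ : ∀ n, τ n ≤ n) {θ : ℝ} (hθ : 0 < θ)
    (hτθ : Tendsto (fun n => (τ n : ℝ) / n) atTop (𝓝 θ))
    (hnest : ∀ (m n : ℕ) (i : Fin m) (j : Fin n), (i : ℕ) < τ m → (j : ℕ) < τ n →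
      (i : ℕ) = (j : ℕ) → Z m i = Z n j)
    (hF : Integrable (fun x => x) F) {m : ℕ → ℕ} (hm : Tendsto m atTop atTop) :
    FrontControl (aeFilter P) Prod.fst (fun k => τ k.1) (fun k => m k.1)
      (fun k i => Z k.1 i k.2) F θ := by
  have hτtop : Tendsto τ atTop atTop := by
    rw [← tendsto_natCast_atTop_iff (R := ℝ)]
    have h1 := hτθ.pos_mul_atTop hθ tendsto_natCast_atTop_atTop
    refine h1.congr' ?_
    filter_upwards [eventually_ne_atTop 0] with n hn
    rw [div_mul_cancel₀]
    exact_mod_cast hn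
  -- Every position precedes the change in some row; by nesting, all such rows give the same
  -- variable there, which defines one infinite sequence.
  have hex : ∀ i : ℕ, ∃ n, i < τ n := fun i => (hτtop.eventually (eventually_gt_atTop i)).exists
  choose ν hν using hex
  set X : ℕ → Ω → Vec d := fun i => Z (ν i) ⟨i, (hν i).trans_le (hτ _)⟩ with hX
  have hXZ : ∀ (n : ℕ) (i : Fin n), (i : ℕ) < τ n → Z n i = X i := fun n i hi =>
    hnest n (ν i) i ⟨i, _⟩ hi (hν i) rfl
  have hlaw : ∀ i, HasLaw (X i) F P := fun i => h.law _ _ (hν i)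
  -- Two given positions share a row in which both precede the change. Pairwise independence is
  -- enough for the strong law.
  have hind : Pairwise fun i j => IndepFun (X i) (X j) P := by
    intro i j hij
    obtain ⟨n, hn⟩ := (hτtop.eventually (eventually_gt_atTop (max i j))).exists
    have hi : i < τ n := (le_max_left i j).trans_lt hn
    have hj : j < τ n := (le_max_right i j).trans_lt hn
    have h1 := (h.indep n).indepFun (i := ⟨i, hi.trans_le (hτ n)⟩) (j := ⟨j, hj.trans_le (hτ n)⟩)
      (by simpa using hij)
    rwa [hXZ n ⟨i, _⟩ hi, hXZ n ⟨j, _⟩ hj] at h1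
  have hslln : ∀ f : Vec d → ℝ, LinearGrowth f → ∀ᵐ ω ∂P,
      Tendsto (fun n : ℕ => (∑ i ∈ Finset.range n, f (X i ω)) / n) atTop (𝓝 (∫ x, f x ∂F)) := by
    intro f hf
    have h1 := strong_law_ae_real (μ := P) (fun i => f ∘ X i)
      (by
        have h2 := hf.integrable hF
        rw [← (hlaw 0).map_eq] at h2
        exact h2.comp_aemeasurable (hlaw 0).aemeasurable)
      (fun i j hij => (hind hij).comp hf.1 hf.1)
      (fun i => (IdentDistrib.mk (hlaw i).aemeasurable (hlaw 0).aemeasurable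
        ((hlaw i).map_eq.trans (hlaw 0).map_eq.symm)).comp hf.1)
    have h3 : P[f ∘ X 0] = ∫ x, f x ∂F :=
      (hlaw 0).integral_comp hf.1.aestronglyMeasurable
    rw [h3] at h1
    exact h1
  have hsum : ∀ (f : Vec d → ℝ) (n t : ℕ) (ω : Ω),
      frontSum f (fun i => Z n i ω) (τ n) t = ∑ i ∈ Finset.range (min t (τ n)), f (X i ω) := by
    intro f n t ω
    have hle : min t (τ n) ≤ n := (min_le_right _ _).trans (hτ n)
    rw [frontSum_eq_sum_firstSet]
    refine Finset.sum_bij (fun (i : Fin n) _ => (i : ℕ)) ?_ ?_ ?_ ?_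
    · intro i hi
      exact Finset.mem_range.2 (mem_firstSet.1 hi)
    · intro i _ j _ hij
      exact Fin.ext hij
    · intro i hi
      exact ⟨⟨i, (Finset.mem_range.1 hi).trans_le hle⟩, mem_firstSet.2 (Finset.mem_range.1 hi), rfl⟩
    · intro i hi
      rw [hXZ n i ((mem_firstSet.1 hi).trans_le (min_le_right _ _))]
  refine ⟨fun f hf γ => tendsto_aeFilter.2 ?_, ?_⟩
  · filter_upwards [hslln f hf] with ω hω
    simp only [hsum]
    rcases le_or_gt γ 0 with hγ | hγ
    · have h0 : ∀ n : ℕ, ⌊γ * n⌋₊ = 0 := fun n =>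
        Nat.floor_of_nonpos (mul_nonpos_of_nonpos_of_nonneg hγ n.cast_nonneg)
      simp [h0, max_eq_right hγ, min_eq_left hθ.le]
    · have hutop : Tendsto (fun n : ℕ => min ⌊γ * n⌋₊ (τ n)) atTop atTop :=
        have hfl : Tendsto (fun n : ℕ => ⌊γ * n⌋₊) atTop atTop :=
          tendsto_nat_floor_atTop.comp (tendsto_natCast_atTop_atTop.const_mul_atTop hγ)
        tendsto_atTop.2 fun b => ((tendsto_atTop.1 hfl b).and (tendsto_atTop.1 hτtop b)).mono
          fun n hn => le_min hn.1 hn.2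
      refine ((tendsto_min_floor_div hτθ γ).mul (hω.comp hutop)).congr' ?_
      filter_upwards [hutop.eventually (eventually_gt_atTop 0)] with n hn
      have : ((min ⌊γ * n⌋₊ (τ n) : ℕ) : ℝ) ≠ 0 := by exact_mod_cast hn.ne'
      simp only [Function.comp_apply]
      field_simp
  · set μ := ∫ x : Vec d, ‖x‖ ∂F
    -- By the strong law, sums of `t` norms are below `(μ + 1)t` for all `t` past a threshold that
    -- the margin eventually exceeds. No error term is needed.
    refine ⟨(μ + 1) ^ 2, fun _ => 0, tendsto_const_nhds, ?_⟩
    rw [eventually_aeFilter]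
    filter_upwards [hslln _ linearGrowth_norm] with ω hω
    obtain ⟨u0, hu0⟩ := eventually_atTop.1 (hω.eventually (gt_mem_nhds (lt_add_one μ)))
    filter_upwards [hm.eventually (eventually_ge_atTop (max u0 1))] with n hn t htm htτ
    have ht1 : 1 ≤ t := (le_max_right u0 1).trans (hn.trans htm)
    have ht0 : (0 : ℝ) < t := by exact_mod_cast ht1
    have h1 := hu0 t ((le_max_left u0 1).trans (hn.trans htm))
    rw [div_lt_iff₀ ht0] at h1
    rw [hsum, min_eq_left htτ]
    have h0 : 0 ≤ ∑ i ∈ Finset.range t, ‖X i ω‖ := Finset.sum_nonneg fun i _ => norm_nonneg _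
    calc _ ≤ ((μ + 1) * t) ^ 2 := by gcongr
      _ = _ := by ring

end FrontModel

end Model

/-! ### Random permutations and sampling without replacement -/

section Permutations

/-- Sampling without replacement: the sum over the permutations of the squared partial sums of a
centred finite population. -/
lemma sum_perm_sq_le {n : ℕ} (c : Fin n → ℝ) (hc : ∑ j, c j = 0) (I : Finset (Fin n)) :
    ∑ π : Equiv.Perm (Fin n), (∑ i ∈ I, c (π i)) ^ 2 ≤ (n ! : ℝ) * ∑ j, c j ^ 2 := by
  set R : Fin n → Fin n → ℝ := fun i j => ∑ π : Equiv.Perm (Fin n), c (π i) * c (π j) with hR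
  have hperm : ∀ π : Equiv.Perm (Fin n), ∑ j, c (π j) = 0 := fun π =>
    (Equiv.sum_comp π c).trans hc
  -- Composing with a transposition shows that all off-diagonal entries of a row are equal.
  have hsymm : ∀ i j j', j ≠ i → j' ≠ i → R i j' = R i j := by
    intro i j j' hj hj'
    simp only [hR]
    rw [← Equiv.sum_comp (Equiv.mulRight (Equiv.swap j j'))]
    refine Finset.sum_congr rfl fun π _ => ?_
    simp [Equiv.swap_apply_of_ne_of_ne hj.symm hj'.symm]
  have hrow : ∀ i, ∑ j, R i j = 0 := by
    intro i
    simp only [hR]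
    rw [Finset.sum_comm]
    simp_rw [← Finset.mul_sum, hperm, mul_zero, Finset.sum_const_zero]
  have hdiag : ∀ i, 0 ≤ R i i := fun i => Finset.sum_nonneg fun π _ => mul_self_nonneg _
  -- The row sums to zero and its diagonal entry is nonnegative, so the common off-diagonal value is
  -- not positive: draws without replacement are negatively correlated.
  have hoff : ∀ i j, j ≠ i → R i j ≤ 0 := by
    intro i j hj
    by_contra hpos
    push Not at hpos
    have h1 := hrow i
    rw [← Finset.add_sum_erase _ _ (Finset.mem_univ i)] at h1
    have h2 : R i j ≤ ∑ j' ∈ Finset.univ.erase i, R i j' := by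
      refine Finset.single_le_sum (f := R i) (fun j' hj' => ?_) (by simp [hj])
      rw [hsymm i j j' hj (Finset.ne_of_mem_erase hj')]
      exact hpos.le
    linarith [hdiag i]
  have hexp : ∑ π : Equiv.Perm (Fin n), (∑ i ∈ I, c (π i)) ^ 2 = ∑ i ∈ I, ∑ j ∈ I, R i j := by
    simp_rw [sq, Finset.sum_mul_sum]
    rw [Finset.sum_comm]
    refine Finset.sum_congr rfl fun i _ => ?_
    rw [Finset.sum_comm]
  rw [hexp]
  calc ∑ i ∈ I, ∑ j ∈ I, R i j ≤ ∑ i ∈ I, R i i := by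
        refine Finset.sum_le_sum fun i hi => ?_
        rw [← Finset.add_sum_erase _ _ hi]
        have := Finset.sum_nonpos fun j (hj : j ∈ I.erase i) => hoff i j (Finset.ne_of_mem_erase hj)
        linarith
    _ ≤ ∑ i, R i i := Finset.sum_le_univ_sum_of_nonneg hdiag
    _ = (n ! : ℝ) * ∑ j, c j ^ 2 := by
        simp only [hR]
        rw [Finset.sum_comm]
        simp_rw [← sq]
        have : ∀ π : Equiv.Perm (Fin n), ∑ i, c (π i) ^ 2 = ∑ j, c j ^ 2 := fun π =>
          Equiv.sum_comp π fun j => c j ^ 2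
        simp_rw [this]
        rw [Finset.sum_const, Finset.card_univ, Fintype.card_perm, Fintype.card_fin, nsmul_eq_mul]

variable {κ : Type*}

open Classical in
/-- The proportion of permutations with a given property. -/
noncomputable def permFraction {n : ℕ} (p : Equiv.Perm (Fin n) → Prop) : ℝ :=
  ((Finset.univ.filter p).card : ℝ) / (n ! : ℝ)

lemma permFraction_nonneg {n : ℕ} (p : Equiv.Perm (Fin n) → Prop) : 0 ≤ permFraction p := by
  unfold permFraction; positivity

lemma permFraction_mono {n : ℕ} {p q : Equiv.Perm (Fin n) → Prop} (h : ∀ π, p π → q π) :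
    permFraction p ≤ permFraction q := by
  classical
  unfold permFraction
  gcongr with π
  exact h π

lemma permFraction_or_le {n : ℕ} (p q : Equiv.Perm (Fin n) → Prop) :
    permFraction (fun π => p π ∨ q π) ≤ permFraction p + permFraction q := by
  classical
  unfold permFraction
  rw [← add_div]
  gcongr
  norm_cast
  refine (Finset.card_le_card (t := Finset.univ.filter p ∪ Finset.univ.filter q)
    fun π hπ => ?_).trans (Finset.card_union_le _ _)
  simpa using hπ

lemma permFraction_not {n : ℕ} (p : Equiv.Perm (Fin n) → Prop) :
    permFraction p = 1 - permFraction fun π => ¬ p π := by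
  classical
  unfold permFraction
  have h := Finset.card_filter_add_card_filter_not (s := (Finset.univ : Finset (Equiv.Perm (Fin n)))) p
  rw [Finset.card_univ, Fintype.card_perm, Fintype.card_fin] at h
  have h2 : (n ! : ℝ) ≠ 0 := by positivity
  rw [eq_sub_iff_add_eq, ← add_div, div_eq_one_iff_eq h2]
  norm_cast
  convert h

/-- Chebyshev's inequality for the uniform distribution on permutations. -/
lemma permFraction_le_of_sum_sq_le {n : ℕ} {A : Equiv.Perm (Fin n) → ℝ} {V η : ℝ} (hη : 0 < η)
    (hA : ∑ π, A π ^ 2 ≤ (n ! : ℝ) * V) : permFraction (fun π => η ≤ |A π|) ≤ V / η ^ 2 := by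
  classical
  unfold permFraction
  rw [div_le_div_iff₀ (by positivity) (by positivity), mul_comm V]
  refine le_trans ?_ hA
  calc _ = ∑ π ∈ Finset.univ.filter (fun π => η ≤ |A π|), η ^ 2 := by
        rw [Finset.sum_const, nsmul_eq_mul]
    _ ≤ ∑ π ∈ Finset.univ.filter (fun π => η ≤ |A π|), A π ^ 2 := by
        refine Finset.sum_le_sum fun π hπ => ?_
        rw [← sq_abs (A π)]
        have := (Finset.mem_filter_univ _).1 hπ
        gcongr
    _ ≤ _ := Finset.sum_le_univ_sum_of_nonneg fun π => sq_nonneg _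

/-- Sets that contain `(k, π)` for a proportion of the permutations `π` that tends to one
along `L`. -/
def permFilter (L : Filter κ) (N : κ → ℕ) : Filter (Σ k, Equiv.Perm (Fin (N k))) where
  sets := {B | Tendsto (fun k => permFraction fun π => (⟨k, π⟩ : Σ k, Equiv.Perm (Fin (N k))) ∉ B)
    L (𝓝 0)}
  univ_sets := by simpa [permFraction] using tendsto_const_nhds
  sets_of_superset {B C} h hBC :=
    tendsto_of_tendsto_of_tendsto_of_le_of_le tendsto_const_nhds h
      (fun _ => permFraction_nonneg _) fun k => permFraction_mono fun π hπ hB => hπ (hBC hB)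
  inter_sets {B C} h h' := by
    have h2 : Tendsto (fun k =>
        (permFraction fun π => (⟨k, π⟩ : Σ k, Equiv.Perm (Fin (N k))) ∉ B) +
        permFraction fun π => (⟨k, π⟩ : Σ k, Equiv.Perm (Fin (N k))) ∉ C) L (𝓝 0) := by
      simpa using Tendsto.add h h'
    refine tendsto_of_tendsto_of_tendsto_of_le_of_le tendsto_const_nhds h2
      (fun _ => permFraction_nonneg _) fun k =>
        (permFraction_mono fun π hπ => ?_).trans (permFraction_or_le _ _)
    by_contra hcon
    simp only [not_or, not_not] at hcon
    exact hπ hcon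

variable {L : Filter κ} {N : κ → ℕ}

lemma eventually_permFilter {p : (Σ k, Equiv.Perm (Fin (N k))) → Prop} :
    (∀ᶠ q in permFilter L N, p q) ↔
      Tendsto (fun k => permFraction fun π => ¬ p ⟨k, π⟩) L (𝓝 0) := Iff.rfl

lemma tendsto_fst_permFilter : Tendsto Sigma.fst (permFilter L N) L := by
  intro s hs
  refine (tendsto_const_nhds (x := (0 : ℝ))).congr' ?_
  filter_upwards [hs] with k hk
  simp [permFraction, hk]

lemma tendsto_permFilter_zero {A : (Σ k, Equiv.Perm (Fin (N k))) → ℝ} {V : κ → ℝ}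
    (hV : Tendsto V L (𝓝 0)) (hA : ∀ k, ∑ π, A ⟨k, π⟩ ^ 2 ≤ ((N k) ! : ℝ) * V k) :
    Tendsto A (permFilter L N) (𝓝 0) := by
  rw [Metric.tendsto_nhds]
  intro η hη
  rw [eventually_permFilter]
  refine tendsto_of_tendsto_of_tendsto_of_le_of_le tendsto_const_nhds
    (by simpa using hV.div_const (η ^ 2)) (fun _ => permFraction_nonneg _) fun k =>
      (permFraction_mono fun π hπ => ?_).trans (permFraction_le_of_sum_sq_le hη (hA k))
  rwa [Real.dist_eq, sub_zero, not_lt] at hπ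

variable {E : Type*} [NormedAddCommGroup E] [MeasurableSpace E] [BorelSpace E]

/-- The law of large numbers for the partial sums of randomly permuted observations. -/
lemma frontLimit_perm {z : (k : κ) → Fin (N k) → E} (hN : Tendsto N L atTop) {f : E → ℝ} {a b : ℝ}
    (ha : Tendsto (fun k => (N k : ℝ)⁻¹ * ∑ j, f (z k j)) L (𝓝 a))
    (hb : Tendsto (fun k => (N k : ℝ)⁻¹ * ∑ j, f (z k j) ^ 2) L (𝓝 b)) :
    FrontLimit (permFilter L N) (fun q => N q.1) (fun q => N q.1) (fun q i => z q.1 (q.2 i)) f 1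
      a := by
  intro γ
  set u : ℕ → ℕ := fun n => min ⌊γ * n⌋₊ n with hu
  have hinv : Tendsto (fun k => ((N k : ℝ))⁻¹) L (𝓝 0) :=
    tendsto_inv_atTop_zero.comp (tendsto_natCast_atTop_atTop.comp hN)
  set y : κ → ℝ := fun k => (N k : ℝ)⁻¹ * ∑ j, f (z k j) with hy
  set A : (Σ k, Equiv.Perm (Fin (N k))) → ℝ := fun q =>
    (N q.1 : ℝ)⁻¹ * ∑ i ∈ firstSet (N q.1) (u (N q.1)), (f (z q.1 (q.2 i)) - y q.1) with hAdef
  have hA : Tendsto A (permFilter L N) (𝓝 0) := by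
    -- The variance bound is `n⁻²` times the sum of the squares of `f`. Its mean square converges,
    -- which leaves a factor `n⁻¹`.
    refine tendsto_permFilter_zero (V := fun k => (N k : ℝ)⁻¹ *
      ((N k : ℝ)⁻¹ * ∑ j, f (z k j) ^ 2)) (by simpa using hinv.mul hb) fun k => ?_
    have hsum : ∑ j, (f (z k j) - y k) = 0 := by
      rcases Nat.eq_zero_or_pos (N k) with h0 | h0
      · have : IsEmpty (Fin (N k)) := by rw [h0]; infer_instance
        simp
      · have h1 : (N k : ℝ) ≠ 0 := by exact_mod_cast h0.ne'
        rw [Finset.sum_sub_distrib, Finset.sum_const, Finset.card_univ, Fintype.card_fin,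
          nsmul_eq_mul, hy]
        field_simp
        ring
    have hvar : ∑ j, (f (z k j) - y k) ^ 2 ≤ ∑ j, f (z k j) ^ 2 := by
      have h1 : ∑ j, (f (z k j) - y k) ^ 2 =
          ∑ j, f (z k j) ^ 2 - 2 * y k * ∑ j, (f (z k j) - y k) - ∑ _j : Fin (N k), y k ^ 2 := by
        rw [Finset.mul_sum, ← Finset.sum_sub_distrib, ← Finset.sum_sub_distrib]
        exact Finset.sum_congr rfl fun j _ => by ring
      rw [h1, hsum, mul_zero, sub_zero]
      have : 0 ≤ ∑ _j : Fin (N k), y k ^ 2 := Finset.sum_nonneg fun _ _ => sq_nonneg _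
      linarith
    have hmain := sum_perm_sq_le (fun j => f (z k j) - y k) hsum (firstSet (N k) (u (N k)))
    simp only [hAdef, mul_pow]
    rw [← Finset.mul_sum]
    calc _ ≤ (N k : ℝ)⁻¹ ^ 2 * (((N k) ! : ℝ) * ∑ j, f (z k j) ^ 2) := by
          gcongr
          exact hmain.trans (by gcongr)
      _ = _ := by ring
  have hB : Tendsto (fun q : (Σ k, Equiv.Perm (Fin (N k))) =>
      ((u (N q.1) : ℕ) : ℝ) / N q.1 * y q.1) (permFilter L N) (𝓝 (min (max γ 0) 1 * a)) := by
    have h1 : Tendsto (fun n : ℕ => (n : ℝ) / n) atTop (𝓝 1) := by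
      refine tendsto_const_nhds.congr' ?_
      filter_upwards [eventually_ne_atTop 0] with n hn
      rw [div_self (Nat.cast_ne_zero.2 hn)]
    have h2 : Tendsto (fun k => ((u (N k) : ℕ) : ℝ) / N k * y k) L (𝓝 (min (max γ 0) 1 * a)) :=
      ((tendsto_min_floor_div (τ := fun n => n) h1 γ).comp hN).mul ha
    exact h2.comp tendsto_fst_permFilter
  have := hA.add hB
  rw [zero_add] at this
  refine this.congr fun q => ?_
  rw [frontSum_eq_sum_firstSet, hAdef]
  simp only
  rw [Finset.sum_sub_distrib, Finset.sum_const, card_firstSet (min_le_right _ _), nsmul_eq_mul]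
  ring

end Permutations

/-! ### The criterion of an asymptotically homogeneous sample -/

section Homogeneous

variable {d : ℕ} {ι : Type*} {l : Filter ι} {N m t : ι → ℕ} {z : (k : ι) → Fin (N k) → Vec d}
  {γ : ℝ}

lemma tendsto_sum_firstSet_of_frontLimit {f : Vec d → ℝ} {a : ℝ} (hf : ∀ x, 0 ≤ f x)
    (hN : Tendsto N l atTop) (h : FrontLimit l N N z f 1 a)
    (ht : Tendsto (fun k => (t k : ℝ) / N k) l (𝓝 γ)) (hγ0 : 0 ≤ γ) (hγ1 : γ ≤ 1) :
    Tendsto (fun k => (N k : ℝ)⁻¹ * ∑ i ∈ firstSet (N k) (t k), f (z k i)) l (𝓝 (γ * a)) := by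
  have h1 := h.tendsto hf hN ht
  rw [max_eq_left hγ0, min_eq_left hγ1] at h1
  refine h1.congr fun k => ?_
  congr 1
  unfold frontSum firstSet
  refine Finset.sum_congr ?_ fun _ _ => rfl
  ext i
  simp

lemma tendsto_sum_lastSet_of_frontLimit {f : Vec d → ℝ} {a : ℝ} (hf : ∀ x, 0 ≤ f x)
    (hN : Tendsto N l atTop) (h : FrontLimit l N N z f 1 a)
    (ht : Tendsto (fun k => (t k : ℝ) / N k) l (𝓝 γ)) (hγ0 : 0 ≤ γ) (hγ1 : γ ≤ 1) :
    Tendsto (fun k => (N k : ℝ)⁻¹ * ∑ i ∈ lastSet (N k) (t k), f (z k i)) l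
      (𝓝 ((1 - γ) * a)) := by
  have hNN : Tendsto (fun k => (N k : ℝ) / N k) l (𝓝 1) := by
    refine tendsto_const_nhds.congr' ?_
    filter_upwards [hN.eventually (eventually_ne_atTop 0)] with k hk
    rw [div_self (Nat.cast_ne_zero.2 hk)]
  have h1 := tendsto_sum_firstSet_of_frontLimit hf hN h ht hγ0 hγ1
  have h2 := tendsto_sum_firstSet_of_frontLimit hf hN h hNN zero_le_one le_rfl
  refine ((h2.sub h1).congr fun k => ?_).trans (le_of_eq (by ring_nf))
  have h3 := sum_firstSet_add_sum_lastSet (n := N k) (t k) (fun i => f (z k i))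
  have h4 : firstSet (N k) (N k) = Finset.univ := by
    ext i; simp [mem_firstSet]
  rw [h4, ← h3]
  ring

/-- If all parts of the sample have the same limiting distribution, the criterion vanishes uniformly
over the search range. -/
theorem tendsto_criterion_of_homogeneous {μ : Measure (Vec d)} [IsFiniteMeasure μ]
    (hμ : Integrable (fun x => x) μ) (hN : Tendsto N l atTop) (hmtop : Tendsto m l atTop)
    (hlln : ∀ f, LinearGrowth f → FrontLimit l N N z f 1 (∫ x, f x ∂μ)) {b : ℝ}
    (hsq : FrontLimit l N N z (fun x => ‖x‖ ^ 2) 1 b)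
    (hm : ∀ᶠ k in l, m k ≤ t k ∧ t k + m k ≤ N k) :
    Tendsto (fun k => criterion (z k) (t k)) l (𝓝 0) := by
  rw [tendsto_iff_ultrafilter]
  intro U hU
  replace hN := hN.mono_left hU
  replace hm := hm.filter_mono hU
  replace hmtop := hmtop.mono_left hU
  replace hlln := fun f hf => (hlln f hf).mono hU
  replace hsq := hsq.mono hU
  have htN : ∀ᶠ k in (U : Filter ι), t k ≤ N k := hm.mono fun k hk => by omega
  have hmem : ∀ᶠ k in (U : Filter ι), (t k : ℝ) / N k ∈ Set.Icc (0 : ℝ) 1 := by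
    filter_upwards [htN] with k hk
    exact ⟨by positivity, div_le_one_of_le₀ (by exact_mod_cast hk) (by positivity)⟩
  obtain ⟨γ, hγ, hlim⟩ := isCompact_Icc.ultrafilter_le_nhds (U.map fun k => (t k : ℝ) / N k)
    (le_principal_iff.2 hmem)
  have hlim : Tendsto (fun k => (t k : ℝ) / N k) U (𝓝 γ) := hlim
  have hm2 := hmtop.eventually (eventually_ge_atTop 2)
  -- At the ends Cauchy–Schwarz bounds the squared norm sum over `t n` by the normalised sum of
  -- squares over the short part, whose limit carries the vanishing fraction.
  by_cases hend : γ = 0 ∨ γ = 1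
  · have hr := tendsto_sum_firstSet_of_frontLimit (fun x => sq_nonneg ‖x‖) hN hsq hlim hγ.1 hγ.2
    have hs := tendsto_sum_lastSet_of_frontLimit (fun x => sq_nonneg ‖x‖) hN hsq hlim hγ.1 hγ.2
    refine tendsto_criterion_zero
      (r := fun k => (N k : ℝ)⁻¹ * ∑ i ∈ firstSet (N k) (t k), ‖z k i‖ ^ 2)
      (s := fun k => (N k : ℝ)⁻¹ * ∑ i ∈ lastSet (N k) (t k), ‖z k i‖ ^ 2) ?_ ?_ ?_ ?_
    · filter_upwards [hm, hm2] with k h1 h2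
      omega
    · filter_upwards [hm, hm2] with k h1 h2
      have ht0 : (0 : ℝ) < t k := by
        have : 0 < t k := by omega
        exact_mod_cast this
      have hn0 : (0 : ℝ) < N k := by
        have : 0 < N k := by omega
        exact_mod_cast this
      have := sq_sum_le_card_mul_sum_sq (s := firstSet (N k) (t k)) (f := fun i => ‖z k i‖)
      rw [card_firstSet (by omega)] at this
      rw [div_le_iff₀ (by positivity)]
      refine this.trans (le_of_eq ?_)
      field_simp
    · filter_upwards [hm, hm2] with k h1 h2
      have ht0 : (0 : ℝ) < (N k : ℝ) - t k := by
        have : t k < N k := by omega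
        exact sub_pos.2 (by exact_mod_cast this)
      have hn0 : (0 : ℝ) < N k := by
        have : 0 < N k := by omega
        exact_mod_cast this
      have := sq_sum_le_card_mul_sum_sq (s := lastSet (N k) (t k)) (f := fun i => ‖z k i‖)
      rw [card_lastSet (by omega)] at this
      rw [div_le_iff₀ (by positivity)]
      refine this.trans (le_of_eq ?_)
      field_simp
    · have := ((hlim.const_sub 1).mul hr).add (hlim.mul hs)
      rcases hend with rfl | rfl
      · simpa using this
      · simpa using this
  · rw [not_or] at hend
    have hγ0 : 0 < γ := lt_of_le_of_ne hγ.1 (Ne.symm hend.1)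
    have hγ1 : γ < 1 := lt_of_le_of_ne hγ.2 hend.2
    have n1 : 0 ≤ 1 - γ := by linarith
    have n2 : 1 - γ ≠ 0 := by linarith
    -- The measure `γ μ` is written as a combination with a zero second weight, so that
    -- `meanDist_mix` applies.
    have hI : EmpiricalLimit U N z (fun k => firstSet (N k) (t k)) (mix μ μ γ 0) := by
      intro f hf
      rw [integral_mix (hf.integrable hμ) (hf.integrable hμ) hγ.1 le_rfl, zero_mul, add_zero]
      exact tendsto_sum_firstSet_of_frontLimit hf.2.1 hN (hlln f hf) hlim hγ.1 hγ.2
    have hJ : EmpiricalLimit U N z (fun k => lastSet (N k) (t k)) (mix μ μ (1 - γ) 0) := by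
      intro f hf
      rw [integral_mix (hf.integrable hμ) (hf.integrable hμ) n1 le_rfl, zero_mul, add_zero]
      exact tendsto_sum_lastSet_of_frontLimit hf.2.1 hN (hlln f hf) hlim hγ.1 hγ.2
    refine (tendsto_criterion (integrable_mix hμ hμ _ _) (integrable_mix hμ hμ _ _) hN htN hγ0
      hγ1 hlim hI hJ).trans (le_of_eq ?_)
    rw [meanDist_mix hμ hμ hγ.1 le_rfl n1 le_rfl, meanDist_mix hμ hμ hγ.1 le_rfl hγ.1 le_rfl,
      meanDist_mix hμ hμ n1 le_rfl n1 le_rfl]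
    have e1 : (γ * (1 - γ) * meanDist μ μ + (γ * 0 + 0 * (1 - γ)) * meanDist μ μ +
        0 * 0 * meanDist μ μ) / (γ * (1 - γ)) = meanDist μ μ := by field_simp; ring
    have e2 : (γ * γ * meanDist μ μ + (γ * 0 + 0 * γ) * meanDist μ μ + 0 * 0 * meanDist μ μ) /
        (γ * (γ - 0)) = meanDist μ μ := by rw [sub_zero]; field_simp; ring
    have e3 : ((1 - γ) * (1 - γ) * meanDist μ μ + ((1 - γ) * 0 + 0 * (1 - γ)) * meanDist μ μ +
        0 * 0 * meanDist μ μ) / ((1 - γ) * (1 - γ - 0)) = meanDist μ μ := by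
      rw [sub_zero]; field_simp; ring
    rw [e1, e2, e3]
    ring_nf

end Homogeneous

/-! ### Search range, test statistic and cut-off -/

section SearchRange

/-- The distance that the search range keeps from both ends of the sample. -/
noncomputable def searchMargin (δ : ℕ → ℝ) (n : ℕ) : ℕ := ⌊(n : ℝ) * δ n⌋₊ - 1

variable {δ : ℕ → ℝ}

lemma tendsto_searchMargin (hnδ : Tendsto (fun n : ℕ => (n : ℝ) * δ n) atTop atTop) :
    Tendsto (searchMargin δ) atTop atTop :=
  (tendsto_sub_atTop_nat 1).comp (tendsto_nat_floor_atTop.comp hnδ)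

lemma eventually_searchRange {θ : ℝ} (hθ₀ : 0 < θ) (hθ₁ : θ < 1) (hδ : Tendsto δ atTop (𝓝 0))
    (hnδ : Tendsto (fun n : ℕ => (n : ℝ) * δ n) atTop atTop) :
    ∀ᶠ n : ℕ in atTop, ⌊(n : ℝ) * θ⌋₊ ∈ searchRange n (δ n) ∧
      ∀ t ∈ searchRange n (δ n), searchMargin δ n ≤ t ∧ t + searchMargin δ n ≤ n := by
  filter_upwards [hδ.eventually (gt_mem_nhds hθ₀),
    hδ.eventually (gt_mem_nhds (by linarith : (0 : ℝ) < 1 - θ)),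
    hnδ.eventually (eventually_ge_atTop 1)] with n h1 h2 h3
  have hn : (0 : ℝ) ≤ n := n.cast_nonneg
  refine ⟨Finset.mem_Icc.2 ⟨Nat.floor_le_floor (by gcongr), ?_⟩, fun t ht => ?_⟩
  · refine (Nat.floor_le_floor (b := (n : ℝ) * (1 - δ n)) ?_).trans (Nat.floor_le_ceil _)
    gcongr
    linarith
  · rw [searchRange, Finset.mem_Icc] at ht
    have hfl : 1 ≤ ⌊(n : ℝ) * δ n⌋₊ := Nat.le_floor (by simpa using h3)
    refine ⟨(Nat.sub_le _ _).trans ht.1, ?_⟩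
    -- The ceiling costs less than one, which the final strict inequality between integers absorbs.
    have h4 : (t : ℝ) < (n : ℝ) * (1 - δ n) + 1 := by
      refine lt_of_le_of_lt (Nat.cast_le.2 ht.2) (Nat.ceil_lt_add_one ?_)
      exact mul_nonneg hn (by linarith)
    have h5 : (⌊(n : ℝ) * δ n⌋₊ : ℝ) ≤ n * δ n := Nat.floor_le (by linarith)
    have h6 : ((t + ⌊(n : ℝ) * δ n⌋₊ : ℕ) : ℝ) < ((n + 1 : ℕ) : ℝ) := by
      push_cast
      linarith
    have h7 : t + ⌊(n : ℝ) * δ n⌋₊ < n + 1 := by exact_mod_cast h6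
    unfold searchMargin
    omega

variable {d n : ℕ}

lemma criterion_le_testStatistic {δ : ℝ} (z : Fin n → Vec d) {t : ℕ} (ht : t ∈ searchRange n δ) :
    criterion z t ≤ testStatistic δ z :=
  le_ciSup (f := fun t : {t : ℕ // t ∈ searchRange n δ} => criterion z t)
    (Set.finite_range _).bddAbove ⟨t, ht⟩

lemma exists_testStatistic_le {δ : ℝ} (z : Fin n → Vec d) (h : (searchRange n δ).Nonempty) :
    ∃ t ∈ searchRange n δ, testStatistic δ z ≤ criterion z t := by
  obtain ⟨t, ht, hmax⟩ := Finset.exists_max_image _ (criterion z) h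
  have : Nonempty {t : ℕ // t ∈ searchRange n δ} := ⟨⟨t, ht⟩⟩
  exact ⟨t, ht, ciSup_le fun s => hmax s s.2⟩

/-- If at most a proportion `α` of the permutations exceeds `x`, then `x` belongs to the set whose
infimum is the cut-off. -/
lemma permutationCutoff_le {δ α x : ℝ} {z : Fin n → Vec d} (hx : 0 ≤ x)
    (h : permFraction (fun π => ¬ testStatistic δ (fun i => z (π i)) ≤ x) ≤ α) :
    permutationCutoff δ α z ≤ x := by
  refine csInf_le ⟨0, fun y hy => hy.1⟩ ⟨hx, ?_⟩
  have h1 := permFraction_not fun π : Equiv.Perm (Fin n) => testStatistic δ (fun i => z (π i)) ≤ x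
  have h2 : 1 - α ≤ permFraction
      fun π : Equiv.Perm (Fin n) => testStatistic δ (fun i => z (π i)) ≤ x := by
    rw [h1]; linarith
  unfold permFraction at h2
  convert h2

end SearchRange

/-! ### Moments of sub-exponential laws -/

section SubExponential

variable {d : ℕ}

/-- Sub-exponentiality along the coordinate vectors gives exponential moments of the coordinates.
The even exponent makes the norm power a power of the sum of squared coordinates. -/
lemma IsSubExponential.memLp {F : Measure (Vec d)} [IsProbabilityMeasure F]
    (h : IsSubExponential F) (k : ℕ) : MemLp (fun x => x) ((2 * (k + 1) : ℕ) : ℝ≥0∞) F := by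
  obtain ⟨K, hK, hexp⟩ := h
  have hcoord : ∀ i : Fin d, Integrable (fun x : Vec d => Real.exp (|x i| / K)) F := by
    intro i
    refine ⟨by fun_prop, ?_⟩
    rw [hasFiniteIntegral_iff_ofReal (ae_of_all _ fun x => (Real.exp_pos _).le)]
    have h1 := hexp (EuclideanSpace.single i 1) (by simp)
    simp only [EuclideanSpace.inner_single_left, map_one, one_mul] at h1
    exact h1.trans_lt ENNReal.ofNat_lt_top
  have hint : Integrable (fun x : Vec d => ‖x‖ ^ (2 * (k + 1))) F := by
    have h2 : Integrable (fun x : Vec d => (d : ℝ) ^ k * ∑ i : Fin d,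
        (K ^ (2 * (k + 1)) * ((2 * (k + 1)) ! : ℝ)) * Real.exp (|x i| / K)) F :=
      (integrable_finsetSum _ fun i _ => (hcoord i).const_mul _).const_mul _
    refine h2.mono' (by fun_prop) (ae_of_all _ fun x => ?_)
    rw [Real.norm_of_nonneg (by positivity), pow_mul, EuclideanSpace.real_norm_sq_eq]
    -- Power mean inequality: the power `k + 1` of a sum of `d` nonnegative terms is at most `d ^ k`
    -- times the sum of their powers.
    have h3 := pow_sum_div_card_le_sum_pow (s := (Finset.univ : Finset (Fin d)))
      (f := fun i => x i ^ 2) (fun i _ => sq_nonneg _) k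
    rcases Nat.eq_zero_or_pos d with h0 | h0
    · subst h0; simp
    have hd : (0 : ℝ) < (d : ℝ) ^ k := by positivity
    rw [Finset.card_univ, Fintype.card_fin, div_le_iff₀ hd, mul_comm] at h3
    refine h3.trans ?_
    gcongr with i
    -- A power is dominated by the exponential series: `yᵐ ≤ m! eʸ` with `y = |x i| / K` and `m =
    -- 2(k + 1)`.
    have h4 := Real.pow_div_factorial_le_exp (|x i| / K) (by positivity) (2 * (k + 1))
    rw [div_pow, div_div, div_le_iff₀ (by positivity), pow_mul, sq_abs, ← pow_mul] at h4
    rw [← pow_mul]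
    exact h4.trans_eq (mul_comm _ _)
  rw [← integrable_norm_rpow_iff (by fun_prop) (Nat.cast_ne_zero.2 (by omega))
    (ENNReal.natCast_ne_top _)]
  simp_rw [ENNReal.toReal_natCast, Real.rpow_natCast]
  exact hint

/-- The fourth-moment method applied to test functions of degree four needs sixteen moments. -/
lemma memLp_four_of_le {F : Measure (Vec d)} [IsProbabilityMeasure F]
    (h : MemLp (fun x => x) ((16 : ℕ) : ℝ≥0∞) F) {f : Vec d → ℝ} (hf : Measurable f) {C : ℝ}
    (hC : ∀ x, |f x| ≤ C * (1 + ‖x‖ ^ 4)) : MemLp f 4 F := by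
  have h1 : MemLp (fun x : Vec d => ‖x‖ ^ 4) 4 F := by
    rw [← integrable_norm_rpow_iff (by fun_prop) (by simp) (by simp)]
    refine (h.integrable_norm_pow (by norm_num)).congr (ae_of_all _ fun x => ?_)
    simp only [norm_pow, norm_norm]
    have : (4 : ℝ≥0∞).toReal = ((4 : ℕ) : ℝ) := by simp
    rw [this, Real.rpow_natCast, ← pow_mul]
  have h2 : MemLp (fun x : Vec d => 1 + ‖x‖ ^ 4) 4 F := (memLp_const (1 : ℝ)).add h1
  refine (h2.const_mul C).mono hf.aestronglyMeasurable (ae_of_all _ fun x => ?_)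
  rw [Real.norm_eq_abs, Real.norm_eq_abs]
  exact (hC x).trans (le_abs_self _)

end SubExponential

/-! ### The single-change model seen from both ends -/

section Model

variable {Ω : Type*} [MeasurableSpace Ω] {P : Measure Ω} [IsProbabilityMeasure P] {d : ℕ}
  {F₁ F₂ : Measure (Vec d)} [IsProbabilityMeasure F₁] [IsProbabilityMeasure F₂] {τ : ℕ → ℕ}
  {Z : (n : ℕ) → Fin n → Ω → Vec d}

namespace IsSingleChangeModel

lemma aemeasurable (h : IsSingleChangeModel P Z τ F₁ F₂) (n : ℕ) (i : Fin n) :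
    AEMeasurable (Z n i) P := by
  rcases lt_or_ge (i : ℕ) (τ n) with hi | hi
  · exact (h.law_before n i hi).aemeasurable
  · exact (h.law_after n i hi).aemeasurable

lemma frontModel (h : IsSingleChangeModel P Z τ F₁ F₂) : FrontModel P Z τ F₁ :=
  ⟨h.indep, h.aemeasurable, h.law_before⟩

lemma backModel (h : IsSingleChangeModel P Z τ F₁ F₂) :
    FrontModel P (fun n i => Z n i.rev) (fun n => n - τ n) F₂ :=
  ⟨fun n => (h.indep n).precomp Fin.rev_injective, fun n i => h.aemeasurable n i.rev,
    fun n i hi => h.law_after n i.rev (by rw [Fin.val_rev]; have := i.2; omega)⟩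

end IsSingleChangeModel

end Model

/-! ### Consistency of the estimator and of the permutation test -/

section Main

variable {Ω : Type*} [MeasurableSpace Ω] {P : Measure Ω} [IsProbabilityMeasure P] {d : ℕ}
  {F₁ F₂ : Measure (Vec d)} [IsProbabilityMeasure F₁] [IsProbabilityMeasure F₂]
  {Z : (n : ℕ) → Fin n → Ω → Vec d} {θ : ℝ} {m : ℕ → ℕ}

lemma floor_mul_le (hθ₁ : θ < 1) (n : ℕ) : ⌊(n : ℝ) * θ⌋₊ ≤ n :=
  Nat.floor_le_of_le (mul_le_of_le_one_right n.cast_nonneg hθ₁.le)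

lemma floor_le_rev {n : ℕ} {i : Fin n} (hi : (i : ℕ) < n - ⌊(n : ℝ) * θ⌋₊) :
    ⌊(n : ℝ) * θ⌋₊ ≤ (i.rev : ℕ) := by
  rw [Fin.val_rev]
  omega

lemma tendsto_floor_div (hθ₀ : 0 < θ) :
    Tendsto (fun n : ℕ => (⌊(n : ℝ) * θ⌋₊ : ℝ) / n) atTop (𝓝 θ) := by
  have := tendsto_floor_mul_div θ
  rw [max_eq_left hθ₀.le] at this
  simpa only [mul_comm θ] using this

lemma tendsto_sub_floor_div (hθ₀ : 0 < θ) (hθ₁ : θ < 1) :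
    Tendsto (fun n : ℕ => ((n - ⌊(n : ℝ) * θ⌋₊ : ℕ) : ℝ) / n) atTop (𝓝 (1 - θ)) :=
  tendsto_sub_div tendsto_id (.of_forall fun n => floor_mul_le hθ₁ n) (tendsto_floor_div hθ₀)

/-- The sample is controlled as soon as its parts before and after the change are. -/
lemma twoSidedControl {l : Filter (ℕ × Ω)} (hl : Tendsto Prod.fst l atTop)
    (h₁ : Integrable (fun x => x) F₁) (h₂ : Integrable (fun x => x) F₂)
    (hθ₀ : 0 < θ) (hθ₁ : θ < 1) (hm : Tendsto m atTop atTop)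
    (hf : FrontControl l Prod.fst (fun k => ⌊(k.1 : ℝ) * θ⌋₊) (fun k => m k.1)
      (fun k i => Z k.1 i k.2) F₁ θ)
    (hb : FrontControl l Prod.fst (fun k => k.1 - ⌊(k.1 : ℝ) * θ⌋₊) (fun k => m k.1)
      (fun k i => Z k.1 i.rev k.2) F₂ (1 - θ)) :
    TwoSidedControl l Prod.fst (fun k => ⌊(k.1 : ℝ) * θ⌋₊) (fun k => m k.1)
      (fun k i => Z k.1 i k.2) F₁ F₂ θ where
  size := hl
  margin := hm.comp hl
  change_le k := floor_mul_le hθ₁ k.1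
  change := (tendsto_floor_div hθ₀).comp hl
  pos := hθ₀
  lt_one := hθ₁
  integrable_left := h₁
  integrable_right := h₂
  front := hf
  back := hb

lemma twoSidedControl_of_memLp (hZ : IsSingleChangeModel P Z (fun n => ⌊(n : ℝ) * θ⌋₊) F₁ F₂)
    {l : Filter (ℕ × Ω)} (hl : SummableVanish P l) (hθ₀ : 0 < θ) (hθ₁ : θ < 1)
    (hm : Tendsto m atTop atTop) (h₁ : MemLp (fun x => x) 4 F₁) (h₂ : MemLp (fun x => x) 4 F₂) :
    TwoSidedControl l Prod.fst (fun k => ⌊(k.1 : ℝ) * θ⌋₊) (fun k => m k.1)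
      (fun k i => Z k.1 i k.2) F₁ F₂ θ :=
  twoSidedControl hl.fst (h₁.integrable (by norm_num)) (h₂.integrable (by norm_num)) hθ₀ hθ₁ hm
    (hZ.frontModel.frontControl_of_memLp (floor_mul_le hθ₁) (tendsto_floor_div hθ₀) hl h₁ hm)
    (hZ.backModel.frontControl_of_memLp (fun n => Nat.sub_le _ _)
      (tendsto_sub_floor_div hθ₀ hθ₁) hl h₂ hm)

lemma twoSidedControl_of_nested (hZ : IsSingleChangeModel P Z (fun n => ⌊(n : ℝ) * θ⌋₊) F₁ F₂)
    (hnest : IsNested Z (fun n => ⌊(n : ℝ) * θ⌋₊)) (hθ₀ : 0 < θ) (hθ₁ : θ < 1)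
    (hm : Tendsto m atTop atTop) (h₁ : Integrable (fun x => x) F₁)
    (h₂ : Integrable (fun x => x) F₂) :
    TwoSidedControl (aeFilter P) Prod.fst (fun k => ⌊(k.1 : ℝ) * θ⌋₊) (fun k => m k.1)
      (fun k i => Z k.1 i k.2) F₁ F₂ θ :=
  twoSidedControl (tendsto_fst_aeFilter P) h₁ h₂ hθ₀ hθ₁ hm
    (hZ.frontModel.frontControl_of_nested (floor_mul_le hθ₁) hθ₀ (tendsto_floor_div hθ₀)
      hnest.1 h₁ hm)
    (hZ.backModel.frontControl_of_nested (fun n => Nat.sub_le _ _) (by linarith)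
      (tendsto_sub_floor_div hθ₀ hθ₁)
      (fun m n i j hi hj hij => hnest.2 m n i.rev j.rev
        (floor_le_rev hi) (floor_le_rev hj)
        (by rwa [Fin.rev_rev, Fin.rev_rev])) h₂ hm)

/-- Strong consistency of the estimated change. -/
lemma ae_tendsto_changePoint {δ : ℕ → ℝ} (hF : F₁ ≠ F₂) (hθ₀ : 0 < θ) (hθ₁ : θ < 1)
    (hδ : Tendsto δ atTop (𝓝 0)) (hnδ : Tendsto (fun n : ℕ => (n : ℝ) * δ n) atTop atTop)
    {T : ℕ → Ω → ℕ}
    (hT : ∀ (n : ℕ) (ω : Ω), (searchRange n (δ n)).Nonempty →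
      IsPotentialChangePoint (δ n) (fun i => Z n i ω) (T n ω))
    (h : TwoSidedControl (aeFilter P) Prod.fst (fun k => ⌊(k.1 : ℝ) * θ⌋₊)
      (fun k => searchMargin δ k.1) (fun k i => Z k.1 i k.2) F₁ F₂ θ) :
    ∀ᵐ ω ∂P, Tendsto (fun n : ℕ => (T n ω : ℝ) / n) atTop (𝓝 θ) := by
  have hrange := (tendsto_fst_aeFilter P).eventually (eventually_searchRange hθ₀ hθ₁ hδ hnδ)
  have key := h.tendsto_maximiser (t := fun k => T k.1 k.2) hF
  refine tendsto_aeFilter.1 (key ?_ ?_)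
  · filter_upwards [hrange] with k hk
    exact hk.2 _ (hT k.1 k.2 ⟨_, hk.1⟩).1
  · filter_upwards [hrange] with k hk
    exact (hT k.1 k.2 ⟨_, hk.1⟩).2 _ hk.1

/-- The test statistic of the randomly permuted sample vanishes in probability. -/
lemma eventually_testStatistic_perm_le
    (hZ : IsSingleChangeModel P Z (fun n => ⌊(n : ℝ) * θ⌋₊) F₁ F₂)
    {δ : ℕ → ℝ} (hθ₀ : 0 < θ) (hθ₁ : θ < 1)
    (hδ : Tendsto δ atTop (𝓝 0)) (hnδ : Tendsto (fun n : ℕ => (n : ℝ) * δ n) atTop atTop)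
    (h₁ : MemLp (fun x => x) ((16 : ℕ) : ℝ≥0∞) F₁) (h₂ : MemLp (fun x => x) ((16 : ℕ) : ℝ≥0∞) F₂)
    {x : ℝ} (hx : 0 < x) :
    ∀ᶠ q in permFilter (probFilter P) Prod.fst,
      testStatistic (δ q.1.1) (fun i => Z q.1.1 (q.2 i) q.1.2) ≤ x := by
  have hl := summableVanish_probFilter P
  have h4₁ : MemLp (fun x => x) 4 F₁ := h₁.mono_exponent (by norm_num)
  have h4₂ : MemLp (fun x => x) 4 F₂ := h₂.mono_exponent (by norm_num)
  have hm := tendsto_searchMargin hnδ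
  have h := twoSidedControl_of_memLp hZ hl hθ₀ hθ₁ hm h4₁ h4₂
  have hrange := eventually_searchRange hθ₀ hθ₁ hδ hnδ
  set μ := mix F₁ F₂ θ (1 - θ) with hμ
  have hμi : Integrable (fun x => x) μ := integrable_mix h.integrable_left h.integrable_right _ _
  -- laws of large numbers for the whole sample
  have htotal : ∀ f : Vec d → ℝ, Measurable f → (∀ x, 0 ≤ f x) →
      (∃ C : ℝ, ∀ x, |f x| ≤ C * (1 + ‖x‖ ^ 4)) →
      Tendsto (fun k : ℕ × Ω => (k.1 : ℝ)⁻¹ * ∑ j, f (Z k.1 j k.2)) (probFilter P)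
        (𝓝 (∫ x, f x ∂μ)) := by
    rintro f hf hf0 ⟨C, hC⟩
    have m₁ := memLp_four_of_le h₁ hf hC
    have m₂ := memLp_four_of_le h₂ hf hC
    have hNN : Tendsto (fun k : ℕ × Ω => (k.1 : ℝ) / k.1) (probFilter P) (𝓝 1) := by
      refine tendsto_const_nhds.congr' ?_
      filter_upwards [hl.fst.eventually (eventually_ne_atTop 0)] with k hk
      rw [div_self (Nat.cast_ne_zero.2 hk)]
    have h5 := tendsto_sum_firstSet (N := Prod.fst) (t := Prod.fst)
      (z := fun (k : ℕ × Ω) i => Z k.1 i k.2) hf0 hl.fst h.change_le hθ₀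
      (hZ.frontModel.frontLimit (floor_mul_le hθ₁) (tendsto_floor_div hθ₀) hl hf m₁)
      (hZ.backModel.frontLimit (fun n => Nat.sub_le _ _) (tendsto_sub_floor_div hθ₀ hθ₁) hl hf m₂)
      (.of_forall fun _ => le_rfl) hNN zero_le_one le_rfl
    rw [min_eq_right hθ₁.le, max_eq_left hθ₁.le] at h5
    rw [hμ, integral_mix (m₁.integrable (by norm_num)) (m₂.integrable (by norm_num)) hθ₀.le
      (by linarith)]
    refine h5.congr fun k => ?_
    have : firstSet k.1 k.1 = Finset.univ := by
      ext i; simp [mem_firstSet]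
    rw [this]
  have hpoly : ∀ r : ℝ, 0 ≤ r → (1 + r) ^ 2 ≤ 4 * (1 + r ^ 4) ∧ 1 + r ≤ 2 * (1 + r ^ 4) := by
    intro r hr
    have h6 : 0 ≤ (r ^ 2 - 1) ^ 2 := sq_nonneg _
    have h7 : 0 ≤ (r - 1) ^ 2 := sq_nonneg _
    constructor <;> nlinarith
  have hlin : ∀ f : Vec d → ℝ, LinearGrowth f → ∃ C : ℝ, ∀ x, |f x| ≤ C * (1 + ‖x‖ ^ 4) := by
    rintro f ⟨-, h0, C, hC⟩
    refine ⟨C * 2, fun x => ?_⟩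
    rw [abs_of_nonneg (h0 x)]
    have hC0 : 0 ≤ C := by
      have := (h0 0).trans (hC 0)
      simpa using this
    have := mul_le_mul_of_nonneg_left (hpoly ‖x‖ (norm_nonneg x)).2 hC0
    linarith [hC x]
  have hlinsq : ∀ f : Vec d → ℝ, LinearGrowth f →
      ∃ C : ℝ, ∀ x, |f x ^ 2| ≤ C * (1 + ‖x‖ ^ 4) := by
    rintro f ⟨-, h0, C, hC⟩
    refine ⟨C ^ 2 * 4, fun x => ?_⟩
    rw [abs_of_nonneg (sq_nonneg _)]
    have h8 : f x ^ 2 ≤ (C * (1 + ‖x‖)) ^ 2 := pow_le_pow_left₀ (h0 x) (hC x) 2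
    have := mul_le_mul_of_nonneg_left (hpoly ‖x‖ (norm_nonneg x)).1 (sq_nonneg C)
    nlinarith
  -- the permuted samples are asymptotically homogeneous
  have hpermlim : ∀ f : Vec d → ℝ, LinearGrowth f →
      FrontLimit (permFilter (probFilter P) Prod.fst) (fun q => q.1.1) (fun q => q.1.1)
        (fun q i => Z q.1.1 (q.2 i) q.1.2) f 1 (∫ x, f x ∂μ) := fun f hf =>
    frontLimit_perm (z := fun (k : ℕ × Ω) i => Z k.1 i k.2) hl.fst
      (htotal f hf.1 hf.2.1 (hlin f hf))
      (htotal (fun x => f x ^ 2) (hf.1.pow_const 2) (fun x => sq_nonneg _) (hlinsq f hf))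
  have hpermsq : FrontLimit (permFilter (probFilter P) Prod.fst) (fun q => q.1.1) (fun q => q.1.1)
      (fun q i => Z q.1.1 (q.2 i) q.1.2) (fun x => ‖x‖ ^ 2) 1 (∫ x, ‖x‖ ^ 2 ∂μ) :=
    frontLimit_perm (z := fun (k : ℕ × Ω) i => Z k.1 i k.2) hl.fst
      (htotal (fun x => ‖x‖ ^ 2) (by fun_prop) (fun x => sq_nonneg _)
        (hlinsq _ linearGrowth_norm))
      -- The permutation variance of sums of `‖x‖²` involves `‖x‖⁴`; this is the test function that
      -- requires sixteen moments.
      (htotal (fun x => (‖x‖ ^ 2) ^ 2) (by fun_prop) (fun x => sq_nonneg _)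
        ⟨1, fun x => by
          rw [abs_of_nonneg (sq_nonneg _), ← pow_mul, one_mul]
          exact le_add_of_nonneg_left zero_le_one⟩)
  have hfst : Tendsto (fun q : (Σ k : ℕ × Ω, Equiv.Perm (Fin k.1)) => q.1.1)
      (permFilter (probFilter P) Prod.fst) atTop := hl.fst.comp tendsto_fst_permFilter
  -- A maximising split is selected for each permuted sample, so that convergence along every
  -- selection controls the maximum. The value `0` is a default for an empty range.
  have hsel : ∀ q : (Σ k : ℕ × Ω, Equiv.Perm (Fin k.1)), ∃ t, (searchRange q.1.1 (δ q.1.1)).Nonempty →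
      t ∈ searchRange q.1.1 (δ q.1.1) ∧
      testStatistic (δ q.1.1) (fun i => Z q.1.1 (q.2 i) q.1.2) ≤
        criterion (fun i => Z q.1.1 (q.2 i) q.1.2) t := by
    intro q
    by_cases hne : (searchRange q.1.1 (δ q.1.1)).Nonempty
    · obtain ⟨t, ht⟩ := exists_testStatistic_le (fun i => Z q.1.1 (q.2 i) q.1.2) hne
      exact ⟨t, fun _ => ht⟩
    · exact ⟨0, fun hne' => absurd hne' hne⟩
  choose t ht using hsel
  have hlim := tendsto_criterion_of_homogeneous (t := t) hμi hfst (hm.comp hfst) hpermlim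
    hpermsq (by
      filter_upwards [hfst.eventually hrange] with q hq
      exact hq.2 _ (ht q ⟨_, hq.1⟩).1)
  filter_upwards [hlim.eventually (gt_mem_nhds hx), hfst.eventually hrange]
    with q hq1 hq2
  exact (ht q ⟨_, hq2.1⟩).2.trans hq1.le

/-- The event may fail to be measurable, so subadditivity of the outer measure replaces the formula
for the complement. -/
lemma tendsto_measure_one_of_eventually {p : ℕ × Ω → Prop} (h : ∀ᶠ k in probFilter P, p k) :
    Tendsto (fun n : ℕ => P {ω | p (n, ω)}) atTop (𝓝 1) := by
  rw [eventually_probFilter] at h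
  have hlow : Tendsto (fun n : ℕ => 1 - P {ω | ¬ p (n, ω)}) atTop (𝓝 1) := by
    simpa using ENNReal.Tendsto.sub tendsto_const_nhds h (Or.inl ENNReal.one_ne_top)
  refine tendsto_of_tendsto_of_tendsto_of_le_of_le hlow tendsto_const_nhds (fun n => ?_)
    fun n => prob_le_one
  rw [tsub_le_iff_right, ← measure_univ (μ := P)]
  refine (measure_mono fun ω _ => ?_).trans (measure_union_le _ _)
  exact em _

/-- Consistency of the permutation test. -/
lemma tendsto_measure_detected (hZ : IsSingleChangeModel P Z (fun n => ⌊(n : ℝ) * θ⌋₊) F₁ F₂)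
    {δ : ℕ → ℝ} (hF : F₁ ≠ F₂) (hθ₀ : 0 < θ) (hθ₁ : θ < 1)
    (hδ : Tendsto δ atTop (𝓝 0)) (hnδ : Tendsto (fun n : ℕ => (n : ℝ) * δ n) atTop atTop)
    {T : ℕ → Ω → ℕ}
    (hT : ∀ (n : ℕ) (ω : Ω), (searchRange n (δ n)).Nonempty →
      IsPotentialChangePoint (δ n) (fun i => Z n i ω) (T n ω))
    (h₁ : MemLp (fun x => x) ((16 : ℕ) : ℝ≥0∞) F₁) (h₂ : MemLp (fun x => x) ((16 : ℕ) : ℝ≥0∞) F₂)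
    {α : ℝ} (hα : 0 < α) :
    Tendsto (fun n : ℕ => P {ω | IsDetectedChangePoint (δ n) α (fun i => Z n i ω) (T n ω)})
      atTop (𝓝 1) := by
  have hl := summableVanish_probFilter P
  have h := twoSidedControl_of_memLp hZ hl hθ₀ hθ₁ (tendsto_searchMargin hnδ)
    (h₁.mono_exponent (by norm_num)) (h₂.mono_exponent (by norm_num))
  have hrange := eventually_searchRange hθ₀ hθ₁ hδ hnδ
  have hchange := h.tendsto_criterion_change
  set S := θ * (1 - θ) * ((meanDist F₁ F₂ - meanDist F₁ F₁) ^ 2 +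
    (meanDist F₁ F₂ - meanDist F₂ F₂) ^ 2) with hS
  have hSpos : 0 < S := by
    have henergy := energy_pos h.integrable_left h.integrable_right hF
    refine mul_pos (mul_pos hθ₀ (by linarith)) ?_
    have h8 := sq_nonneg (meanDist F₁ F₂ - meanDist F₁ F₁)
    have h9 := sq_nonneg (meanDist F₁ F₂ - meanDist F₂ F₂)
    by_contra hcon
    have h10 := pow_eq_zero_iff two_ne_zero |>.1
      (by linarith : (meanDist F₁ F₂ - meanDist F₁ F₁) ^ 2 = 0)
    have h11 := pow_eq_zero_iff two_ne_zero |>.1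
      (by linarith : (meanDist F₁ F₂ - meanDist F₂ F₂) ^ 2 = 0)
    linarith
  have hstat : ∀ᶠ k in probFilter P, S / 2 < testStatistic (δ k.1) (fun i => Z k.1 i k.2) := by
    filter_upwards [hchange.eventually (lt_mem_nhds (half_lt_self hSpos)),
      hl.fst.eventually hrange] with k hk1 hk2
    exact hk1.trans_le (criterion_le_testStatistic _ hk2.1)
  have hperm := eventually_permFilter.1
    (eventually_testStatistic_perm_le hZ hθ₀ hθ₁ hδ hnδ h₁ h₂ (half_pos hSpos))
  -- The proportion of permutations with statistic above `S / 2` tends to zero in probability, hence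
  -- is eventually below `α`.
  have hcut : ∀ᶠ k in probFilter P,
      permutationCutoff (δ k.1) α (fun i => Z k.1 i k.2) ≤ S / 2 := by
    filter_upwards [hperm.eventually (gt_mem_nhds hα)] with k hk
    exact permutationCutoff_le (half_pos hSpos).le (le_of_lt hk)
  refine tendsto_measure_one_of_eventually
    (p := fun k => IsDetectedChangePoint (δ k.1) α (fun i => Z k.1 i k.2) (T k.1 k.2)) ?_
  filter_upwards [hstat, hcut, hl.fst.eventually hrange] with k hk1 hk2 hk3
  exact ⟨hT k.1 k.2 ⟨_, hk3.1⟩, hk2.trans_lt hk1⟩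

end Main

end ChangePoint

theorem theorem1 {Ω : Type*} [MeasurableSpace Ω] (P : Measure Ω) [IsProbabilityMeasure P]
    (d : ℕ) (F₁ F₂ : Measure (ChangePoint.Vec d))
    [IsProbabilityMeasure F₁] [IsProbabilityMeasure F₂] (hF : F₁ ≠ F₂)
    (h₁ : Integrable (fun x => x) F₁) (h₂ : Integrable (fun x => x) F₂)
    (θ : ℝ) (hθ₀ : 0 < θ) (hθ₁ : θ < 1)
    (Z : (n : ℕ) → Fin n → Ω → ChangePoint.Vec d)
    (hZ : ChangePoint.IsSingleChangeModel P Z (fun n => ⌊(n : ℝ) * θ⌋₊) F₁ F₂)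
    (δ : ℕ → ℝ) (hδ : Tendsto δ atTop (𝓝 0))
    (hnδ : Tendsto (fun n : ℕ => (n : ℝ) * δ n) atTop atTop)
    (T : ℕ → Ω → ℕ)
    (hT : ∀ (n : ℕ) (ω : Ω), (ChangePoint.searchRange n (δ n)).Nonempty →
      ChangePoint.IsPotentialChangePoint (δ n) (fun i => Z n i ω) (T n ω)) :
    (ChangePoint.IsNested Z (fun n => ⌊(n : ℝ) * θ⌋₊) →
      ∀ᵐ ω ∂P, Tendsto (fun n : ℕ => (T n ω : ℝ) / n) atTop (𝓝 θ)) ∧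
    (MemLp (fun x => x) 4 F₁ → MemLp (fun x => x) 4 F₂ →
      ∀ᵐ ω ∂P, Tendsto (fun n : ℕ => (T n ω : ℝ) / n) atTop (𝓝 θ)) ∧
    (ChangePoint.IsSubExponential F₁ → ChangePoint.IsSubExponential F₂ →
      ∀ α : ℝ, 0 < α → α < 1 →
        Tendsto (fun n : ℕ => P {ω | ChangePoint.IsDetectedChangePoint (δ n) α
          (fun i => Z n i ω) (T n ω)}) atTop (𝓝 1)) := by
  have hm := ChangePoint.tendsto_searchMargin hnδ
  refine ⟨fun hnest => ?_, fun h4₁ h4₂ => ?_, fun hs₁ hs₂ α hα _ => ?_⟩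
  · exact ChangePoint.ae_tendsto_changePoint hF hθ₀ hθ₁ hδ hnδ hT
      (ChangePoint.twoSidedControl_of_nested hZ hnest hθ₀ hθ₁ hm h₁ h₂)
  · exact ChangePoint.ae_tendsto_changePoint hF hθ₀ hθ₁ hδ hnδ hT
      (ChangePoint.twoSidedControl_of_memLp hZ (ChangePoint.summableVanish_aeFilter P) hθ₀ hθ₁ hm
        h4₁ h4₂)
  -- The argument `7` gives the exponent `2 · (7 + 1) = 16`.
  · exact ChangePoint.tendsto_measure_detected hZ hF hθ₀ hθ₁ hδ hnδ hT (hs₁.memLp 7) (hs₂.memLp 7)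
      hα
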